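/- **Definitions.** Let $V$ be a finite set with $n$ elements and a fixed ordering $v_1,\dots,v_n$; graphs are simple graphs on $V$. Two graphs are edge-neighboring if their edge sets differ in exactly one edge. A randomized algorithm $\mathcal A$ on graphs is $\varepsilon$-edge DP if $\Pr[\mathcal A(G)\in S]\le e^{\varepsilon}\Pr[\mathcal A(G')\in S]$ for all edge-neighboring $G,G'$ and all sets $S$ of outputs. An $\varepsilon_0$-local randomizer for a node $v$ takes the neighborhood $N(v)$ as input and satisfies the same inequality, with parameter $\varepsilon_0$, for any two possible neighborhoods whose symmetric difference has one element. A protocol chooses in each round, from the public transcript alone, a set of parties and a local randomizer (with some finite parameter) for each of them, or stops; the parties publish the outputs of their randomizers. An algorithm that posts a public billboard is $\varepsilon$-LEDP if its billboard is produced by a terminating protocol whose entire transcript is $\varepsilon$-edge DP. An implicit solution is a family $\mathcal S=(S_v)_{v\in V}$ of public sets $S_v\subseteq V$; on $G=(V,E)$ it encodes the explicit solution $\{\{u,v\}\in E: u\in S_v \text{ or } v\in S_u\}$, of which every node $v$ can decode its own part from $\mathcal S$ and $N(v)$. A $b$-matching of $G$ is a set of edges of $G$ such that every vertex lies on at most $b$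 of them; $\mathrm{OPT}_G(b)$ is the maximum number of edges of a $b$-matching. $\mathrm{Lap}(s)$ is the centered Laplace distribution of scale $s$. **Algorithm** (inputs $G$, $\varepsilon$, $\eta$, $c$, $b$). Let $\varepsilon'=\frac{\varepsilon}{2(1+2\eta)/\eta}$. For every pair $u\ne v$ and every $r=0,\dots,\lceil\log_{1+\eta} n\rceil$, flip and release a coin $coin(u,v,r)$ that is heads with probability $(1+\eta)^{-r}$. For every $u\in V$ let $\tilde b(u)=b-36c\ln(n)/\varepsilon'+\mathrm{Lap}(4/\varepsilon')$, $M(u)=\emptyset$, $A(u)=\infty$. For $i=1,\dots,n$, with $v=v_i$: (1) every $u$ with $A(u)>i$ draws $\nu_i(u)\sim\mathrm{Lap}(8/\varepsilon')$ and, if $|M(u)|+\nu_i(u)\ge\tilde b(u)$, releases $A(u)\leftarrow i$. (2) If still $A(v)>i$, let $W_r(v)$ be the set of neighbors $u$ of $v$ with $A(u)>i$ that come after $v$ in the ordering and have $coin(u,v,r)$ heads, let $\widetilde W_r=|W_r(v)|+\mathrm{Lap}(2/\varepsilon')$ for each $r$ and $\widetilde M=|M(v)|+\mathrm{Lap}(2/\varepsilon')$,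 and release $r_v=\min\{r:\widetilde M+\widetilde W_r+12c\ln(n)/\varepsilon'\le b\}$; then add $v$ to $M(u)$ and $u$ to $M(v)$ for all $u\in W_{r_v}(v)$ (nothing is matched if there is no such $r$). All random draws are independent. The billboard consists of the coins, the times $A(u)$ and the indices $r_v$. The implicit solution read off from it is $S_{v_i}=\{u : u \text{ after } v_i,\ A(u)>i,\ coin(u,v_i,r_{v_i})\text{ heads}\}$ (empty if $v_i$ released no index). **Theorem.** Let $\varepsilon,\eta\in(0,1)$, let $c\ge 3$ be real and let $b$ be a natural number. 1. The algorithm is $\varepsilon$-LEDP, and in every run the final sets $M(v)$ are exactly the sets of neighbors of $v$ in the explicit solution $M$ encoded by the implicit solution on the billboard. 2. Let $b'\ge 1$ be an integer with $b\ge\frac{(1+\eta)^2}{1-\eta}\,b'+\frac{576\,c\ln n}{\eta^2\varepsilon}$. Then for every graph $G$ on $V$, with probability at least $1-\frac1{n^c}$, $M$ is a $b$-matching of $G$ and $|M|\ge\frac12\mathrm{OPT}_G(b')$. 3. If $\eta<\frac12$ and $b\ge\frac{576\,c\ln n}{\eta^3\varepsilon}$, then for every graph $G$ on $V$, with probability at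 least $1-\frac1{n^c}$, $M$ is a $b$-matching of $G$ and $(2+24\eta)\,|M|\ge\mathrm{OPT}_G(b)$. -/

import Mathlib

open MeasureTheory
open scoped ENNReal NNReal

noncomputable section

namespace PrivateMatching

/-! ### Edge privacy and the local (LEDP) model -/

/-- Two graphs on the same vertex set are edge-neighboring if they differ in exactly one edge. -/
def EdgeNeighboring {V : Type*} (G G' : SimpleGraph V) : Prop :=
  ∃ e : Sym2 V, symmDiff G.edgeSet G'.edgeSet = {e}

/-- Pure `ε`-edge differential privacy of a randomized graph algorithm with discrete outputs. -/
def EdgeDP {V α : Type*} (ε : ℝ) (alg : SimpleGraph V → PMF α) : Prop :=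
  ∀ G G' : SimpleGraph V, EdgeNeighboring G G' → ∀ S : Set α,
    (alg G).toOuterMeasure S ≤ ENNReal.ofReal (Real.exp ε) * (alg G').toOuterMeasure S

/-- An `eps`-local randomizer for the node `v`: a randomized map from the possible neighborhoods
of `v` to outputs, which is `eps`-differentially private with respect to changing the
neighborhood in a single element. -/
structure LocalRandomizer (V Y : Type*) (v : V) where
  eps : ℝ≥0
  law : Set V → PMF Y
  isPrivate : ∀ a a' : Set V, v ∉ a → v ∉ a' → (∃ w, symmDiff a a' = {w}) → ∀ S : Set Y,
    (law a).toOuterMeasure S ≤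
      ENNReal.ofReal (Real.exp (eps : ℝ)) * (law a').toOuterMeasure S

/-- The choices made for one round: the nodes `v` with `asg v = some R` are the parties of the
round, `R` is the local randomizer assigned to `v`, and `R.eps` its privacy parameter. -/
abbrev Assignment (V Y : Type*) := (v : V) → Option (LocalRandomizer V Y v)

/-- A transcript: for each round, in order, the outputs published by the parties of that round
(`none` for the other nodes). The remaining entries of a round (its parties, randomizers and
privacy parameters) are a fixed function of the earlier outputs, through the protocol. -/
abbrev Transcript (V Y : Type*) := List (V → Option Y)

/-- A protocol looks at the public transcript only and chooses the next round; `none` stands for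
the end of the computation. -/
abbrev Protocol (V Y : Type*) := Transcript V Y → Option (Assignment V Y)

/-- Independent product of finitely many discrete laws on finite types. -/
def piPMF {V Z : Type*} [Fintype V] [Fintype Z] (p : V → PMF Z) : PMF (V → Z) :=
  letI : DecidableEq V := Classical.decEq V
  PMF.ofFintype (fun f => ∏ v, p v (f v)) (by
    have h := Finset.prod_univ_sum (fun _ : V => (Finset.univ : Finset Z)) (fun v y => p v y)
    rw [Fintype.piFinset_univ] at h
    rw [← h]
    refine Finset.prod_eq_one fun v _ => ?_
    rw [← tsum_fintype (L := .unconditional Z)]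
    exact (p v).tsum_coe)

/-- The outputs of one round on the graph `G`: every party applies its randomizer to its own
neighborhood, with independent randomness. -/
def roundLaw {V Y : Type*} [Fintype V] [Fintype Y] (G : SimpleGraph V) (asg : Assignment V Y) :
    PMF (V → Option Y) :=
  piPMF fun v =>
    match asg v with
    | none => PMF.pure none
    | some R => (R.law (G.neighborSet v)).map some

/-- The law of the transcript of a protocol on `G` after at most `T` rounds. -/
def transcriptLaw {V Y : Type*} [Fintype V] [Fintype Y] (P : Protocol V Y) (G : SimpleGraph V) :
    ℕ → PMF (Transcript V Y)
  | 0 => PMF.pure []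
  | T + 1 => (transcriptLaw P G T).bind fun π =>
      match P π with
      | none => PMF.pure π
      | some asg => (roundLaw G asg).map fun y => π ++ [y]

/-- `law G S` is the probability that the billboard which an algorithm posts on input `G` lies in
`S`. The algorithm is `ε`-LEDP if this billboard is produced by a (terminating) protocol of local
randomizers whose entire transcript is `ε`-edge differentially private: the billboard is read off
from the transcript by a map that does not depend on the graph. -/
def IsLEDP {V B : Type*} [Fintype V] (ε : ℝ) (law : SimpleGraph V → Set B → ℝ≥0∞) : Prop :=
  ∃ (Y : Type) (_ : Fintype Y) (P : Protocol V Y) (T : ℕ) (read : Transcript V Y → B),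
    (∀ G, ∀ π ∈ (transcriptLaw P G T).support, P π = none) ∧
    EdgeDP ε (fun G => transcriptLaw P G T) ∧
    ∀ G, ∀ S : Set B, ((transcriptLaw P G T).map read).toOuterMeasure S = law G S

/-! ### `b`-matchings and implicit solutions -/

/-- `F` is (the edge set of) a `b`-matching of `G`. -/
def IsBMatching {V : Type*} (G : SimpleGraph V) (b : ℕ) (F : SimpleGraph V) : Prop :=
  F ≤ G ∧ ∀ v, (F.neighborSet v).ncard ≤ b

/-- The number of edges of a maximum `b`-matching of the (finite) graph `G`. -/
def optBMatching {V : Type*} (G : SimpleGraph V) (b : ℕ) : ℕ :=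
  sSup {k | ∃ F : SimpleGraph V, IsBMatching G b F ∧ F.edgeSet.ncard = k}

/-- The explicit solution encoded by the implicit solution `S`: the intersection of `G` with the
graph in which `u ≠ v` are joined when `u ∈ S v` or `v ∈ S u`. -/
def implicitGraph {V : Type*} (G : SimpleGraph V) (S : V → Set V) : SimpleGraph V :=
  G ⊓ SimpleGraph.fromRel fun u v => u ∈ S v

/-! ### The algorithm -/

/-- The centered Laplace distribution with scale `s`. -/
def laplace (s : ℝ) : Measure ℝ :=
  volume.withDensity fun x => ENNReal.ofReal (1 / (2 * s) * Real.exp (-|x| / s))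

/-- A coin with success probability `p`. -/
def coinLaw (p : ℝ) : Measure Bool :=
  ENNReal.ofReal p • Measure.dirac true + ENNReal.ofReal (1 - p) • Measure.dirac false

/-- Numerical inputs of the algorithm. -/
structure Params where
  eps : ℝ
  eta : ℝ
  c : ℝ
  b : ℕ

/-- The internal privacy parameter `ε' = ε / (2 (1 + 2 η) / η)`. -/
def Params.eps' (p : Params) : ℝ := p.eps / (2 * (1 + 2 * p.eta) / p.eta)

/-- The number of subgraph indices `r = 0, …, ⌈log_{1+η} n⌉`. -/
def Params.numIdx (p : Params) (n : ℕ) : ℕ := ⌈Real.logb (1 + p.eta) n⌉₊ + 1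

/-- All the random draws of a run on a vertex set `V` of size `n`. (The coins of a degenerate
pair `s(v, v)` are never used.) -/
abbrev Randomness (p : Params) (V : Type*) (n : ℕ) :=
  (Sym2 V → Fin (p.numIdx n) → Bool) × (V → ℝ) × (Fin n → V → ℝ) ×
    (V → Fin (p.numIdx n) → ℝ) × (V → ℝ)

namespace Randomness

variable {p : Params} {V : Type*} {n : ℕ}

/-- `coin(u, v, r)`; `true` is heads. -/
def coin (ω : Randomness p V n) (e : Sym2 V) (r : Fin (p.numIdx n)) : Bool := ω.1 e r
/-- The noise in the threshold of `u`. -/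
def thresholdNoise (ω : Randomness p V n) (u : V) : ℝ := ω.2.1 u
/-- The noise `ν_i(u)`. -/
def checkNoise (ω : Randomness p V n) (i : Fin n) (u : V) : ℝ := ω.2.2.1 i u
/-- The noise in the estimate of `|W_r(v)|`. -/
def sizeNoise (ω : Randomness p V n) (v : V) (r : Fin (p.numIdx n)) : ℝ := ω.2.2.2.1 v r
/-- The noise in the estimate of `|M(v)|`. -/
def degreeNoise (ω : Randomness p V n) (v : V) : ℝ := ω.2.2.2.2 v

end Randomness

/-- The law of the random draws: all of them are independent, a coin with index `r` is heads with
probability `(1 + η)^(-r)`, and the noises are Laplace of scales `4/ε'`, `8/ε'`, `2/ε'`,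
`2/ε'`. -/
def randomnessLaw (p : Params) (V : Type*) [Fintype V] (n : ℕ) : Measure (Randomness p V n) :=
  (Measure.pi fun _ : Sym2 V => Measure.pi fun r : Fin (p.numIdx n) =>
      coinLaw (((1 + p.eta) ^ (r : ℕ))⁻¹)).prod <|
  (Measure.pi fun _ : V => laplace (4 / p.eps')).prod <|
  (Measure.pi fun _ : Fin n => Measure.pi fun _ : V => laplace (8 / p.eps')).prod <|
  (Measure.pi fun _ : V => Measure.pi fun _ : Fin (p.numIdx n) => laplace (2 / p.eps')).prod <|
  (Measure.pi fun _ : V => laplace (2 / p.eps'))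

/-- The variables of the algorithm: the (private) sets `M(u)`, the times `A(u)` (with `⊤` for
`∞`), and the released subgraph indices `r_v` (with `⊤` if no index was released). -/
structure State (p : Params) (V : Type*) (n : ℕ) where
  M : V → Finset V
  A : V → WithTop (Fin n)
  idx : V → WithTop (Fin (p.numIdx n))

section Algorithm

variable {p : Params} {V : Type*} [Fintype V] {n : ℕ}

/-- The noisy threshold `b̃(u) = b - 36 c ln(n)/ε' + Lap(4/ε')`. -/
def noisyThreshold (ω : Randomness p V n) (u : V) : ℝ :=
  p.b - 36 * p.c * Real.log n / p.eps' + ω.thresholdNoise u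

open Classical in
/-- The first part of iteration `i`: every node that has not satisfied its matching condition
compares its noisy number of matches with its noisy threshold. -/
def checkConditions (ω : Randomness p V n) (i : Fin n) (s : State p V n) : State p V n :=
  { s with
    A := fun u =>
      if (i : WithTop (Fin n)) < s.A u ∧
          noisyThreshold ω u ≤ ((s.M u).card : ℝ) + ω.checkNoise i u
      then (i : WithTop (Fin n)) else s.A u }

open Classical in
/-- `W_r(v_i)`: the still active neighbors of `v_i` that come later in the ordering and whose coin
with index `r` is heads. -/
def proposalSet (ord : Fin n ≃ V) (G : SimpleGraph V) (ω : Randomness p V n) (i : Fin n)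
    (A : V → WithTop (Fin n)) (r : Fin (p.numIdx n)) : Finset V :=
  Finset.univ.filter fun u =>
    (i : WithTop (Fin n)) < A u ∧ i < ord.symm u ∧ G.Adj u (ord i) ∧
      ω.coin s(u, ord i) r = true

open Classical in
/-- `r_v` for `v = v_i`: the least index `r` whose noisy size estimate passes the test; `⊤` if
there is none. -/
def chooseIdx (ord : Fin n ≃ V) (G : SimpleGraph V) (ω : Randomness p V n) (i : Fin n)
    (s : State p V n) : WithTop (Fin (p.numIdx n)) :=
  (Finset.univ.filter fun r : Fin (p.numIdx n) =>
    (((s.M (ord i)).card : ℝ) + ω.degreeNoise (ord i)) +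
      (((proposalSet ord G ω i s.A r).card : ℝ) + ω.sizeNoise (ord i) r) +
      12 * p.c * Real.log n / p.eps' ≤ p.b).min

open Classical in
/-- The second part of iteration `i`: if `v = v_i` is still active, it releases `r_v` and is
matched to all of `W_{r_v}(v)`. If no index passes the test, nothing is matched. -/
def propose (ord : Fin n ≃ V) (G : SimpleGraph V) (ω : Randomness p V n) (i : Fin n)
    (s : State p V n) : State p V n :=
  if (i : WithTop (Fin n)) < s.A (ord i) then
    let rv := chooseIdx ord G ω i s
    let W : Finset V := rv.recTopCoe ∅ fun r => proposalSet ord G ω i s.A r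
    { M := fun u =>
        if u = ord i then s.M u ∪ W else if u ∈ W then insert (ord i) (s.M u) else s.M u
      A := s.A
      idx := Function.update s.idx (ord i) rv }
  else s

/-- The final state of a run with vertex ordering `v_i = ord i` and random draws `ω`. -/
def run (ord : Fin n ≃ V) (G : SimpleGraph V) (ω : Randomness p V n) : State p V n :=
  (List.finRange n).foldl (fun s i => propose ord G ω i (checkConditions ω i s))
    { M := fun _ => ∅, A := fun _ => ⊤, idx := fun _ => ⊤ }

end Algorithm

/-- The public billboard: the coins, the times `A(u)` and the subgraph indices `r_v`. -/
structure Billboard (p : Params) (V : Type*) (n : ℕ) where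
  coin : Sym2 V → Fin (p.numIdx n) → Bool
  A : V → WithTop (Fin n)
  idx : V → WithTop (Fin (p.numIdx n))

/-- The information released by a run. -/
def billboard {p : Params} {V : Type*} [Fintype V] {n : ℕ} (ord : Fin n ≃ V)
    (G : SimpleGraph V) (ω : Randomness p V n) : Billboard p V n :=
  { coin := ω.coin, A := (run ord G ω).A, idx := (run ord G ω).idx }

/-- The probability that the billboard lies in `S`. -/
def billboardLaw (p : Params) {V : Type*} [Fintype V] {n : ℕ} (ord : Fin n ≃ V)
    (G : SimpleGraph V) (S : Set (Billboard p V n)) : ℝ≥0∞ :=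
  randomnessLaw p V n {ω | billboard ord G ω ∈ S}

/-- The implicit solution on the billboard. The public set of `v = v_i` consists of the nodes `u`
which come later in the ordering, were active in iteration `i`, and whose coin `coin(u, v, r_v)`
is heads; it is empty if `v` released no index. -/
def Billboard.implicitSolution {p : Params} {V : Type*} {n : ℕ} (ord : Fin n ≃ V)
    (B : Billboard p V n) (v : V) : Set V :=
  {u | (ord.symm v : WithTop (Fin n)) < B.A u ∧ ord.symm v < ord.symm u ∧
    ∃ r : Fin (p.numIdx n), B.idx v = (r : WithTop (Fin (p.numIdx n))) ∧ B.coin s(u, v) r = true}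

/-- The explicit solution which the nodes decode from the billboard: `v` intersects the graph of
the implicit solution with its own neighborhood. -/
def Billboard.decode {p : Params} {V : Type*} {n : ℕ} (ord : Fin n ≃ V)
    (B : Billboard p V n) (G : SimpleGraph V) : SimpleGraph V :=
  implicitGraph G (B.implicitSolution ord)

end PrivateMatching

end

/-!
The theorem has a privacy part and a utility part.

**Privacy.** In the algorithm a node keeps its noises over several rounds (the noisy threshold is
reused in all checks), whereas local randomizers have no memory. This is bridged in general by
`isLEDP_of_nodePrivate`: if every node publishes functions of its neighborhood, the transcript and
private randomness `ω v` drawn once and for all, then, for a fixed transcript, the set of those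
`ω v` which are `consistent` with it depends on `v` alone. So the law of the transcript is a product
over the nodes, and each message can as well be redrawn from its conditional law given the earlier
ones. If the consistency probability of a single node is `ε`-private, the conditional laws are
`2ε`-local randomizers, and the transcript is `2ε`-edge private, as an edge affects two nodes.

For a single node, `nodePrivate_nodeOutput` is a sparse vector argument. A node publishes an
unbounded number of answers, but for a fixed transcript only one check and one index test are
answered positively. Shifting the threshold and the degree noise by `1`, and the noises of these two
queries by `2`, maps the randomness consistent for one neighborhood into that for a neighboring one
(`shiftNoise_mem_consistent`); the Laplace scales make this cost `2ε'`. It matters here that the sum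
of `|M(v)|` and `|W_r(v)|` changes by at most one: when `v` proposes, its partners come earlier in
the ordering, and the nodes to which it proposes come later. An edge thus costs `4ε' ≤ ε`. That the
nodes can take part with public information only is `runUpTo_M_eq`: the private sets `M(v)` are at
any time what `v` decodes from the public information, and this is also the second claim.

**Utility.** Suppose that the noises in the checks are small. Then nodes that become inactive have
degree at least `θ` (any `θ` below `b` by a suitable margin), and active nodes have degree less than
`b`. If moreover every proposing node reaches degree at least `θ` or is matched to all active later
neighbors (`GoodProposal`), every edge outside of `M` has an endpoint of degree at least `θ`
(`isBMatching_and_cover`). Charging the edges of an optimal solution to such endpoints gives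
`OPT(k) ≤ 2κ |M|` whenever `k ≤ κθ` (`optBMatching_le_of_cover`).

Proposals are good because `|W_r|` shrinks by a factor of about `1 + η` with each step of `r`: as
the index before the chosen one fails the test, the chosen set is almost as large as the capacity
allows (`GoodRun.goodProposal_of_all_mem`). The concentration of `|W_r|` is a Chernoff bound; it applies
although the set of active neighbors is random, because the coins used by `v_i` are independent of
everything that happened before (`randomnessLaw_adaptive_le`).

The union bound in `success_probability` extends over all indices `r`, whose number is only bounded
by about `2 ln(n) / η`. If this exceeds `2 n`, then the assumption on `b` makes `b` so much larger
than `2 n` that the index `0` always passes, and the other indices need not be considered.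
-/

set_option linter.unusedSectionVars false

noncomputable section

namespace PrivateMatching

/-! ### The run as an iteration -/

section Run

variable {p : Params} {V : Type*} [Fintype V] {n : ℕ}

/-- The state after the first `k` iterations of the algorithm. -/
def runUpTo (ord : Fin n ≃ V) (G : SimpleGraph V) (ω : Randomness p V n) : ℕ → State p V n
  | 0 => { M := fun _ => ∅, A := fun _ => ⊤, idx := fun _ => ⊤ }
  | k + 1 =>
    if h : k < n then
      propose ord G ω ⟨k, h⟩ (checkConditions ω ⟨k, h⟩ (runUpTo ord G ω k))
    else runUpTo ord G ω k

/-- The state in the middle of iteration `i`: the matching conditions have been checked, and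
`v_i` has not proposed yet. -/
def midState (ord : Fin n ≃ V) (G : SimpleGraph V) (ω : Randomness p V n) (i : Fin n) :
    State p V n :=
  checkConditions ω i (runUpTo ord G ω i)

lemma runUpTo_succ (ord : Fin n ≃ V) (G : SimpleGraph V) (ω : Randomness p V n) (i : Fin n) :
    runUpTo ord G ω (i + 1) = propose ord G ω i (midState ord G ω i) := by
  simp [runUpTo, midState]

lemma foldl_finRange_castLE {α : Type*} (f : α → Fin n → α) (a : α) (m : ℕ) (hm : m + 1 ≤ n) :
    (List.finRange (m + 1)).foldl (fun s j => f s (j.castLE hm)) a =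
      f ((List.finRange m).foldl (fun s j => f s (j.castLE (by omega))) a) ⟨m, hm⟩ := by
  rw [List.finRange_succ_last, List.foldl_append, List.foldl_map]
  rfl

lemma run_eq_runUpTo (ord : Fin n ≃ V) (G : SimpleGraph V) (ω : Randomness p V n) :
    run ord G ω = runUpTo ord G ω n := by
  have key : ∀ m, ∀ hm : m ≤ n, (List.finRange m).foldl
      (fun s (j : Fin m) => propose ord G ω (j.castLE hm)
        (checkConditions ω (j.castLE hm) s))
      { M := fun _ => ∅, A := fun _ => ⊤, idx := fun _ => ⊤ } = runUpTo ord G ω m := by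
    intro m
    induction m with
    | zero => intro _; rfl
    | succ m ih =>
      intro hm
      have h := foldl_finRange_castLE
        (fun s (i : Fin n) => propose ord G ω i (checkConditions ω i s))
        { M := fun _ => ∅, A := fun _ => ⊤, idx := fun _ => ⊤ } m hm
      rw [h, ih (by omega)]
      exact (runUpTo_succ ord G ω ⟨m, hm⟩).symm
  exact key n le_rfl

open Classical in
lemma mem_proposalSet {ord : Fin n ≃ V} {G : SimpleGraph V} {ω : Randomness p V n} {i : Fin n}
    {A : V → WithTop (Fin n)} {r : Fin (p.numIdx n)} {u : V} :
    u ∈ proposalSet ord G ω i A r ↔ (i : WithTop (Fin n)) < A u ∧ i < ord.symm u ∧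
      G.Adj u (ord i) ∧ ω.coin s(u, ord i) r = true := by
  simp [proposalSet]

lemma checkConditions_M (ω : Randomness p V n) (i : Fin n) (s : State p V n) :
    (checkConditions ω i s).M = s.M := rfl

lemma checkConditions_idx (ω : Randomness p V n) (i : Fin n) (s : State p V n) :
    (checkConditions ω i s).idx = s.idx := rfl

open Classical in
lemma checkConditions_A (ω : Randomness p V n) (i : Fin n) (s : State p V n) (u : V) :
    (checkConditions ω i s).A u =
      if (i : WithTop (Fin n)) < s.A u ∧
          noisyThreshold ω u ≤ ((s.M u).card : ℝ) + ω.checkNoise i u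
      then (i : WithTop (Fin n)) else s.A u := rfl

lemma propose_A (ord : Fin n ≃ V) (G : SimpleGraph V) (ω : Randomness p V n) (i : Fin n)
    (s : State p V n) : (propose ord G ω i s).A = s.A := by
  unfold propose
  split_ifs <;> rfl

open Classical in
lemma propose_idx (ord : Fin n ≃ V) (G : SimpleGraph V) (ω : Randomness p V n) (i : Fin n)
    (s : State p V n) :
    (propose ord G ω i s).idx = if (i : WithTop (Fin n)) < s.A (ord i) then
      Function.update s.idx (ord i) (chooseIdx ord G ω i s) else s.idx := by
  unfold propose
  split_ifs <;> rfl

/-- The set of nodes to which `v_i` is matched in iteration `i`, if it proposes. -/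
def chosenSet (ord : Fin n ≃ V) (G : SimpleGraph V) (ω : Randomness p V n) (i : Fin n)
    (s : State p V n) : Finset V :=
  (chooseIdx ord G ω i s).recTopCoe ∅ fun r => proposalSet ord G ω i s.A r

lemma mem_chosenSet {ord : Fin n ≃ V} {G : SimpleGraph V} {ω : Randomness p V n} {i : Fin n}
    {s : State p V n} {u : V} :
    u ∈ chosenSet ord G ω i s ↔ ∃ r : Fin (p.numIdx n),
      chooseIdx ord G ω i s = (r : WithTop (Fin (p.numIdx n))) ∧
      u ∈ proposalSet ord G ω i s.A r := by
  unfold chosenSet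
  cases h : chooseIdx ord G ω i s with
  | top => simp
  | coe r => simp

open Classical in
lemma propose_M_of_active {ord : Fin n ≃ V} {G : SimpleGraph V} {ω : Randomness p V n} {i : Fin n}
    {s : State p V n} (h : (i : WithTop (Fin n)) < s.A (ord i)) (u : V) :
    (propose ord G ω i s).M u =
      if u = ord i then s.M u ∪ chosenSet ord G ω i s
      else if u ∈ chosenSet ord G ω i s then insert (ord i) (s.M u) else s.M u := by
  unfold propose
  rw [if_pos h]
  rfl

lemma propose_of_inactive {ord : Fin n ≃ V} {G : SimpleGraph V} {ω : Randomness p V n} {i : Fin n}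
    {s : State p V n} (h : ¬ (i : WithTop (Fin n)) < s.A (ord i)) :
    propose ord G ω i s = s := by
  unfold propose
  rw [if_neg h]

lemma M_subset_propose_M (ord : Fin n ≃ V) (G : SimpleGraph V) (ω : Randomness p V n) (i : Fin n)
    (s : State p V n) (u : V) : s.M u ⊆ (propose ord G ω i s).M u := by
  classical
  by_cases h : (i : WithTop (Fin n)) < s.A (ord i)
  · rw [propose_M_of_active h]
    split_ifs
    · exact Finset.subset_union_left
    · exact Finset.subset_insert _ _
    · exact subset_rfl
  · rw [propose_of_inactive h]

lemma runUpTo_M_subset_succ (ord : Fin n ≃ V) (G : SimpleGraph V) (ω : Randomness p V n) (k : ℕ)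
    (u : V) : (runUpTo ord G ω k).M u ⊆ (runUpTo ord G ω (k + 1)).M u := by
  by_cases h : k < n
  · have := runUpTo_succ ord G ω ⟨k, h⟩
    simp only at this
    rw [this]
    exact M_subset_propose_M ord G ω ⟨k, h⟩ (midState ord G ω ⟨k, h⟩) u
  · simp [runUpTo, h]

lemma runUpTo_M_mono (ord : Fin n ≃ V) (G : SimpleGraph V) (ω : Randomness p V n) (u : V) :
    Monotone fun k => (runUpTo ord G ω k).M u :=
  monotone_nat_of_le_succ fun k => runUpTo_M_subset_succ ord G ω k u

/-- To prove a property of all the states `runUpTo k`, it suffices to treat the two parts of an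
iteration one after the other. -/
lemma runUpTo_induction {ord : Fin n ≃ V} {G : SimpleGraph V} {ω : Randomness p V n}
    {Q : ℕ → State p V n → Prop} (h0 : Q 0 (runUpTo ord G ω 0))
    (hstep : ∀ i : Fin n, Q i (runUpTo ord G ω i) →
      Q (i + 1) (propose ord G ω i (midState ord G ω i))) :
    ∀ k, k ≤ n → Q k (runUpTo ord G ω k) := by
  intro k
  induction k with
  | zero => intro _; exact h0
  | succ k ih =>
    intro hk
    have := hstep ⟨k, hk⟩ (ih (by omega))
    rwa [← runUpTo_succ] at this

lemma runUpTo_idx_eq_top (ord : Fin n ≃ V) (G : SimpleGraph V) (ω : Randomness p V n) (k : ℕ)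
    (hk : k ≤ n) (j : Fin n) (h : k ≤ j) : (runUpTo ord G ω k).idx (ord j) = ⊤ := by
  refine runUpTo_induction (ord := ord) (G := G) (ω := ω)
    (Q := fun k s => ∀ j : Fin n, k ≤ j → s.idx (ord j) = ⊤)
    ?_ ?_ k hk j h
  · intro j h
    simp [runUpTo]
  · intro i ih j h
    have hij : ord j ≠ ord i := fun h' => by
      have := ord.injective h'
      subst this
      omega
    have := ih j (by omega)
    classical
    rw [propose_idx, midState, checkConditions_idx]
    split_ifs
    · rw [Function.update_of_ne hij, this]
    · exact this

/-- The first part of an iteration `i` does not change who was active in earlier iterations. -/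
lemma lt_checkConditions_A_iff (ω : Randomness p V n) (i j : Fin n) (s : State p V n) (u : V)
    (hij : j < i) : (j : WithTop (Fin n)) < (checkConditions ω i s).A u ↔
      (j : WithTop (Fin n)) < s.A u := by
  rw [checkConditions_A]
  split_ifs with h
  · have h1 : (j : WithTop (Fin n)) < (i : WithTop (Fin n)) := WithTop.coe_lt_coe.2 hij
    exact ⟨fun _ => h1.trans h.1, fun _ => h1⟩
  · rfl

/-- A node is active in the second part of iteration `i` exactly if its final time exceeds
`i`. -/
lemma lt_runUpTo_A_iff (ord : Fin n ≃ V) (G : SimpleGraph V) (ω : Randomness p V n) (k : ℕ)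
    (hk : k ≤ n) (i : Fin n) (hi : (i : ℕ) < k) (u : V) :
    (i : WithTop (Fin n)) < (runUpTo ord G ω k).A u ↔
      (i : WithTop (Fin n)) < (midState ord G ω i).A u := by
  refine runUpTo_induction (ord := ord) (G := G) (ω := ω)
    (Q := fun k s => ∀ i : Fin n, (i : ℕ) < k → ((i : WithTop (Fin n)) < s.A u ↔
      (i : WithTop (Fin n)) < (midState ord G ω i).A u)) ?_ ?_ k hk i hi
  · intro i hi
    omega
  · intro j ih i hi
    rw [propose_A]
    rcases Nat.lt_succ_iff_lt_or_eq.1 hi with h | h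
    · rw [midState, lt_checkConditions_A_iff ω j i _ u h, ih i h]
    · rw [Fin.ext h]

/-! ### Decoding the matching from the public information -/

/-- The public part of a state. -/
def publicPart (ω : Randomness p V n) (s : State p V n) : Billboard p V n :=
  { coin := ω.coin, A := s.A, idx := s.idx }

open Classical in
/-- What a node `v` with neighborhood `a` decodes from the public information `B`: the set of its
partners. -/
def localMatches (ord : Fin n ≃ V) (a : Set V) (B : Billboard p V n) (v : V) : Finset V :=
  Finset.univ.filter fun w =>
    w ∈ a ∧ (w ∈ B.implicitSolution ord v ∨ v ∈ B.implicitSolution ord w)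

lemma mem_localMatches {ord : Fin n ≃ V} {a : Set V} {B : Billboard p V n} {v w : V} :
    w ∈ localMatches ord a B v ↔
      w ∈ a ∧ (w ∈ B.implicitSolution ord v ∨ v ∈ B.implicitSolution ord w) := by
  simp [localMatches]

lemma coe_localMatches (ord : Fin n ≃ V) (G : SimpleGraph V) (B : Billboard p V n) (v : V) :
    (localMatches ord (G.neighborSet v) B v : Set V) = (B.decode ord G).neighborSet v := by
  ext w
  simp only [Finset.mem_coe, mem_localMatches, SimpleGraph.mem_neighborSet, Billboard.decode,
    implicitGraph, SimpleGraph.inf_adj, SimpleGraph.fromRel_adj]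
  constructor
  · rintro ⟨h, h'⟩
    exact ⟨h, h.ne, h'.symm⟩
  · rintro ⟨h, _, h'⟩
    exact ⟨h, h'.symm⟩

lemma mem_implicitSolution {ord : Fin n ≃ V} {B : Billboard p V n} {u v : V} :
    u ∈ B.implicitSolution ord v ↔ (ord.symm v : WithTop (Fin n)) < B.A u ∧
      ord.symm v < ord.symm u ∧ ∃ r : Fin (p.numIdx n),
        B.idx v = (r : WithTop (Fin (p.numIdx n))) ∧ B.coin s(u, v) r = true := Iff.rfl

/-- The first part of an iteration does not change the implicit solution: the nodes which proposed
did so in earlier iterations. -/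
lemma implicitSolution_midState (ord : Fin n ≃ V) (G : SimpleGraph V) (ω : Randomness p V n)
    (i : Fin n) (v : V) :
    (publicPart ω (midState ord G ω i)).implicitSolution ord v =
      (publicPart ω (runUpTo ord G ω i)).implicitSolution ord v := by
  ext u
  simp only [mem_implicitSolution, publicPart, midState, checkConditions_idx]
  by_cases hv : ord.symm v < i
  · rw [lt_checkConditions_A_iff ω i _ _ u hv]
  · have := runUpTo_idx_eq_top ord G ω i i.2.le (ord.symm v) (not_lt.1 hv)
    rw [Equiv.apply_symm_apply] at this
    simp [this]

lemma implicitSolution_propose_self {ord : Fin n ≃ V} {G : SimpleGraph V} {ω : Randomness p V n}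
    {i : Fin n} {s : State p V n} (h : (i : WithTop (Fin n)) < s.A (ord i)) (u : V)
    (hu : G.Adj u (ord i)) :
    u ∈ (publicPart ω (propose ord G ω i s)).implicitSolution ord (ord i) ↔
      u ∈ chosenSet ord G ω i s := by
  simp only [mem_implicitSolution, publicPart, propose_A, propose_idx, if_pos h,
    Function.update_self, mem_chosenSet, mem_proposalSet, Equiv.symm_apply_apply, hu, true_and]
  constructor
  · rintro ⟨h1, h2, r, h3, h4⟩
    exact ⟨r, h3, h1, h2, h4⟩
  · rintro ⟨r, h3, h1, h2, h4⟩
    exact ⟨h1, h2, r, h3, h4⟩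

lemma implicitSolution_propose_of_ne {ord : Fin n ≃ V} {G : SimpleGraph V} {ω : Randomness p V n}
    {i : Fin n} {s : State p V n} {v : V} (hv : v ≠ ord i) :
    (publicPart ω (propose ord G ω i s)).implicitSolution ord v =
      (publicPart ω s).implicitSolution ord v := by
  classical
  ext u
  simp only [mem_implicitSolution, publicPart, propose_A, propose_idx]
  split_ifs
  · rw [Function.update_of_ne hv]
  · rfl

/-- A node which has not proposed yet has an empty public set. -/
lemma implicitSolution_midState_self (ord : Fin n ≃ V) (G : SimpleGraph V) (ω : Randomness p V n)
    (i : Fin n) : (publicPart ω (midState ord G ω i)).implicitSolution ord (ord i) = ∅ := by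
  ext u
  have := runUpTo_idx_eq_top ord G ω i i.2.le i le_rfl
  simp [mem_implicitSolution, publicPart, midState, checkConditions_idx, this]

/-- At any time of the run, the private sets are what the nodes decode from the public
information. -/
theorem runUpTo_M_eq (ord : Fin n ≃ V) (G : SimpleGraph V) (ω : Randomness p V n) (k : ℕ)
    (hk : k ≤ n) (v : V) : (runUpTo ord G ω k).M v =
      localMatches ord (G.neighborSet v) (publicPart ω (runUpTo ord G ω k)) v := by
  classical
  refine runUpTo_induction (ord := ord) (G := G) (ω := ω)
    (Q := fun k s => ∀ v, s.M v = localMatches ord (G.neighborSet v) (publicPart ω s) v)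
    ?_ ?_ k hk v
  · intro v
    ext w
    simp [mem_localMatches, runUpTo, mem_implicitSolution, publicPart]
  · intro i ih v
    have ih' : ∀ v, (midState ord G ω i).M v =
        localMatches ord (G.neighborSet v) (publicPart ω (midState ord G ω i)) v := by
      intro v
      rw [midState, checkConditions_M, ih v]
      ext w
      rw [mem_localMatches, mem_localMatches, ← midState, implicitSolution_midState,
        implicitSolution_midState]
    by_cases h : (i : WithTop (Fin n)) < (midState ord G ω i).A (ord i)
    · rw [propose_M_of_active h]
      have hS := implicitSolution_midState_self ord G ω i
      by_cases hv : v = ord i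
      · rw [if_pos hv]
        subst hv
        ext w
        rw [Finset.mem_union, ih', mem_localMatches, mem_localMatches, hS]
        by_cases hw : G.Adj (ord i) w
        · rw [implicitSolution_propose_self h w hw.symm, implicitSolution_propose_of_ne hw.ne']
          simp only [SimpleGraph.mem_neighborSet, hw, true_and, Set.mem_empty_iff_false, false_or]
          exact or_comm
        · have : w ∉ chosenSet ord G ω i (midState ord G ω i) := fun h' => by
            obtain ⟨r, _, h2⟩ := mem_chosenSet.1 h'
            exact hw (mem_proposalSet.1 h2).2.2.1.symm
          simp [hw, this]
      · rw [if_neg hv]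
        ext w
        rw [mem_localMatches, implicitSolution_propose_of_ne hv]
        have hM : w ∈ (if v ∈ chosenSet ord G ω i (midState ord G ω i) then
            insert (ord i) ((midState ord G ω i).M v) else (midState ord G ω i).M v) ↔
            (w = ord i ∧ v ∈ chosenSet ord G ω i (midState ord G ω i)) ∨
              w ∈ (midState ord G ω i).M v := by
          split_ifs with h' <;> simp [h']
        rw [hM, ih', mem_localMatches]
        by_cases hw : w = ord i
        · subst hw
          rw [hS]
          by_cases hvw : G.Adj v (ord i)
          · rw [implicitSolution_propose_self h v hvw]
            simp only [SimpleGraph.mem_neighborSet, hvw, true_and, Set.mem_empty_iff_false,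
              or_false]
            exact or_comm
          · have : v ∉ chosenSet ord G ω i (midState ord G ω i) := fun h' => by
              obtain ⟨r, _, h2⟩ := mem_chosenSet.1 h'
              exact hvw (mem_proposalSet.1 h2).2.2.1
            simp [hvw, this]
        · rw [implicitSolution_propose_of_ne hw]
          simp [hw]
    · rw [propose_of_inactive h]
      exact ih' v

theorem run_M_eq_decode (ord : Fin n ≃ V) (G : SimpleGraph V) (ω : Randomness p V n) (v : V) :
    ((run ord G ω).M v : Set V) = ((billboard ord G ω).decode ord G).neighborSet v := by
  rw [← coe_localMatches, run_eq_runUpTo, runUpTo_M_eq ord G ω n le_rfl v, ← run_eq_runUpTo]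
  rfl

end Run

/-! ### Protocols whose parties keep private randomness -/

section Simulation

variable {V Y Ω : Type*} (out : (v : V) → Set V → Transcript V Y → Ω → Y)

/-- The transcript of the first `T` rounds when in every round each node `v` publishes
`out v N(v) π (ω v)`, where `π` is the transcript so far and `ω v` is private randomness of `v`,
drawn once and for all. -/
def simulate (G : SimpleGraph V) (ω : V → Ω) : ℕ → Transcript V Y
  | 0 => []
  | T + 1 => simulate G ω T ++
      [fun v => some (out v (G.neighborSet v) (simulate G ω T) (ω v))]

/-- The values of the private randomness of `v` for which its messages agree with the transcript
`π`, if its neighborhood is `a`. -/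
def consistent (v : V) (a : Set V) (π : Transcript V Y) : Set Ω :=
  {ω | ∀ (t : ℕ) (ρ : V → Option Y), π[t]? = some ρ → some (out v a (π.take t) ω) = ρ v}

lemma consistent_nil (v : V) (a : Set V) : consistent out v a [] = Set.univ := by
  simp [consistent]

lemma consistent_append (v : V) (a : Set V) (π : Transcript V Y) (ρ : V → Option Y) :
    consistent out v a (π ++ [ρ]) = consistent out v a π ∩ {ω | some (out v a π ω) = ρ v} := by
  ext ω
  simp only [consistent, Set.mem_ofPred_eq, Set.mem_inter_iff]
  constructor
  · intro h
    refine ⟨fun t σ ht => ?_, ?_⟩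
    · have hlt : t < π.length := by
        by_contra h'
        rw [List.getElem?_eq_none (not_lt.1 h')] at ht
        simp at ht
      have := h t σ (by rw [List.getElem?_append_left hlt, ht])
      rwa [List.take_append_of_le_length hlt.le] at this
    · have := h π.length ρ (by simp)
      simpa using this
  · rintro ⟨h1, h2⟩ t σ ht
    rcases lt_trichotomy t π.length with hlt | heq | hgt
    · rw [List.getElem?_append_left hlt] at ht
      rw [List.take_append_of_le_length hlt.le]
      exact h1 t σ ht
    · subst heq
      have : ρ = σ := by simpa using ht
      subst this
      simpa using h2
    · rw [List.getElem?_eq_none (by simp; omega)] at ht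
      simp at ht

lemma length_simulate (G : SimpleGraph V) (ω : V → Ω) (T : ℕ) :
    (simulate out G ω T).length = T := by
  induction T with
  | zero => rfl
  | succ T ih => simp [simulate, ih]

lemma simulate_eq_iff (G : SimpleGraph V) (ω : V → Ω) (T : ℕ) (π : Transcript V Y) :
    simulate out G ω T = π ↔
      π.length = T ∧ ∀ v, ω v ∈ consistent out v (G.neighborSet v) π := by
  induction T generalizing π with
  | zero =>
    constructor
    · rintro rfl
      exact ⟨rfl, fun v => by rw [show simulate out G ω 0 = [] from rfl, consistent_nil]; trivial⟩
    · rintro ⟨h, _⟩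
      exact (List.length_eq_zero_iff.1 h).symm
  | succ T ih =>
    rcases List.eq_nil_or_concat π with rfl | ⟨π, ρ, rfl⟩
    · simp [simulate]
    · simp only [List.concat_eq_append, simulate, consistent_append, List.length_append,
        List.length_singleton, Nat.add_right_cancel_iff, Set.mem_inter_iff, Set.mem_ofPred_eq,
        forall_and]
      constructor
      · intro h
        have h' := List.append_inj' h rfl
        have h2 : (fun v => some (out v (G.neighborSet v) (simulate out G ω T) (ω v))) = ρ := by
          simpa using h'.2
        obtain ⟨h3, h4⟩ := (ih π).1 h'.1
        refine ⟨h3, h4, fun v => ?_⟩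
        rw [← h'.1, ← h2]
      · rintro ⟨h1, h2, h3⟩
        have h4 := (ih π).2 ⟨h1, h2⟩
        rw [h4]
        congr 2
        ext1 v
        exact h3 v

lemma measurableSet_consistent [MeasurableSpace Ω]
    (hout : ∀ v a π y, MeasurableSet {ω | out v a π ω = y}) (v : V) (a : Set V)
    (π : Transcript V Y) : MeasurableSet (consistent out v a π) := by
  induction π using List.reverseRecOn with
  | nil => rw [consistent_nil]; exact MeasurableSet.univ
  | append_singleton π ρ ih =>
    rw [consistent_append]
    refine ih.inter ?_
    cases h : ρ v with
    | none => simp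
    | some y =>
      have : {ω | some (out v a π ω) = some y} = {ω | out v a π ω = y} := by ext; simp
      rw [this]
      exact hout v a π y

/-- The transcript is a list of which every entry is determined by the nodes separately, so its
law is a product over the nodes. -/
lemma pi_simulate_eq [Fintype V] [MeasurableSpace Ω] (μ : Measure Ω) [IsProbabilityMeasure μ]
    (G : SimpleGraph V) (T : ℕ) (π : Transcript V Y) :
    Measure.pi (fun _ : V => μ) {ω | simulate out G ω T = π} =
      if π.length = T then ∏ v, μ (consistent out v (G.neighborSet v) π) else 0 := by
  split_ifs with h
  · have : {ω : V → Ω | simulate out G ω T = π} =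
        Set.pi Set.univ fun v => consistent out v (G.neighborSet v) π := by
      ext ω
      simp [simulate_eq_iff, h]
    rw [this, Measure.pi_pi]
  · have : {ω : V → Ω | simulate out G ω T = π} = ∅ := by
      ext ω
      simp [simulate_eq_iff, h]
    rw [this, measure_empty]

/-! ### Local randomizers by conditioning -/

/-- The law of the next message of `v`, conditioned on the transcript so far (and an arbitrary
constant law if that transcript is impossible). -/
def nextLaw [Fintype Y] [Nonempty Y] [MeasurableSpace Ω] (μ : Measure Ω) [IsProbabilityMeasure μ]
    (hout : ∀ v a π y, MeasurableSet {ω | out v a π ω = y}) (v : V) (π : Transcript V Y)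
    (a : Set V) : PMF Y :=
  letI := Classical.dec (μ (consistent out v a π) = 0)
  if h : μ (consistent out v a π) = 0 then PMF.pure (Classical.arbitrary Y) else
    PMF.ofFintype
      (fun y => μ (consistent out v a π ∩ {ω | out v a π ω = y}) / μ (consistent out v a π)) (by
        simp only [div_eq_mul_inv]
        rw [← Finset.sum_mul, ← measure_biUnion_finset]
        · have : (⋃ y ∈ Finset.univ, consistent out v a π ∩ {ω | out v a π ω = y}) =
              consistent out v a π := by
            ext ω
            simp
          rw [this]
          exact ENNReal.mul_inv_cancel h (measure_ne_top _ _)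
        · intro y _ z _ hyz
          refine Set.disjoint_left.2 fun ω h1 h2 => hyz ?_
          exact h1.2.symm.trans h2.2
        · intro y _
          exact (measurableSet_consistent out hout v a π).inter (hout v a π y))

lemma nextLaw_apply_of_ne_zero [Fintype Y] [Nonempty Y] [MeasurableSpace Ω] (μ : Measure Ω)
    [IsProbabilityMeasure μ] (hout : ∀ v a π y, MeasurableSet {ω | out v a π ω = y}) (v : V)
    (π : Transcript V Y) (a : Set V) (h : μ (consistent out v a π) ≠ 0) (y : Y) :
    nextLaw out μ hout v π a y =
      μ (consistent out v a π ∩ {ω | out v a π ω = y}) / μ (consistent out v a π) := by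
  simp [nextLaw, h]

lemma measure_consistent_mul_nextLaw [Fintype Y] [Nonempty Y] [MeasurableSpace Ω] (μ : Measure Ω)
    [IsProbabilityMeasure μ] (hout : ∀ v a π y, MeasurableSet {ω | out v a π ω = y}) (v : V)
    (π : Transcript V Y) (a : Set V) (y : Y) :
    μ (consistent out v a π) * nextLaw out μ hout v π a y =
      μ (consistent out v a π ∩ {ω | out v a π ω = y}) := by
  by_cases h : μ (consistent out v a π) = 0
  · rw [h, zero_mul]
    exact (measure_mono_null Set.inter_subset_left h).symm
  · rw [nextLaw_apply_of_ne_zero out μ hout v π a h]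
    exact ENNReal.mul_div_cancel h (measure_ne_top _ _)

end Simulation

lemma PMF_toOuterMeasure_le {α : Type*} (p q : PMF α) (C : ℝ≥0∞) (h : ∀ x, p x ≤ C * q x)
    (S : Set α) : p.toOuterMeasure S ≤ C * q.toOuterMeasure S := by
  rw [PMF.toOuterMeasure_apply, PMF.toOuterMeasure_apply, ← ENNReal.tsum_mul_left]
  refine ENNReal.tsum_le_tsum fun x => ?_
  by_cases hx : x ∈ S
  · simpa [hx] using h x
  · simp [hx]

/-- Adding or removing an edge changes the neighborhoods of its two endpoints only, by one element
each. -/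
lemma EdgeNeighboring.exists_endpoints {V : Type*} {G G' : SimpleGraph V}
    (h : EdgeNeighboring G G') : ∃ u w : V, u ≠ w ∧
      symmDiff (G.neighborSet u) (G'.neighborSet u) = {w} ∧
      symmDiff (G.neighborSet w) (G'.neighborSet w) = {u} ∧
      ∀ v, v ≠ u → v ≠ w → G.neighborSet v = G'.neighborSet v := by
  obtain ⟨e, he⟩ := h
  induction e using Sym2.ind with
  | _ u w =>
    have key : ∀ x y, ((G.Adj x y ∧ ¬ G'.Adj x y) ∨ (G'.Adj x y ∧ ¬ G.Adj x y)) ↔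
        (x = u ∧ y = w) ∨ (x = w ∧ y = u) := by
      intro x y
      have : s(x, y) ∈ symmDiff G.edgeSet G'.edgeSet ↔ s(x, y) ∈ ({s(u, w)} : Set (Sym2 V)) := by
        rw [he]
      simpa [Set.mem_symmDiff] using this
    have huw : u ≠ w := by
      rintro rfl
      have := (key u u).2 (Or.inl ⟨rfl, rfl⟩)
      simp at this
    refine ⟨u, w, huw, ?_, ?_, ?_⟩
    · ext y
      have := key u y
      simp only [Set.mem_symmDiff, SimpleGraph.mem_neighborSet, Set.mem_singleton_iff]
      rw [this]
      simp [huw]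
    · ext y
      have := key w y
      simp only [Set.mem_symmDiff, SimpleGraph.mem_neighborSet, Set.mem_singleton_iff]
      rw [this]
      simp [huw.symm]
    · intro v hu hw
      ext y
      have := key v y
      simp only [hu, hw, false_and, or_self, iff_false] at this
      simp only [SimpleGraph.mem_neighborSet]
      tauto

section Main

variable {V : Type*} [Fintype V] {Y : Type} [Fintype Y] {Ω : Type*} [MeasurableSpace Ω]
  (μ : Measure Ω) [IsProbabilityMeasure μ] (out : (v : V) → Set V → Transcript V Y → Ω → Y)
  (hout : ∀ v a π y, MeasurableSet {ω | out v a π ω = y}) (ε : ℝ)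

/-- The messages of every node depend on its own neighborhood in an `ε`-private way, whatever the
other nodes publish. -/
def NodePrivate (ε : ℝ) : Prop :=
  ∀ (v : V) (a a' : Set V), v ∉ a → v ∉ a' → (∃ w, symmDiff a a' = {w}) →
    ∀ π : Transcript V Y, μ (consistent out v a π) ≤
      ENNReal.ofReal (Real.exp ε) * μ (consistent out v a' π)

variable {μ out ε}

/-- The local randomizer which draws the next message of `v` from its conditional law. -/
def nextRandomizer [Nonempty Y] (hε : 0 ≤ ε) (hpriv : NodePrivate μ out ε) (v : V)
    (π : Transcript V Y) : LocalRandomizer V Y v where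
  eps := (2 * ε).toNNReal
  law := nextLaw out μ hout v π
  isPrivate := by
    intro a a' ha ha' haa' S
    refine PMF_toOuterMeasure_le _ _ _ (fun y => ?_) S
    have haa'' : ∃ w, symmDiff a' a = {w} := by
      simpa only [symmDiff_comm] using haa'
    have h1 := hpriv v a a' ha ha' haa'
    have h2 := hpriv v a' a ha' ha haa''
    have hE : ENNReal.ofReal (Real.exp ε) ≠ 0 := by
      simp [Real.exp_pos]
    have hE2 : ENNReal.ofReal (Real.exp (2 * ε)) =
        ENNReal.ofReal (Real.exp ε) * ENNReal.ofReal (Real.exp ε) := by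
      rw [← ENNReal.ofReal_mul (Real.exp_pos _).le, ← Real.exp_add]
      ring_nf
    rw [Real.coe_toNNReal _ (by positivity), hE2]
    by_cases h : μ (consistent out v a π) = 0
    · have h' : μ (consistent out v a' π) = 0 := by
        have := h2 π
        rw [h, mul_zero] at this
        exact le_antisymm this zero_le
      have : nextLaw out μ hout v π a = nextLaw out μ hout v π a' := by
        simp [nextLaw, h, h']
      rw [this]
      refine le_mul_of_one_le_left zero_le ?_
      rw [← hE2]
      rw [ENNReal.one_le_ofReal]
      exact Real.one_le_exp (by positivity)
    · have h' : μ (consistent out v a' π) ≠ 0 := by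
        intro h'
        have := h1 π
        rw [h', mul_zero] at this
        exact h (le_antisymm this zero_le)
      rw [nextLaw_apply_of_ne_zero out μ hout v π a h,
        nextLaw_apply_of_ne_zero out μ hout v π a' h']
      have h3 := h1 (π ++ [fun _ => some y])
      have hset : ∀ a, {ω | some (out v a π ω) = some y} = {ω | out v a π ω = y} := by
        intro a; ext; simp
      rw [consistent_append, consistent_append, hset, hset] at h3
      have h4 : (μ (consistent out v a π))⁻¹ ≤
          ENNReal.ofReal (Real.exp ε) * (μ (consistent out v a' π))⁻¹ := by
        have := ENNReal.inv_le_inv.2 (h2 π)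
        rw [ENNReal.mul_inv (Or.inl hE) (Or.inl ENNReal.ofReal_ne_top)] at this
        calc (μ (consistent out v a π))⁻¹
            = ENNReal.ofReal (Real.exp ε) * ((ENNReal.ofReal (Real.exp ε))⁻¹ *
              (μ (consistent out v a π))⁻¹) := by
              rw [← mul_assoc, ENNReal.mul_inv_cancel hE ENNReal.ofReal_ne_top, one_mul]
          _ ≤ _ := by gcongr
      calc _ ≤ _ := mul_le_mul' h3 h4
        _ = _ := by rw [div_eq_mul_inv]; ring

/-- The protocol in which every node publishes in each of `T` rounds a message drawn from its
conditional law. -/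
def conditionalProtocol [Nonempty Y] (hε : 0 ≤ ε) (hpriv : NodePrivate μ out ε) (T : ℕ) :
    Protocol V Y := fun π =>
  if π.length < T then some fun v => some (nextRandomizer hout hε hpriv v π) else none

lemma map_some_apply {α : Type*} (p : PMF α) (o : Option α) :
    (p.map some) o = o.elim 0 p := by
  classical
  rw [PMF.map_apply]
  cases o with
  | none => simp
  | some y =>
    rw [tsum_eq_single y]
    · simp
    · intro z hz
      simp [hz.symm]

lemma roundLaw_conditional [Nonempty Y] (hε : 0 ≤ ε) (hpriv : NodePrivate μ out ε)
    (G : SimpleGraph V) (π : Transcript V Y) (ρ : V → Option Y) :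
    (∏ v, μ (consistent out v (G.neighborSet v) π)) *
      roundLaw G (fun v => some (nextRandomizer hout hε hpriv v π)) ρ =
      ∏ v, μ (consistent out v (G.neighborSet v) (π ++ [ρ])) := by
  simp only [roundLaw, piPMF, PMF.ofFintype_apply]
  rw [← Finset.prod_mul_distrib]
  refine Finset.prod_congr rfl fun v _ => ?_
  rw [map_some_apply, consistent_append]
  cases ρ v with
  | none => simp
  | some y =>
    simp only [nextRandomizer, Option.elim_some, measure_consistent_mul_nextLaw,
      Option.some.injEq]

lemma transcriptLaw_conditional [Nonempty Y] (hε : 0 ≤ ε) (hpriv : NodePrivate μ out ε)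
    (G : SimpleGraph V) (T t : ℕ) (ht : t ≤ T) (π : Transcript V Y) :
    transcriptLaw (conditionalProtocol hout hε hpriv T) G t π =
      if π.length = t then ∏ v, μ (consistent out v (G.neighborSet v) π) else 0 := by
  classical
  induction t generalizing π with
  | zero =>
    simp only [transcriptLaw, PMF.pure_apply, List.length_eq_zero_iff]
    split_ifs with h
    · subst h
      simp [consistent_nil]
    · rfl
  | succ t ih =>
    have ih := ih (by omega)
    rw [transcriptLaw, PMF.bind_apply]
    -- only transcripts of length `t` contribute, and for those the protocol continues
    have hterm : ∀ π' : Transcript V Y,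
        transcriptLaw (conditionalProtocol hout hε hpriv T) G t π' *
          (match conditionalProtocol hout hε hpriv T π' with
            | none => PMF.pure π'
            | some asg => (roundLaw G asg).map fun y => π' ++ [y]) π =
        transcriptLaw (conditionalProtocol hout hε hpriv T) G t π' *
          ((roundLaw G fun v => some (nextRandomizer hout hε hpriv v π')).map
            fun y => π' ++ [y]) π := by
      intro π'
      rw [ih π']
      split_ifs with h
      · have : conditionalProtocol hout hε hpriv T π' =
            some fun v => some (nextRandomizer hout hε hpriv v π') := by
          simp only [conditionalProtocol]
          rw [if_pos (by omega)]
        rw [this]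
      · simp
    refine (tsum_congr hterm).trans ?_
    rcases List.eq_nil_or_concat π with rfl | ⟨π, ρ, rfl⟩
    · rw [if_neg (by simp)]
      refine ENNReal.tsum_eq_zero.2 fun π' => ?_
      rw [PMF.map_apply]
      simp
    · rw [List.concat_eq_append, tsum_eq_single π]
      · rw [PMF.map_apply, tsum_eq_single ρ, if_pos rfl, ih π]
        · simp only [List.length_append, List.length_singleton, Nat.add_right_cancel_iff]
          split_ifs
          · exact roundLaw_conditional hout hε hpriv G π ρ
          · exact zero_mul _
        · intro ρ' hρ'
          rw [if_neg]
          intro h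
          exact hρ' (by simpa using h.symm)
      · intro π' hπ'
        rw [PMF.map_apply]
        refine mul_eq_zero_of_right _ (ENNReal.tsum_eq_zero.2 fun ρ' => ?_)
        rw [if_neg]
        intro h
        exact hπ' (List.append_inj' h rfl).1.symm

lemma edgeDP_conditional [Nonempty Y] (hε : 0 ≤ ε) (hpriv : NodePrivate μ out ε) (T : ℕ) :
    EdgeDP (2 * ε) fun G => transcriptLaw (conditionalProtocol hout hε hpriv T) G T := by
  classical
  intro G G' hGG'
  refine PMF_toOuterMeasure_le _ _ _ fun π => ?_
  rw [transcriptLaw_conditional hout hε hpriv G T T le_rfl,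
    transcriptLaw_conditional hout hε hpriv G' T T le_rfl]
  split_ifs
  swap
  · simp
  obtain ⟨u, w, huw, hu, hw, hne⟩ := hGG'.exists_endpoints
  have hE2 : ENNReal.ofReal (Real.exp (2 * ε)) =
      ∏ v : V, if v = u ∨ v = w then ENNReal.ofReal (Real.exp ε) else 1 := by
    rw [Finset.prod_ite, Finset.prod_const_one, mul_one, Finset.prod_const]
    have : (Finset.univ.filter fun v : V => v = u ∨ v = w) = {u, w} := by
      ext; simp
    rw [this, Finset.card_pair huw, ← ENNReal.ofReal_pow (Real.exp_pos _).le, ← Real.exp_nat_mul]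
    norm_num
  rw [hE2, ← Finset.prod_mul_distrib]
  refine Finset.prod_le_prod' fun v _ => ?_
  split_ifs with h
  · rcases h with rfl | rfl
    · exact hpriv v _ _ (by simp) (by simp) ⟨w, hu⟩ π
    · exact hpriv v _ _ (by simp) (by simp) ⟨u, hw⟩ π
  · push Not at h
    rw [hne v h.1 h.2, one_mul]

end Main

/-- **Private randomness can be simulated by local randomizers.** If each node publishes in every
round a function of its neighborhood, the transcript so far and private randomness drawn once and
for all, and if the messages of a single node are always `ε`-private, then what is read off from
the transcript is `2ε`-LEDP: local randomizers have no memory, but each message can be redrawn from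
its conditional law given the earlier messages. An edge concerns two nodes, whence `2ε`. -/
theorem isLEDP_of_nodePrivate {V B : Type*} [Fintype V] {Y : Type} [Fintype Y] {Ω : Type*}
    [MeasurableSpace Ω] (μ : Measure Ω) [IsProbabilityMeasure μ]
    (out : (v : V) → Set V → Transcript V Y → Ω → Y)
    (hout : ∀ v a π y, MeasurableSet {ω | out v a π ω = y}) {ε : ℝ} (hε : 0 ≤ ε)
    (hpriv : NodePrivate μ out ε) [Nonempty Y] (T : ℕ) (read : Transcript V Y → B)
    (law : SimpleGraph V → Set B → ℝ≥0∞)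
    (hlaw : ∀ G S, law G S =
      Measure.pi (fun _ : V => μ) {ω | read (simulate out G ω T) ∈ S}) :
    IsLEDP (2 * ε) law := by
  classical
  refine ⟨Y, inferInstance, conditionalProtocol hout hε hpriv T, T, read, ?_,
    edgeDP_conditional hout hε hpriv T, ?_⟩
  · intro G π hπ
    rw [PMF.mem_support_iff, transcriptLaw_conditional hout hε hpriv G T T le_rfl] at hπ
    have : π.length = T := by
      by_contra h
      simp [h] at hπ
    simp [conditionalProtocol, this]
  · intro G S
    have hmeas : ∀ π : Transcript V Y, MeasurableSet
        ((fun ω : V → Ω => simulate out G ω T) ⁻¹' {π}) := by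
      intro π
      have : ((fun ω : V → Ω => simulate out G ω T) ⁻¹' {π}) =
          {ω | π.length = T} ∩ ⋂ v, (fun ω : V → Ω => ω v) ⁻¹'
            consistent out v (G.neighborSet v) π := by
        ext ω
        simp [simulate_eq_iff]
      rw [this]
      exact (MeasurableSet.const _).inter (MeasurableSet.iInter fun v =>
        measurable_pi_apply v (measurableSet_consistent out hout v _ π))
    have hcount : (read ⁻¹' S).Countable := Set.to_countable _
    have hsum := tsum_measure_preimage_singleton (μ := Measure.pi fun _ : V => μ) hcount
      (f := fun ω : V → Ω => simulate out G ω T) (fun π _ => hmeas π)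
    rw [hlaw, PMF.toOuterMeasure_map_apply, PMF.toOuterMeasure_apply,
      ← tsum_subtype (read ⁻¹' S)]
    refine Eq.trans ?_ hsum
    refine tsum_congr fun π => ?_
    rw [transcriptLaw_conditional hout hε hpriv G T T le_rfl]
    exact (pi_simulate_eq out μ G T π).symm

/-! ### The Laplace distribution -/

section Laplace

variable {s : ℝ}

lemma measurable_laplaceDensity (s : ℝ) :
    Measurable fun x : ℝ => ENNReal.ofReal (1 / (2 * s) * Real.exp (-|x| / s)) := by
  fun_prop

lemma setLIntegral_exp_Ioi (hs : 0 < s) (t : ℝ) :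
    ∫⁻ x in Set.Ioi t, ENNReal.ofReal (1 / (2 * s) * Real.exp (-x / s)) =
      ENNReal.ofReal (Real.exp (-t / s) / 2) := by
  have ha : -s⁻¹ < 0 := by simpa using hs
  have h1 := integrableOn_exp_mul_Ioi ha t
  have h2 := integral_exp_mul_Ioi ha t
  have hfun : ∀ x : ℝ, Real.exp (-x / s) = Real.exp (-s⁻¹ * x) := by
    intro x; congr 1; field_simp
  simp only [hfun]
  rw [← ofReal_integral_eq_lintegral_ofReal (h1.const_mul _)
    (Filter.Eventually.of_forall fun x => by positivity), integral_const_mul, h2]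
  congr 1
  field_simp

lemma laplace_Ioi (hs : 0 < s) {t : ℝ} (ht : 0 ≤ t) :
    laplace s (Set.Ioi t) = ENNReal.ofReal (Real.exp (-t / s) / 2) := by
  rw [laplace, withDensity_apply _ measurableSet_Ioi, ← setLIntegral_exp_Ioi hs]
  refine setLIntegral_congr_fun measurableSet_Ioi fun x hx => ?_
  rw [abs_of_nonneg (ht.trans (le_of_lt hx))]

lemma laplace_Iio (hs : 0 < s) {t : ℝ} (ht : 0 ≤ t) :
    laplace s (Set.Iio (-t)) = ENNReal.ofReal (Real.exp (-t / s) / 2) := by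
  rw [← laplace_Ioi hs ht, laplace, withDensity_apply _ measurableSet_Iio,
    withDensity_apply _ measurableSet_Ioi]
  have := (Measure.measurePreserving_neg (volume : Measure ℝ)).setLIntegral_comp_preimage
    (s := Set.Ioi t) measurableSet_Ioi (measurable_laplaceDensity s)
  rw [← this]
  simp

lemma laplace_Iic (s : ℝ) (t : ℝ) : laplace s (Set.Iic t) = laplace s (Set.Iio t) := by
  have : laplace s ≪ volume := withDensity_absolutelyContinuous _ _
  exact (measure_congr (this.ae_le Iio_ae_eq_Iic)).symm

lemma isProbabilityMeasure_laplace (hs : 0 < s) : IsProbabilityMeasure (laplace s) := by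
  constructor
  rw [← Set.Iic_union_Ioi (a := (0 : ℝ)), measure_union (Set.Iic_disjoint_Ioi le_rfl)
    measurableSet_Ioi, laplace_Iic, laplace_Ioi hs le_rfl]
  have := laplace_Iio hs le_rfl
  rw [neg_zero] at this
  rw [this, ← ENNReal.ofReal_add (by positivity) (by positivity)]
  norm_num

instance (s : ℝ) : SFinite (laplace s) := by unfold laplace; infer_instance

lemma laplace_abs_gt (hs : 0 < s) {t : ℝ} (ht : 0 ≤ t) :
    laplace s {x | t < |x|} ≤ ENNReal.ofReal (Real.exp (-t / s)) := by
  have : {x : ℝ | t < |x|} ⊆ Set.Ioi t ∪ Set.Iio (-t) := by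
    intro x hx
    rcases lt_abs.1 (show t < |x| from hx) with h | h
    · exact Or.inl h
    · exact Or.inr (show x < -t by linarith)
  refine (measure_mono this).trans ((measure_union_le _ _).trans ?_)
  rw [laplace_Ioi hs ht, laplace_Iio hs ht, ← ENNReal.ofReal_add (by positivity) (by positivity)]
  simp

/-- Translating Laplace noise by `d` changes probabilities by a factor of at most
`exp (|d| / s)`. -/
lemma laplace_map_add_le (hs : 0 < s) (d : ℝ) :
    (laplace s).map (· + d) ≤ ENNReal.ofReal (Real.exp (|d| / s)) • laplace s := by
  refine Measure.le_iff.2 fun S hS => ?_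
  rw [Measure.map_apply (by fun_prop) hS, Measure.smul_apply, smul_eq_mul, laplace,
    withDensity_apply _ (measurable_add_const d hS), withDensity_apply _ hS,
    ← lintegral_const_mul _ (measurable_laplaceDensity s)]
  have h := (measurePreserving_add_right (volume : Measure ℝ) d).setLIntegral_comp_preimage
    (s := S) hS (f := fun x => ENNReal.ofReal (Real.exp (|d| / s)) *
      ENNReal.ofReal (1 / (2 * s) * Real.exp (-|x| / s))) (by fun_prop)
  rw [← h]
  refine lintegral_mono fun x => ?_
  rw [← ENNReal.ofReal_mul (by positivity)]
  refine ENNReal.ofReal_le_ofReal ?_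
  rw [mul_left_comm, ← Real.exp_add]
  refine mul_le_mul_of_nonneg_left (Real.exp_le_exp.2 ?_) (by positivity)
  rw [← add_div]
  refine div_le_div_of_nonneg_right ?_ hs.le
  have := abs_add_le x d
  linarith

lemma pi_laplace_map_add_le {ι : Type*} [Fintype ι] (hs : 0 < s) (d : ι → ℝ) :
    (Measure.pi fun _ : ι => laplace s).map (· + d) ≤
      ENNReal.ofReal (Real.exp ((∑ i, |d i|) / s)) • Measure.pi fun _ : ι => laplace s := by
  have := isProbabilityMeasure_laplace hs
  have hmap : (Measure.pi fun _ : ι => laplace s).map (· + d) =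
      Measure.pi fun i => (laplace s).map (· + d i) :=
    Measure.pi_map_pi (fun i => (measurable_add_const (d i)).aemeasurable)
  have hprob : ∀ i, IsProbabilityMeasure ((laplace s).map (· + d i)) := fun i =>
    Measure.isProbabilityMeasure_map (by fun_prop)
  have hC0 : ENNReal.ofReal (Real.exp ((∑ i, |d i|) / s)) ≠ 0 := by simp [Real.exp_pos]
  have hC : ENNReal.ofReal (Real.exp ((∑ i, |d i|) / s)) =
      ∏ i, ENNReal.ofReal (Real.exp (|d i| / s)) := by
    rw [← ENNReal.ofReal_prod_of_nonneg (fun i _ => by positivity), ← Real.exp_sum,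
      Finset.sum_div]
  rw [hmap]
  set C := ENNReal.ofReal (Real.exp ((∑ i, |d i|) / s)) with hCdef
  have key : (C⁻¹ • Measure.pi fun i => (laplace s).map (· + d i)) ≤
      Measure.pi fun _ : ι => laplace s := by
    refine Measure.le_iff.2 fun S hS => ?_
    rw [show (Measure.pi fun _ : ι => laplace s) S =
      OuterMeasure.pi (fun _ : ι => (laplace s).toOuterMeasure) S by
        rw [Measure.pi, toMeasure_apply _ _ hS]]
    have houter : (C⁻¹ • Measure.pi fun i => (laplace s).map (· + d i)).toOuterMeasure ≤
        OuterMeasure.pi fun _ : ι => (laplace s).toOuterMeasure := by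
      refine OuterMeasure.le_pi.2 fun B _ => ?_
      change (C⁻¹ • Measure.pi fun i => (laplace s).map (· + d i)) (Set.pi Set.univ B) ≤ _
      rw [Measure.smul_apply, smul_eq_mul, Measure.pi_pi]
      calc C⁻¹ * ∏ i, (laplace s).map (· + d i) (B i)
          ≤ C⁻¹ * ∏ i, (ENNReal.ofReal (Real.exp (|d i| / s)) * laplace s (B i)) := by
            gcongr with i
            exact laplace_map_add_le hs (d i) (B i)
        _ = ∏ i, laplace s (B i) := by
            rw [Finset.prod_mul_distrib, ← hC, ← mul_assoc,
              ENNReal.inv_mul_cancel hC0 ENNReal.ofReal_ne_top, one_mul]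
    exact houter S
  intro S
  have := key S
  rw [Measure.smul_apply, smul_eq_mul] at this ⊢
  calc _ = C * (C⁻¹ * (Measure.pi fun i => (laplace s).map (· + d i)) S) := by
        rw [← mul_assoc, ENNReal.mul_inv_cancel hC0 ENNReal.ofReal_ne_top, one_mul]
    _ ≤ _ := by gcongr

end Laplace

lemma isProbabilityMeasure_coinLaw {q : ℝ} (h0 : 0 ≤ q) (h1 : q ≤ 1) :
    IsProbabilityMeasure (coinLaw q) := by
  constructor
  simp [coinLaw, ← ENNReal.ofReal_add h0 (sub_nonneg.2 h1)]

/-! ### Measure-theoretic generalities -/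

lemma prod_map_le {α β : Type*} [MeasurableSpace α] [MeasurableSpace β] {μ : Measure α}
    {ν : Measure β} [SFinite μ] [SFinite ν] {f : α → α} {g : β → β} (hf : Measurable f)
    (hg : Measurable g) {C D : ℝ} (h1 : μ.map f ≤ ENNReal.ofReal (Real.exp C) • μ)
    (h2 : ν.map g ≤ ENNReal.ofReal (Real.exp D) • ν) :
    (μ.prod ν).map (Prod.map f g) ≤ ENNReal.ofReal (Real.exp (C + D)) • μ.prod ν := by
  rw [← Measure.map_prod_map _ _ hf hg]
  refine (Measure.prod_mono h1 h2).trans (le_of_eq ?_)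
  rw [Measure.prod_smul_left, Measure.prod_smul_right, smul_smul,
    ← ENNReal.ofReal_mul (Real.exp_pos _).le, Real.exp_add]

/-- Exchanging the two indices of a doubly indexed family preserves the product measure. -/
lemma measurePreserving_pi_swap {ι κ α : Type*} [Fintype ι] [Fintype κ] [MeasurableSpace α]
    (μ : Measure α) [IsProbabilityMeasure μ] :
    MeasurePreserving (fun (f : ι → κ → α) (k : κ) (i : ι) => f i k)
      (Measure.pi fun _ : ι => Measure.pi fun _ : κ => μ)
      (Measure.pi fun _ : κ => Measure.pi fun _ : ι => μ) := by
  have hmeas : Measurable fun (f : ι → κ → α) (k : κ) (i : ι) => f i k := by fun_prop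
  refine ⟨hmeas, (Measure.pi_eq_generateFrom
    (C := fun _ => Set.pi Set.univ '' Set.pi Set.univ fun _ => {s | MeasurableSet s})
    (fun _ => generateFrom_pi) (fun _ => isPiSystem_pi)
    (fun _ => Measure.FiniteSpanningSetsIn.pi fun _ => μ.toFiniteSpanningSetsIn) ?_).symm⟩
  intro s hs
  choose t ht hts using hs
  rw [Measure.map_apply hmeas]
  · have : (fun (f : ι → κ → α) (k : κ) (i : ι) => f i k) ⁻¹' Set.pi Set.univ s =
        Set.pi Set.univ fun i => Set.pi Set.univ fun k => t k i := by
      ext f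
      simp only [← hts, Set.mem_preimage, Set.mem_pi, Set.mem_univ, forall_true_left]
      exact forall_comm
    rw [this]
    simp only [← hts, Measure.pi_pi]
    exact Finset.prod_comm
  · refine MeasurableSet.univ_pi fun k => ?_
    rw [← hts k]
    exact MeasurableSet.univ_pi fun i => ht k i trivial

/-! ### The algorithm as a protocol -/

section Protocol

variable {p : Params} {V : Type*} [Fintype V] {n : ℕ}

/-- The private randomness of a single node: a table of coins (of which that of one distinguished
node is used), the noise in its threshold, the noises in its checks, in the estimates of the sizes
`|W_r|` and in the estimate of its degree. -/
abbrev NodeNoise (p : Params) (V : Type*) (n : ℕ) :=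
  (Sym2 V → Fin (p.numIdx n) → Bool) × ℝ × (Fin n → ℝ) × (Fin (p.numIdx n) → ℝ) × ℝ

/-- A message consists of a table of coins, the outcome of a check, and an index; only one of the
three is meaningful, depending on the round. -/
abbrev Message (p : Params) (n : ℕ) :=
  (Sym2 (Fin n) → Fin (p.numIdx n) → Bool) × Bool × WithTop (Fin (p.numIdx n))

instance : Nonempty (Message p n) := ⟨(fun _ _ => false, false, ⊤)⟩

/-- The partners of `v` which come before `v` in the ordering. -/
def earlierMatches (ord : Fin n ≃ V) (a : Set V) (B : Billboard p V n) (v : V) : Finset V :=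
  (localMatches ord a B v).filter fun w => ord.symm w < ord.symm v

open Classical in
/-- The set `W_r(v_i)`, computed from the public information and the neighborhood `a` of `v_i`. -/
def localProposals (ord : Fin n ≃ V) (a : Set V) (B : Billboard p V n) (i : Fin n)
    (r : Fin (p.numIdx n)) : Finset V :=
  Finset.univ.filter fun u => u ∈ a ∧ (i : WithTop (Fin n)) < B.A u ∧ i < ord.symm u ∧
    B.coin s(u, ord i) r = true

/-- Whether node `v` satisfies its matching condition in iteration `i`. -/
def CheckPasses (ord : Fin n ≃ V) (a : Set V) (v : V) (B : Billboard p V n) (i : Fin n)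
    (x : NodeNoise p V n) : Prop :=
  p.b - 36 * p.c * Real.log n / p.eps' + x.2.1 ≤
    ((localMatches ord a B v).card : ℝ) + x.2.2.1 i

/-- Whether the index `r` passes the test of `v_i`. -/
def IndexPasses (ord : Fin n ≃ V) (a : Set V) (B : Billboard p V n) (i : Fin n)
    (x : NodeNoise p V n) (r : Fin (p.numIdx n)) : Prop :=
  (((earlierMatches ord a B (ord i)).card : ℝ) + x.2.2.2.2) +
    (((localProposals ord a B i r).card : ℝ) + x.2.2.2.1 r) +
    12 * p.c * Real.log n / p.eps' ≤ p.b

open Classical in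
/-- The message of the node `v` with neighborhood `a` and public information `B` in round `t`.
Coins are published in round `0`; the two parts of iteration `i` are the rounds `2 i + 1` and
`2 i + 2`. -/
def message (ord : Fin n ≃ V) (a : Set V) (v : V) (B : Billboard p V n) :
    ℕ → NodeNoise p V n → Message p n
  | 0, x => (fun e r => x.1 (e.map ord) r, false, ⊤)
  | t + 1, x =>
    if h : t / 2 < n then
      if t % 2 = 0 then
        (fun _ _ => false, decide (((⟨t / 2, h⟩ : Fin n) : WithTop (Fin n)) < B.A v ∧
          CheckPasses ord a v B ⟨t / 2, h⟩ x), ⊤)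
      else
        (fun _ _ => false, false, if v = ord ⟨t / 2, h⟩ then
          (Finset.univ.filter (IndexPasses ord a B ⟨t / 2, h⟩ x)).min else ⊤)
    else (fun _ _ => false, false, ⊤)

open Classical in
lemma message_check (ord : Fin n ≃ V) (a : Set V) (v : V) (B : Billboard p V n) (i : Fin n)
    (x : NodeNoise p V n) :
    message ord a v B (2 * i + 1) x = (fun _ _ => false,
      decide ((i : WithTop (Fin n)) < B.A v ∧ CheckPasses ord a v B i x), ⊤) := by
  simp [message]

open Classical in
lemma message_propose (ord : Fin n ≃ V) (a : Set V) (v : V) (B : Billboard p V n) (i : Fin n)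
    (x : NodeNoise p V n) :
    message ord a v B (2 * i + 2) x = (fun _ _ => false, false, if v = ord i then
      (Finset.univ.filter (IndexPasses ord a B i x)).min else ⊤) := by
  have h1 : (2 * (i : ℕ) + 1) / 2 = i := by omega
  have h2 : (2 * (i : ℕ) + 1) % 2 = 1 := by omega
  simp [message, h1, h2]

lemma message_of_gt (ord : Fin n ≃ V) (a : Set V) (v : V) (B : Billboard p V n) (t : ℕ)
    (ht : 2 * n < t) (x : NodeNoise p V n) :
    message ord a v B t x = (fun _ _ => false, false, ⊤) := by
  obtain ⟨t, rfl⟩ := Nat.exists_eq_succ_of_ne_zero (show t ≠ 0 by omega)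
  have : ¬ t / 2 < n := by omega
  simp [message, this]

lemma round_cases (n t : ℕ) : t = 0 ∨ (∃ i : Fin n, t = 2 * i + 1) ∨
    (∃ i : Fin n, t = 2 * i + 2) ∨ 2 * n < t := by
  rcases Nat.eq_zero_or_pos t with h | h
  · exact Or.inl h
  by_cases hn : 2 * n < t
  · exact Or.inr (Or.inr (Or.inr hn))
  rcases Nat.even_or_odd' t with ⟨k, hk | hk⟩
  · exact Or.inr (Or.inr (Or.inl ⟨⟨k - 1, by omega⟩, by simp only; omega⟩))
  · exact Or.inr (Or.inl ⟨⟨k, by omega⟩, hk⟩)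

open Classical in
/-- How the messages `ρ` of round `t` change the public information. The coins are those of the
node `v₀`. -/
def readStep (v₀ : V) (ord : Fin n ≃ V) (B : Billboard p V n) (ρ : V → Option (Message p n)) :
    ℕ → Billboard p V n
  | 0 => { B with coin := fun e r => (ρ v₀).elim false fun m => m.1 (e.map ord.symm) r }
  | t + 1 =>
    if h : t / 2 < n then
      if t % 2 = 0 then
        { B with A := fun u => if (((⟨t / 2, h⟩ : Fin n) : WithTop (Fin n)) < B.A u) ∧
            (ρ u).elim false (fun m => m.2.1) = true then
              ((⟨t / 2, h⟩ : Fin n) : WithTop (Fin n)) else B.A u }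
      else
        { B with idx := if ((⟨t / 2, h⟩ : Fin n) : WithTop (Fin n)) < B.A (ord ⟨t / 2, h⟩) then
            Function.update B.idx (ord ⟨t / 2, h⟩) ((ρ (ord ⟨t / 2, h⟩)).elim ⊤ fun m => m.2.2)
            else B.idx }
    else B

open Classical in
lemma readStep_check (v₀ : V) (ord : Fin n ≃ V) (B : Billboard p V n)
    (ρ : V → Option (Message p n)) (i : Fin n) :
    readStep v₀ ord B ρ (2 * i + 1) =
      { B with A := fun u => if ((i : WithTop (Fin n)) < B.A u) ∧
            (ρ u).elim false (fun m => m.2.1) = true then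
              (i : WithTop (Fin n)) else B.A u } := by
  simp [readStep]

open Classical in
lemma readStep_propose (v₀ : V) (ord : Fin n ≃ V) (B : Billboard p V n)
    (ρ : V → Option (Message p n)) (i : Fin n) :
    readStep v₀ ord B ρ (2 * i + 2) =
      { B with idx := if (i : WithTop (Fin n)) < B.A (ord i) then
            Function.update B.idx (ord i) ((ρ (ord i)).elim ⊤ fun m => m.2.2) else B.idx } := by
  have h1 : (2 * (i : ℕ) + 1) / 2 = i := by omega
  have h2 : (2 * (i : ℕ) + 1) % 2 = 1 := by omega
  simp [readStep, h1, h2]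

lemma readStep_of_gt (v₀ : V) (ord : Fin n ≃ V) (B : Billboard p V n)
    (ρ : V → Option (Message p n)) (t : ℕ) (ht : 2 * n < t) :
    readStep v₀ ord B ρ t = B := by
  obtain ⟨t, rfl⟩ := Nat.exists_eq_succ_of_ne_zero (show t ≠ 0 by omega)
  have : ¬ t / 2 < n := by omega
  simp [readStep, this]

/-- The public information that can be read off from a transcript. -/
def readTranscript (v₀ : V) (ord : Fin n ≃ V) (π : Transcript V (Message p n)) :
    Billboard p V n :=
  (π.foldl (fun (q : ℕ × Billboard p V n) ρ => (q.1 + 1, readStep v₀ ord q.2 ρ q.1))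
    (0, { coin := fun _ _ => false, A := fun _ => ⊤, idx := fun _ => ⊤ })).2

lemma readTranscript_append (v₀ : V) (ord : Fin n ≃ V) (π : Transcript V (Message p n))
    (ρ : V → Option (Message p n)) :
    readTranscript v₀ ord (π ++ [ρ]) = readStep v₀ ord (readTranscript v₀ ord π) ρ π.length := by
  have hlen : ∀ (π : Transcript V (Message p n)) (q : ℕ × Billboard p V n),
      (π.foldl (fun (q : ℕ × Billboard p V n) ρ => (q.1 + 1, readStep v₀ ord q.2 ρ q.1)) q).1 =
        q.1 + π.length := by
    intro π
    induction π with
    | nil => intro q; rfl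
    | cons ρ π ih =>
      intro q
      rw [List.foldl_cons, ih]
      simp only [List.length_cons]
      omega
  simp only [readTranscript, List.foldl_append, List.foldl_cons, List.foldl_nil]
  rw [hlen]
  simp

/-- The messages of the nodes as functions of the transcript. -/
def nodeOutput (v₀ : V) (ord : Fin n ≃ V) (v : V) (a : Set V) (π : Transcript V (Message p n))
    (x : NodeNoise p V n) : Message p n :=
  message ord a v (readTranscript v₀ ord π) π.length x

/-- All the random draws of a run, collected from the nodes. -/
def collect (v₀ : V) (x : V → NodeNoise p V n) : Randomness p V n :=
  ((x v₀).1, fun u => (x u).2.1, fun i u => (x u).2.2.1 i, fun v => (x v).2.2.2.1,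
    fun v => (x v).2.2.2.2)

open Classical in
lemma earlierMatches_midState (ord : Fin n ≃ V) (G : SimpleGraph V) (ω : Randomness p V n)
    (i : Fin n) :
    earlierMatches ord (G.neighborSet (ord i)) (publicPart ω (midState ord G ω i)) (ord i) =
      (midState ord G ω i).M (ord i) := by
  rw [midState, checkConditions_M, runUpTo_M_eq ord G ω i i.2.le]
  ext w
  rw [earlierMatches, Finset.mem_filter, mem_localMatches, mem_localMatches, ← midState,
    ← implicitSolution_midState ord G ω i (ord i), ← implicitSolution_midState ord G ω i w,
    implicitSolution_midState_self]
  constructor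
  · exact fun h => h.1
  · rintro ⟨h1, h2⟩
    refine ⟨⟨h1, h2⟩, ?_⟩
    rcases h2 with h2 | h2
    · exact h2.elim
    · exact (mem_implicitSolution.1 h2).2.1

lemma mem_localProposals {ord : Fin n ≃ V} {a : Set V} {B : Billboard p V n} {i : Fin n}
    {r : Fin (p.numIdx n)} {u : V} : u ∈ localProposals ord a B i r ↔
      u ∈ a ∧ (i : WithTop (Fin n)) < B.A u ∧ i < ord.symm u ∧ B.coin s(u, ord i) r = true := by
  simp [localProposals]

lemma localProposals_midState (ord : Fin n ≃ V) (G : SimpleGraph V) (ω : Randomness p V n)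
    (i : Fin n) (r : Fin (p.numIdx n)) :
    localProposals ord (G.neighborSet (ord i)) (publicPart ω (midState ord G ω i)) i r =
      proposalSet ord G ω i (midState ord G ω i).A r := by
  ext u
  rw [mem_localProposals, mem_proposalSet, SimpleGraph.mem_neighborSet, G.adj_comm (ord i)]
  simp only [publicPart]
  tauto

lemma readStep_check_publicPart (v₀ : V) (ord : Fin n ≃ V) (G : SimpleGraph V)
    (x : V → NodeNoise p V n) (i : Fin n) :
    readStep v₀ ord (publicPart (collect v₀ x) (runUpTo ord G (collect v₀ x) i))
      (fun u => some (message ord (G.neighborSet u) u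
        (publicPart (collect v₀ x) (runUpTo ord G (collect v₀ x) i)) (2 * i + 1) (x u)))
      (2 * i + 1) = publicPart (collect v₀ x) (midState ord G (collect v₀ x) i) := by
  classical
  rw [readStep_check]
  refine congrArg (fun A => Billboard.mk _ A _) ?_
  ext1 u
  have hC : CheckPasses ord (G.neighborSet u) u
      (publicPart (collect v₀ x) (runUpTo ord G (collect v₀ x) i)) i (x u) ↔
      noisyThreshold (collect v₀ x) u ≤ (((runUpTo ord G (collect v₀ x) i).M u).card : ℝ) +
        (collect v₀ x).checkNoise i u := by
    rw [runUpTo_M_eq ord G _ i i.2.le u]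
    exact Iff.rfl
  rw [midState, checkConditions_A]
  refine if_congr ?_ rfl rfl
  rw [← hC, message_check, Option.elim_some, decide_eq_true_eq, and_self_left]
  rfl

lemma readStep_propose_publicPart (v₀ : V) (ord : Fin n ≃ V) (G : SimpleGraph V)
    (x : V → NodeNoise p V n) (i : Fin n) :
    readStep v₀ ord (publicPart (collect v₀ x) (midState ord G (collect v₀ x) i))
      (fun u => some (message ord (G.neighborSet u) u
        (publicPart (collect v₀ x) (midState ord G (collect v₀ x) i)) (2 * i + 2) (x u)))
      (2 * i + 2) = publicPart (collect v₀ x) (runUpTo ord G (collect v₀ x) (i + 1)) := by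
  classical
  rw [readStep_propose, runUpTo_succ]
  have hidx : (Finset.univ.filter (IndexPasses ord (G.neighborSet (ord i))
      (publicPart (collect v₀ x) (midState ord G (collect v₀ x) i)) i (x (ord i)))).min =
      chooseIdx ord G (collect v₀ x) i (midState ord G (collect v₀ x) i) := by
    rw [chooseIdx]
    congr 1
    ext r
    rw [Finset.mem_filter, Finset.mem_filter]
    refine and_congr_right fun _ => ?_
    rw [IndexPasses, earlierMatches_midState, localProposals_midState]
    rfl
  simp only [message_propose, Option.elim_some, if_true]
  rw [hidx]
  simp only [publicPart, propose_A, propose_idx]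
  congr!

/-- The protocol releases the public information of the run. -/
lemma readTranscript_simulate (v₀ : V) (ord : Fin n ≃ V) (G : SimpleGraph V)
    (x : V → NodeNoise p V n) (k : ℕ) (hk : k ≤ n) :
    readTranscript v₀ ord (simulate (nodeOutput v₀ ord) G x (2 * k + 1)) =
      publicPart (collect v₀ x) (runUpTo ord G (collect v₀ x) k) := by
  induction k with
  | zero =>
    rw [simulate, readTranscript_append, length_simulate]
    refine congrArg (fun c => Billboard.mk c _ _) ?_
    ext e r
    change (x v₀).1 ((e.map ord.symm).map ord) r = (x v₀).1 e r
    rw [Sym2.map_map, Equiv.self_comp_symm, Sym2.map_id]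
    rfl
  | succ k ih =>
    have ih := ih (by omega)
    have hmid : readTranscript v₀ ord (simulate (nodeOutput v₀ ord) G x (2 * k + 2)) =
        publicPart (collect v₀ x) (midState ord G (collect v₀ x) ⟨k, hk⟩) := by
      rw [simulate, readTranscript_append, length_simulate, ih,
        ← readStep_check_publicPart v₀ ord G x ⟨k, hk⟩]
      simp only [nodeOutput, length_simulate, ih]
    rw [show 2 * (k + 1) + 1 = (2 * k + 2) + 1 by ring, simulate, readTranscript_append,
      length_simulate, hmid]
    have := readStep_propose_publicPart v₀ ord G x ⟨k, hk⟩
    rw [← this]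
    simp only [nodeOutput, length_simulate, hmid]

lemma readTranscript_simulate_eq_billboard (v₀ : V) (ord : Fin n ≃ V) (G : SimpleGraph V)
    (x : V → NodeNoise p V n) :
    readTranscript v₀ ord (simulate (nodeOutput v₀ ord) G x (2 * n + 1)) =
      billboard ord G (collect v₀ x) := by
  rw [readTranscript_simulate v₀ ord G x n le_rfl, ← run_eq_runUpTo]
  rfl

/-! ### Privacy of a single node -/

/-- Changing a neighborhood in the single element `w` changes a count of neighbors by at most one,
and only if `w` is counted. -/
lemma abs_card_filter_sub_le {a a' : Set V} {w : V} (h : symmDiff a a' = {w}) (P : V → Prop)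
    [DecidablePred fun u => u ∈ a ∧ P u] [DecidablePred fun u => u ∈ a' ∧ P u] [Decidable (P w)] :
    |((Finset.univ.filter fun u => u ∈ a ∧ P u).card : ℝ) -
      ((Finset.univ.filter fun u => u ∈ a' ∧ P u).card : ℝ)| ≤ if P w then 1 else 0 := by
  classical
  have hne : ∀ u, u ≠ w → (u ∈ a ↔ u ∈ a') := by
    intro u hu
    have : u ∉ symmDiff a a' := by rw [h]; exact hu
    rw [Set.mem_symmDiff] at this
    tauto
  rw [Finset.card_filter, Finset.card_filter]
  push_cast
  rw [← Finset.sum_sub_distrib, Finset.sum_eq_single w]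
  · by_cases hP : P w
    · simp only [hP, and_true, if_true]
      split_ifs <;> simp
    · simp [hP]
  · intro u _ hu
    simp [hne u hu]
  · intro h
    exact absurd (Finset.mem_univ w) h

lemma abs_card_localMatches_sub_le {a a' : Set V} {w : V} (h : symmDiff a a' = {w})
    (ord : Fin n ≃ V) (B : Billboard p V n) (v : V) :
    |((localMatches ord a B v).card : ℝ) - ((localMatches ord a' B v).card : ℝ)| ≤ 1 := by
  classical
  refine (abs_card_filter_sub_le h _).trans ?_
  split_ifs <;> simp

/-- The quantity tested by a proposing node has sensitivity one: its earlier partners and the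
nodes to which it proposes are different neighbors. -/
lemma abs_card_earlier_add_proposals_sub_le {a a' : Set V} {w : V} (h : symmDiff a a' = {w})
    (ord : Fin n ≃ V) (B : Billboard p V n) (i : Fin n) (r : Fin (p.numIdx n)) :
    |(((earlierMatches ord a B (ord i)).card : ℝ) + (localProposals ord a B i r).card) -
      (((earlierMatches ord a' B (ord i)).card : ℝ) + (localProposals ord a' B i r).card)| ≤ 1 := by
  classical
  have h1 := abs_card_filter_sub_le h fun u => ((u ∈ B.implicitSolution ord (ord i) ∨
    ord i ∈ B.implicitSolution ord u) ∧ ord.symm u < ord.symm (ord i))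
  have h2 := abs_card_filter_sub_le h fun u => ((i : WithTop (Fin n)) < B.A u ∧ i < ord.symm u ∧
    B.coin s(u, ord i) r = true)
  have hE : ∀ a : Set V, earlierMatches ord a B (ord i) =
      Finset.univ.filter fun u => u ∈ a ∧ ((u ∈ B.implicitSolution ord (ord i) ∨
        ord i ∈ B.implicitSolution ord u) ∧ ord.symm u < ord.symm (ord i)) := by
    intro a
    ext u
    simp [earlierMatches, mem_localMatches, and_assoc]
  have hP : ∀ a : Set V, localProposals ord a B i r = Finset.univ.filter fun u =>
      u ∈ a ∧ ((i : WithTop (Fin n)) < B.A u ∧ i < ord.symm u ∧ B.coin s(u, ord i) r = true) :=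
    fun a => rfl
  rw [hE a, hE a', hP a, hP a', add_sub_add_comm]
  refine (abs_add_le _ _).trans ((add_le_add h1 h2).trans ?_)
  rw [Equiv.symm_apply_apply]
  by_cases hlt : ord.symm w < i
  · rw [if_neg (fun h : _ ∧ _ ∧ _ => lt_asymm hlt h.2.1), add_zero]
    split_ifs <;> simp
  · rw [if_neg (fun h : _ ∧ _ => hlt h.2), zero_add]
    split_ifs <;> simp

lemma min_filter_eq_iff {m : ℕ} (F : Fin m → Prop) [DecidablePred F] (q : WithTop (Fin m)) :
    (Finset.univ.filter F).min = q ↔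
      (∀ r : Fin m, (r : WithTop (Fin m)) < q → ¬ F r) ∧ ∀ r : Fin m, q = r → F r := by
  constructor
  · rintro rfl
    refine ⟨fun r hr hF => ?_, fun r hr => ?_⟩
    · exact absurd (Finset.min_le (Finset.mem_filter.2 ⟨Finset.mem_univ r, hF⟩)) (not_le.2 hr)
    · exact (Finset.mem_filter.1 (Finset.mem_of_min hr)).2
  · rintro ⟨h1, h2⟩
    refine le_antisymm ?_ ?_
    · cases q with
      | top => exact le_top
      | coe r => exact Finset.min_le (Finset.mem_filter.2 ⟨Finset.mem_univ r, h2 r rfl⟩)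
    · refine Finset.le_min fun r hr => ?_
      exact not_lt.1 fun h => h1 r h (Finset.mem_filter.1 hr).2

/-- A time that was released stays the same. -/
lemma readTranscript_A_stable (v₀ : V) (ord : Fin n ≃ V) (u : V) (i : Fin n)
    (π : Transcript V (Message p n)) (hπ : 2 * (i : ℕ) + 2 ≤ π.length)
    (h : (readTranscript v₀ ord (π.take (2 * i + 2))).A u = (i : WithTop (Fin n))) :
    (readTranscript v₀ ord π).A u = (i : WithTop (Fin n)) := by
  classical
  induction π using List.reverseRecOn with
  | nil => simp at hπ
  | append_singleton π ρ ih =>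
    rcases Nat.lt_or_ge π.length (2 * (i : ℕ) + 2) with hlt | hge
    · rwa [List.take_of_length_le (by simp; omega)] at h
    · rw [List.take_append_of_le_length hge] at h
      have := ih hge h
      rw [readTranscript_append]
      rcases round_cases n π.length with h0 | ⟨j, hj⟩ | ⟨j, hj⟩ | hgt
      · omega
      · rw [hj, readStep_check]
        simp only
        rw [if_neg, this]
        rintro ⟨h1, -⟩
        rw [this, WithTop.coe_lt_coe] at h1
        have : (j : ℕ) < i := h1
        omega
      · rw [hj, readStep_propose]
        exact this
      · rw [readStep_of_gt _ _ _ _ _ hgt, this]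

/-- The outcome of the check of `v` in iteration `i`, according to the transcript. -/
def checkBit (π : Transcript V (Message p n)) (v : V) (i : Fin n) : Bool :=
  ((π[2 * (i : ℕ) + 1]?).bind fun ρ => ρ v).elim false fun m => m.2.1

/-- The index published by `v` in the round in which it proposes. -/
def publishedIdx (ord : Fin n ≃ V) (π : Transcript V (Message p n)) (v : V) :
    WithTop (Fin (p.numIdx n)) :=
  ((π[2 * (ord.symm v : ℕ) + 2]?).bind fun ρ => ρ v).elim ⊤ fun m => m.2.2

open Classical in
/-- The shift of the noises in the checks of `v`: the noise in the check that passed is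
increased by `2`. -/
def checkShift (v₀ : V) (ord : Fin n ≃ V) (π : Transcript V (Message p n)) (v : V)
    (i : Fin n) : ℝ :=
  if checkBit π v i = true ∧ (readTranscript v₀ ord π).A v = (i : WithTop (Fin n)) then 2 else 0

open Classical in
/-- The shift of the noises in the estimates of the sizes: the noise of the published index is
decreased by `2`. -/
def sizeShift (ord : Fin n ≃ V) (π : Transcript V (Message p n)) (v : V)
    (r : Fin (p.numIdx n)) : ℝ :=
  if publishedIdx ord π v = (r : WithTop (Fin (p.numIdx n))) then -2 else 0

/-- The coupling behind the privacy of a node, for a fixed transcript: shift the noise in the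
threshold and the noise in the degree by one, and the noise in the two queries that were answered
positively by two. -/
def shiftNoise (v₀ : V) (ord : Fin n ≃ V) (π : Transcript V (Message p n)) (v : V) :
    NodeNoise p V n → NodeNoise p V n :=
  Prod.map id (Prod.map (· + 1) (Prod.map (· + checkShift v₀ ord π v)
    (Prod.map (· + sizeShift ord π v) (· + 1))))

lemma shiftNoise_mem_consistent (v₀ : V) (ord : Fin n ≃ V) (v : V) {a a' : Set V} {w : V}
    (h : symmDiff a a' = {w}) (π : Transcript V (Message p n)) {x : NodeNoise p V n}
    (hx : x ∈ consistent (nodeOutput v₀ ord) v a π) :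
    shiftNoise v₀ ord π v x ∈ consistent (nodeOutput v₀ ord) v a' π := by
  classical
  intro t ρ ht
  have hlt : t < π.length := by
    by_contra h'
    rw [List.getElem?_eq_none (not_lt.1 h')] at ht
    simp at ht
  have hxt := hx t ρ ht
  rw [← hxt]
  congr 1
  have hlen : (π.take t).length = t := by simp; omega
  simp only [nodeOutput, hlen] at hxt ⊢
  set B := readTranscript v₀ ord (π.take t) with hB
  rcases round_cases n t with rfl | ⟨i, rfl⟩ | ⟨i, rfl⟩ | hgt
  · rfl
  · rw [message_check] at hxt ⊢
    rw [message_check]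
    congr 2
    rw [decide_eq_decide]
    refine and_congr_right fun hact => ?_
    have hsens := abs_le.1 (abs_card_localMatches_sub_le h ord B v)
    have hbit : checkBit π v i =
        decide ((i : WithTop (Fin n)) < B.A v ∧ CheckPasses ord a v B i x) := by
      simp only [checkBit, ht, Option.bind_some, ← hxt, Option.elim_some]
    simp only [hact, true_and] at hbit
    simp only [CheckPasses, shiftNoise, Prod.map_fst, Prod.map_snd, Pi.add_apply] at hbit ⊢
    by_cases hpass : CheckPasses ord a v B i x
    · -- the time `A(v)` is set to `i` in this round and never changes again
      have hA : (readTranscript v₀ ord π).A v = (i : WithTop (Fin n)) := by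
        refine readTranscript_A_stable v₀ ord v i π (by omega) ?_
        rw [show 2 * (i : ℕ) + 2 = (2 * (i : ℕ) + 1) + 1 by ring, List.take_add_one, ht]
        simp only [Option.toList_some]
        rw [readTranscript_append, hlen, ← hB, readStep_check]
        simp only
        rw [if_pos]
        rw [← hxt]
        simp [hact, hpass]
      have hshift : checkShift v₀ ord π v i = 2 := by
        have hb : checkBit π v i = true := by
          rw [hbit]
          exact decide_eq_true hpass
        rw [checkShift, if_pos ⟨hb, hA⟩]
      rw [hshift]
      simp only [CheckPasses] at hpass
      refine iff_of_true ?_ hpass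
      linarith [hsens.2]
    · have hshift : checkShift v₀ ord π v i = 0 := by
        rw [checkShift, if_neg]
        rintro ⟨h1, -⟩
        rw [hbit] at h1
        exact hpass (of_decide_eq_true h1)
      rw [hshift]
      simp only [CheckPasses] at hpass
      refine iff_of_false ?_ hpass
      intro h'
      apply hpass
      linarith [hsens.1]
  · rw [message_propose] at hxt ⊢
    rw [message_propose]
    congr 2
    split_ifs with hv
    swap
    · rfl
    have hidx : publishedIdx ord π v = (Finset.univ.filter (IndexPasses ord a B i x)).min := by
      subst hv
      simp only [publishedIdx, Equiv.symm_apply_apply, ht, Option.bind_some, ← hxt,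
        Option.elim_some, if_true]
    obtain ⟨h1, h2⟩ := (min_filter_eq_iff _ _).1 hidx.symm
    rw [← hidx, min_filter_eq_iff]
    have hsens := fun r => abs_le.1 (abs_card_earlier_add_proposals_sub_le h ord B i r)
    simp only [IndexPasses, shiftNoise, Prod.map_fst, Prod.map_snd, Pi.add_apply] at h1 h2 ⊢
    refine ⟨fun r hr h' => h1 r hr ?_, fun r hr => ?_⟩
    · have hshift : sizeShift ord π v r = 0 := by
        rw [sizeShift, if_neg]
        intro h''
        rw [h''] at hr
        exact lt_irrefl _ hr
      rw [hshift] at h'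
      linarith [(hsens r).1, (hsens r).2]
    · have hshift : sizeShift ord π v r = -2 := by
        rw [sizeShift, if_pos hr]
      have := h2 r hr
      rw [hshift]
      linarith [(hsens r).1, (hsens r).2]
  · rw [message_of_gt _ _ _ _ _ hgt, message_of_gt _ _ _ _ _ hgt]

lemma sum_abs_ite_le {ι : Type*} [Fintype ι] (P : ι → Prop) [DecidablePred P] (d : ℝ)
    (hP : ∀ i j, P i → P j → i = j) : ∑ i, |if P i then d else 0| ≤ |d| := by
  classical
  by_cases h : ∃ i, P i
  · obtain ⟨i, hi⟩ := h
    rw [Finset.sum_eq_single i]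
    · simp [hi]
    · intro j _ hj
      rw [if_neg fun h => hj (hP _ _ h hi), abs_zero]
    · simp
  · push Not at h
    simp [h]

lemma sum_abs_checkShift_le (v₀ : V) (ord : Fin n ≃ V) (π : Transcript V (Message p n)) (v : V) :
    ∑ i, |checkShift v₀ ord π v i| ≤ 2 := by
  classical
  refine (sum_abs_ite_le _ 2 fun i j hi hj => ?_).trans (by norm_num)
  exact WithTop.coe_injective (hi.2.symm.trans hj.2)

lemma sum_abs_sizeShift_le (ord : Fin n ≃ V) (π : Transcript V (Message p n)) (v : V) :
    ∑ r, |sizeShift ord π v r| ≤ 2 := by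
  classical
  refine (sum_abs_ite_le _ (-2) fun i j hi hj => ?_).trans (by norm_num)
  exact WithTop.coe_injective (hi.symm.trans hj)

/-- The law of the coins. -/
def coinsLaw (p : Params) (V : Type*) [Fintype V] (n : ℕ) :
    Measure (Sym2 V → Fin (p.numIdx n) → Bool) :=
  Measure.pi fun _ : Sym2 V => Measure.pi fun r : Fin (p.numIdx n) =>
    coinLaw (((1 + p.eta) ^ (r : ℕ))⁻¹)

/-- The law of the private randomness of a node. -/
def nodeLaw (p : Params) (V : Type*) [Fintype V] (n : ℕ) : Measure (NodeNoise p V n) :=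
  (coinsLaw p V n).prod <| (laplace (4 / p.eps')).prod <|
  (Measure.pi fun _ : Fin n => laplace (8 / p.eps')).prod <|
  (Measure.pi fun _ : Fin (p.numIdx n) => laplace (2 / p.eps')).prod (laplace (2 / p.eps'))

lemma isProbabilityMeasure_coinLaw_pow (hη : 0 ≤ p.eta) (r : ℕ) :
    IsProbabilityMeasure (coinLaw (((1 + p.eta) ^ r)⁻¹)) :=
  isProbabilityMeasure_coinLaw (by positivity)
    (inv_le_one_of_one_le₀ (one_le_pow₀ (by linarith)))

lemma isProbabilityMeasure_coinsLaw (hη : 0 ≤ p.eta) :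
    IsProbabilityMeasure (coinsLaw p V n) := by
  have := isProbabilityMeasure_coinLaw_pow hη
  unfold coinsLaw
  infer_instance

lemma isProbabilityMeasure_nodeLaw (hη : 0 ≤ p.eta) (hε : 0 < p.eps') :
    IsProbabilityMeasure (nodeLaw p V n) := by
  have := isProbabilityMeasure_coinsLaw (V := V) (n := n) hη
  have := isProbabilityMeasure_laplace (s := 4 / p.eps') (by positivity)
  have := isProbabilityMeasure_laplace (s := 8 / p.eps') (by positivity)
  have := isProbabilityMeasure_laplace (s := 2 / p.eps') (by positivity)
  unfold nodeLaw
  infer_instance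

lemma isProbabilityMeasure_randomnessLaw (hη : 0 ≤ p.eta) (hε : 0 < p.eps') :
    IsProbabilityMeasure (randomnessLaw p V n) := by
  have := isProbabilityMeasure_coinLaw_pow hη
  have := isProbabilityMeasure_laplace (s := 4 / p.eps') (by positivity)
  have := isProbabilityMeasure_laplace (s := 8 / p.eps') (by positivity)
  have := isProbabilityMeasure_laplace (s := 2 / p.eps') (by positivity)
  unfold randomnessLaw
  infer_instance

lemma measurable_shiftNoise (v₀ : V) (ord : Fin n ≃ V) (π : Transcript V (Message p n)) (v : V) :
    Measurable (shiftNoise v₀ ord π v) := by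
  unfold shiftNoise
  fun_prop

/-- The shift of the noises of a node costs a factor `exp (2 ε')`: the threshold `ε'/4`, the check
`2 ε'/8`, the size `2 ε'/2` and the degree `ε'/2`. -/
lemma map_shiftNoise_le (hη : 0 ≤ p.eta) (hε : 0 < p.eps') (v₀ : V) (ord : Fin n ≃ V)
    (π : Transcript V (Message p n)) (v : V) :
    (nodeLaw p V n).map (shiftNoise v₀ ord π v) ≤
      ENNReal.ofReal (Real.exp (2 * p.eps')) • nodeLaw p V n := by
  have := isProbabilityMeasure_coinsLaw (V := V) (n := n) hη
  have := isProbabilityMeasure_laplace (s := 4 / p.eps') (by positivity)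
  have := isProbabilityMeasure_laplace (s := 8 / p.eps') (by positivity)
  have := isProbabilityMeasure_laplace (s := 2 / p.eps') (by positivity)
  have h0 : (coinsLaw p V n).map id ≤ ENNReal.ofReal (Real.exp 0) • coinsLaw p V n := by simp
  have h1 := laplace_map_add_le (s := 4 / p.eps') (by positivity) 1
  have h2 := pi_laplace_map_add_le (s := 8 / p.eps') (by positivity) (checkShift v₀ ord π v)
  have h3 := pi_laplace_map_add_le (s := 2 / p.eps') (by positivity) (sizeShift ord π v)
  have h4 := laplace_map_add_le (s := 2 / p.eps') (by positivity) 1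
  have h34 := prod_map_le (by fun_prop) (by fun_prop) h3 h4
  have h234 := prod_map_le (by fun_prop) (by fun_prop) h2 h34
  have h1234 := prod_map_le (by fun_prop) (by fun_prop) h1 h234
  have hall := prod_map_le (by fun_prop) (by fun_prop) h0 h1234
  refine hall.trans ?_
  intro S
  rw [Measure.smul_apply, Measure.smul_apply, smul_eq_mul, smul_eq_mul]
  refine mul_le_mul_left (ENNReal.ofReal_le_ofReal (Real.exp_le_exp.2 ?_)) _
  have hs1 := sum_abs_checkShift_le v₀ ord π v
  have hs2 := sum_abs_sizeShift_le ord π v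
  have e1 : (∑ i, |checkShift v₀ ord π v i|) / (8 / p.eps') ≤ 2 / (8 / p.eps') := by gcongr
  have e2 : (∑ i, |sizeShift ord π v i|) / (2 / p.eps') ≤ 2 / (2 / p.eps') := by gcongr
  refine (add_le_add le_rfl (add_le_add le_rfl (add_le_add e1 (add_le_add e2 le_rfl)))).trans ?_
  rw [abs_one]
  refine le_of_eq ?_
  field_simp
  ring

lemma measurableSet_of_discrete_factor {α β : Type*} {Z : Type*} [MeasurableSpace α]
    [MeasurableSpace Z] [DiscreteMeasurableSpace Z] {h : α → Z} (hh : Measurable h) (g : Z → β)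
    (f : α → β) (hf : ∀ x, f x = g (h x)) (S : Set β) : MeasurableSet {x | f x ∈ S} := by
  have : {x | f x ∈ S} = h ⁻¹' (g ⁻¹' S) := by
    ext x
    simp [hf]
  rw [this]
  exact hh MeasurableSet.of_discrete

lemma measurableSet_nodeOutput (v₀ : V) (ord : Fin n ≃ V) (v : V) (a : Set V)
    (π : Transcript V (Message p n)) (y : Message p n) :
    MeasurableSet {x | nodeOutput v₀ ord v a π x = y} := by
  classical
  simp only [nodeOutput]
  set B := readTranscript v₀ ord π
  rcases round_cases n π.length with h | ⟨i, h⟩ | ⟨i, h⟩ | h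
  · rw [h]
    exact measurableSet_of_discrete_factor (measurable_fst)
      (fun c : Sym2 V → Fin (p.numIdx n) → Bool =>
        ((fun e r => c (e.map ord) r, false, ⊤) : Message p n)) _ (fun x => rfl) {y}
  · rw [h]
    have hh : MeasurableSet {x : NodeNoise p V n | CheckPasses ord a v B i x} :=
      measurableSet_le (by fun_prop) (by fun_prop)
    exact measurableSet_of_discrete_factor (measurable_to_bool (f := fun x : NodeNoise p V n =>
        decide (CheckPasses ord a v B i x)) (by simpa [Set.preimage] using hh))
      (fun c => ((fun _ _ => false, decide ((i : WithTop (Fin n)) < B.A v ∧ c = true), ⊤) :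
        Message p n)) _ (fun x => by simp [message_check]) {y}
  · rw [h]
    have hh : ∀ r, MeasurableSet {x : NodeNoise p V n | IndexPasses ord a B i x r} :=
      fun r => measurableSet_le (by fun_prop) (by fun_prop)
    have hh' : Measurable fun (x : NodeNoise p V n) (r : Fin (p.numIdx n)) =>
        decide (IndexPasses ord a B i x r) :=
      measurable_pi_lambda _ fun r => measurable_to_bool (by simpa [Set.preimage] using hh r)
    exact measurableSet_of_discrete_factor hh'
      (fun c => ((fun _ _ => false, false, if v = ord i then
        (Finset.univ.filter fun r => c r = true).min else ⊤) : Message p n)) _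
      (fun x => by simp [message_propose]) {y}
  · simp [message_of_gt _ _ _ _ _ h]

lemma nodePrivate_nodeOutput (hη : 0 ≤ p.eta) (hε : 0 < p.eps') (v₀ : V) (ord : Fin n ≃ V) :
    NodePrivate (nodeLaw p V n) (nodeOutput v₀ ord) (2 * p.eps') := by
  rintro v a a' - - ⟨w, hw⟩ π
  have hmeas := measurableSet_consistent (nodeOutput v₀ ord)
    (measurableSet_nodeOutput (p := p) v₀ ord) v a' π
  calc nodeLaw p V n (consistent (nodeOutput v₀ ord) v a π)
      ≤ nodeLaw p V n (shiftNoise v₀ ord π v ⁻¹' consistent (nodeOutput v₀ ord) v a' π) :=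
        measure_mono fun x hx => shiftNoise_mem_consistent v₀ ord v hw π hx
    _ = (nodeLaw p V n).map (shiftNoise v₀ ord π v) (consistent (nodeOutput v₀ ord) v a' π) :=
        (Measure.map_apply (measurable_shiftNoise v₀ ord π v) hmeas).symm
    _ ≤ _ := map_shiftNoise_le hη hε v₀ ord π v _

end Protocol

/-! ### Measurability of the run -/

section Measurability

variable {p : Params} {V : Type*} [Fintype V] {n : ℕ}

instance : MeasurableSpace (State p V n) := ⊤

instance : DiscreteMeasurableSpace (State p V n) := ⟨fun _ => trivial⟩

instance : Finite (State p V n) := by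
  have : Finite (WithTop (Fin n)) := inferInstanceAs (Finite (Option (Fin n)))
  have : Finite (WithTop (Fin (p.numIdx n))) :=
    inferInstanceAs (Finite (Option (Fin (p.numIdx n))))
  refine Finite.of_injective (fun s : State p V n => (s.M, s.A, s.idx)) ?_
  rintro ⟨M, A, idx⟩ ⟨M', A', idx'⟩ h
  simpa using h

lemma Randomness.measurable_coin : Measurable fun ω : Randomness p V n => ω.coin := measurable_fst

lemma Randomness.measurable_thresholdNoise (u : V) :
    Measurable fun ω : Randomness p V n => ω.thresholdNoise u := by
  unfold Randomness.thresholdNoise; fun_prop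

lemma Randomness.measurable_checkNoise (i : Fin n) (u : V) :
    Measurable fun ω : Randomness p V n => ω.checkNoise i u := by
  unfold Randomness.checkNoise; fun_prop

lemma Randomness.measurable_sizeNoise (v : V) (r : Fin (p.numIdx n)) :
    Measurable fun ω : Randomness p V n => ω.sizeNoise v r := by
  unfold Randomness.sizeNoise; fun_prop

lemma Randomness.measurable_degreeNoise (v : V) :
    Measurable fun ω : Randomness p V n => ω.degreeNoise v := by
  unfold Randomness.degreeNoise; fun_prop

lemma measurable_discrete_factor {α Z β : Type*} [MeasurableSpace α] [MeasurableSpace Z]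
    [DiscreteMeasurableSpace Z] [MeasurableSpace β] {h : α → Z} (hh : Measurable h) (g : Z → β)
    {f : α → β} (hf : ∀ x, f x = g (h x)) : Measurable f := by
  have : f = g ∘ h := funext hf
  rw [this]
  exact (Measurable.of_discrete).comp hh

lemma measurable_checkConditions (i : Fin n) (s : State p V n) :
    Measurable fun ω : Randomness p V n => checkConditions ω i s := by
  classical
  have hh : Measurable fun (ω : Randomness p V n) (u : V) =>
      decide (noisyThreshold ω u ≤ ((s.M u).card : ℝ) + ω.checkNoise i u) := by
    refine measurable_pi_lambda _ fun u => measurable_to_bool ?_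
    have : MeasurableSet {ω : Randomness p V n |
        noisyThreshold ω u ≤ ((s.M u).card : ℝ) + ω.checkNoise i u} :=
      measurableSet_le ((Randomness.measurable_thresholdNoise u).const_add _)
        ((Randomness.measurable_checkNoise i u).const_add _)
    simpa [Set.preimage] using this
  refine measurable_discrete_factor hh (fun c => ({ s with
    A := fun u => if (i : WithTop (Fin n)) < s.A u ∧ c u = true
      then (i : WithTop (Fin n)) else s.A u } : State p V n)) fun ω => ?_
  simp only [checkConditions, decide_eq_true_eq]

lemma measurable_propose (ord : Fin n ≃ V) (G : SimpleGraph V) (i : Fin n) (s : State p V n) :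
    Measurable fun ω : Randomness p V n => propose ord G ω i s := by
  classical
  have hh : Measurable fun (ω : Randomness p V n) (r : Fin (p.numIdx n)) =>
      decide ((((s.M (ord i)).card : ℝ) + ω.degreeNoise (ord i)) +
        (((proposalSet ord G ω i s.A r).card : ℝ) + ω.sizeNoise (ord i) r) +
        12 * p.c * Real.log n / p.eps' ≤ p.b) := by
    refine measurable_pi_lambda _ fun r => measurable_to_bool ?_
    have hcard : Measurable fun ω : Randomness p V n =>
        ((proposalSet ord G ω i s.A r).card : ℝ) :=
      measurable_discrete_factor Randomness.measurable_coin
        (fun c => ((Finset.univ.filter fun u => (i : WithTop (Fin n)) < s.A u ∧ i < ord.symm u ∧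
          G.Adj u (ord i) ∧ c s(u, ord i) r = true).card : ℝ)) fun ω => rfl
    have : MeasurableSet {ω : Randomness p V n |
        (((s.M (ord i)).card : ℝ) + ω.degreeNoise (ord i)) +
        (((proposalSet ord G ω i s.A r).card : ℝ) + ω.sizeNoise (ord i) r) +
        12 * p.c * Real.log n / p.eps' ≤ p.b} :=
      measurableSet_le ((((Randomness.measurable_degreeNoise (ord i)).const_add _).add
        (hcard.add (Randomness.measurable_sizeNoise (ord i) r))).add_const _) measurable_const
    simpa [Set.preimage] using this
  refine measurable_discrete_factor (Randomness.measurable_coin.prodMk hh)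
    (fun c => if (i : WithTop (Fin n)) < s.A (ord i) then
      let rv := (Finset.univ.filter fun r => c.2 r = true).min
      let W : Finset V := rv.recTopCoe ∅ fun r => Finset.univ.filter fun u =>
        (i : WithTop (Fin n)) < s.A u ∧ i < ord.symm u ∧ G.Adj u (ord i) ∧
          c.1 s(u, ord i) r = true
      { M := fun u =>
          if u = ord i then s.M u ∪ W else if u ∈ W then insert (ord i) (s.M u) else s.M u
        A := s.A
        idx := Function.update s.idx (ord i) rv }
      else s) fun ω => ?_
  unfold propose chooseIdx proposalSet
  simp only [decide_eq_true_eq]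

lemma measurable_step {α : Type*} [MeasurableSpace α] {F : α → State p V n → State p V n}
    (hF : ∀ s, Measurable fun ω => F ω s) {g : α → State p V n} (hg : Measurable g) :
    Measurable fun ω => F ω (g ω) := by
  have : Measurable fun q : α × State p V n => F q.1 q.2 := measurable_from_prod_countable_left hF
  exact this.comp (measurable_id.prodMk hg)

lemma measurable_runUpTo (ord : Fin n ≃ V) (G : SimpleGraph V) (k : ℕ) :
    Measurable fun ω : Randomness p V n => runUpTo ord G ω k := by
  induction k with
  | zero => exact measurable_const
  | succ k ih =>
    simp only [runUpTo]
    split_ifs with h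
    · exact measurable_step (measurable_propose ord G ⟨k, h⟩)
        (measurable_step (measurable_checkConditions ⟨k, h⟩) ih)
    · exact ih

lemma measurable_midState (ord : Fin n ≃ V) (G : SimpleGraph V) (i : Fin n) :
    Measurable fun ω : Randomness p V n => midState ord G ω i :=
  measurable_step (measurable_checkConditions i) (measurable_runUpTo ord G i)

lemma measurableSet_billboard (ord : Fin n ≃ V) (G : SimpleGraph V) (S : Set (Billboard p V n)) :
    MeasurableSet {ω : Randomness p V n | billboard ord G ω ∈ S} := by
  have h := (Randomness.measurable_coin (p := p) (V := V) (n := n)).prodMk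
    (measurable_runUpTo ord G n)
  refine measurableSet_of_discrete_factor h
    (fun c => ({ coin := c.1, A := c.2.A, idx := c.2.idx } : Billboard p V n)) _
    (fun ω => ?_) S
  simp only [billboard, run_eq_runUpTo]

/-! ### The algorithm is private -/

/-- The draws collected from independent nodes have the law of the draws of the algorithm. -/
lemma measurePreserving_collect (hη : 0 ≤ p.eta) (hε : 0 < p.eps') (v₀ : V) :
    MeasurePreserving (collect v₀) (Measure.pi fun _ : V => nodeLaw p V n)
      (randomnessLaw p V n) := by
  have := isProbabilityMeasure_coinsLaw (V := V) (n := n) hη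
  have := isProbabilityMeasure_laplace (s := 4 / p.eps') (by positivity)
  have := isProbabilityMeasure_laplace (s := 8 / p.eps') (by positivity)
  have := isProbabilityMeasure_laplace (s := 2 / p.eps') (by positivity)
  have h4 := measurePreserving_arrowProdEquivProdArrow (Fin (p.numIdx n) → ℝ) ℝ V
    (fun _ => Measure.pi fun _ => laplace (2 / p.eps')) (fun _ => laplace (2 / p.eps'))
  have h3 := ((measurePreserving_pi_swap (ι := V) (κ := Fin n) (laplace (8 / p.eps'))).prod
    h4).comp (measurePreserving_arrowProdEquivProdArrow (Fin n → ℝ)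
      ((Fin (p.numIdx n) → ℝ) × ℝ) V (fun _ => Measure.pi fun _ => laplace (8 / p.eps'))
      (fun _ => (Measure.pi fun _ => laplace (2 / p.eps')).prod (laplace (2 / p.eps'))))
  have h2 := ((MeasurePreserving.id (Measure.pi fun _ : V => laplace (4 / p.eps'))).prod h3).comp
    (measurePreserving_arrowProdEquivProdArrow ℝ
      ((Fin n → ℝ) × (Fin (p.numIdx n) → ℝ) × ℝ) V (fun _ => laplace (4 / p.eps'))
      (fun _ => (Measure.pi fun _ => laplace (8 / p.eps')).prod
        ((Measure.pi fun _ => laplace (2 / p.eps')).prod (laplace (2 / p.eps')))))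
  have h1 := ((measurePreserving_eval (fun _ : V => coinsLaw p V n) v₀).prod h2).comp
    (measurePreserving_arrowProdEquivProdArrow (Sym2 V → Fin (p.numIdx n) → Bool)
      (ℝ × (Fin n → ℝ) × (Fin (p.numIdx n) → ℝ) × ℝ) V (fun _ => coinsLaw p V n)
      (fun _ => (laplace (4 / p.eps')).prod ((Measure.pi fun _ => laplace (8 / p.eps')).prod
        ((Measure.pi fun _ => laplace (2 / p.eps')).prod (laplace (2 / p.eps'))))))
  exact h1

lemma IsLEDP.mono {V B : Type*} [Fintype V] {ε ε' : ℝ} {law : SimpleGraph V → Set B → ℝ≥0∞}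
    (h : IsLEDP ε law) (hle : ε ≤ ε') : IsLEDP ε' law := by
  obtain ⟨Y, hY, P, T, read, h1, h2, h3⟩ := h
  refine ⟨Y, hY, P, T, read, h1, fun G G' hG S => (h2 G G' hG S).trans ?_, h3⟩
  gcongr

/-- If there are no nodes, the billboard is constant. -/
lemma isLEDP_of_isEmpty [IsEmpty V] (hη : 0 ≤ p.eta) (hε' : 0 < p.eps') {ε : ℝ} (hε : 0 ≤ ε)
    (ord : Fin n ≃ V) : IsLEDP ε fun G => billboardLaw p ord G := by
  have hsub : ∀ B B' : Billboard p V n, B = B' := by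
    rintro ⟨c, A, idx⟩ ⟨c', A', idx'⟩
    congr 1
    · funext e
      exact e.ind fun v => isEmptyElim v
    · exact Subsingleton.elim _ _
    · exact Subsingleton.elim _ _
  let B₀ : Billboard p V n := ⟨fun _ _ => false, fun _ => ⊤, fun _ => ⊤⟩
  have := isProbabilityMeasure_randomnessLaw (V := V) (n := n) hη hε'
  refine ⟨Unit, inferInstance, fun _ => none, 0, fun _ => B₀, fun _ _ _ => rfl, ?_, ?_⟩
  · intro G G' _ S
    simp only [transcriptLaw]
    refine le_mul_of_one_le_left zero_le ?_
    rw [ENNReal.one_le_ofReal]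
    exact Real.one_le_exp hε
  · intro G S
    by_cases h : B₀ ∈ S
    · have hS : {ω : Randomness p V n | billboard ord G ω ∈ S} = Set.univ := by
        ext ω
        simp [hsub (billboard ord G ω) B₀, h]
      simp [billboardLaw, hS, transcriptLaw, PMF.toOuterMeasure_pure_apply, PMF.pure_map, h]
    · have hS : {ω : Randomness p V n | billboard ord G ω ∈ S} = ∅ := by
        ext ω
        simp [hsub (billboard ord G ω) B₀, h]
      simp [billboardLaw, hS, transcriptLaw, PMF.toOuterMeasure_pure_apply, PMF.pure_map, h]

/-- An edge costs `2ε'` at each of its endpoints. -/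
theorem isLEDP_billboardLaw (hη : 0 ≤ p.eta) (hε' : 0 < p.eps') {ε : ℝ}
    (hε : 4 * p.eps' ≤ ε) (ord : Fin n ≃ V) : IsLEDP ε fun G => billboardLaw p ord G := by
  rcases isEmpty_or_nonempty V with hV | ⟨⟨v₀⟩⟩
  · exact isLEDP_of_isEmpty hη hε' (by linarith) ord
  · have := isProbabilityMeasure_nodeLaw (V := V) (n := n) hη hε'
    refine (isLEDP_of_nodePrivate (nodeLaw p V n) (nodeOutput v₀ ord)
      (measurableSet_nodeOutput v₀ ord) (by positivity)
      (nodePrivate_nodeOutput hη hε' v₀ ord) (2 * n + 1) (readTranscript v₀ ord) _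
      fun G S => ?_).mono (by linarith)
    simp only [readTranscript_simulate_eq_billboard]
    exact ((measurePreserving_collect hη hε' v₀).measure_preimage
      (measurableSet_billboard ord G S).nullMeasurableSet).symm

end Measurability

/-! ### Comparing a `b`-matching with an optimal one -/

section Combinatorics

variable {V : Type*} [Fintype V]

lemma exists_isBMatching_ncard_eq (G : SimpleGraph V) (b : ℕ) :
    ∃ F : SimpleGraph V, IsBMatching G b F ∧ F.edgeSet.ncard = optBMatching G b := by
  refine Nat.sSup_mem (s := {k | ∃ F : SimpleGraph V, IsBMatching G b F ∧ F.edgeSet.ncard = k})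
    ⟨_, ⊥, ⟨bot_le, fun v => ?_⟩, rfl⟩ ⟨Fintype.card (Sym2 V), ?_⟩
  · simp
  · rintro _ ⟨F, _, rfl⟩
    exact (Set.ncard_le_ncard (Set.subset_univ _)).trans (by simp [Set.ncard_univ])

lemma ncard_neighborSet_inf_add_sdiff (F M : SimpleGraph V) (v : V) :
    ((F ⊓ M).neighborSet v).ncard + ((F \ M).neighborSet v).ncard = (F.neighborSet v).ncard := by
  rw [← Set.ncard_inter_add_ncard_sdiff_eq_ncard (F.neighborSet v) (M.neighborSet v)
    (Set.toFinite _)]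
  congr 2

lemma ncard_edgeSet_inf_add_sdiff (F M : SimpleGraph V) :
    (F ⊓ M).edgeSet.ncard + (F \ M).edgeSet.ncard = F.edgeSet.ncard := by
  rw [SimpleGraph.edgeSet_inf, SimpleGraph.edgeSet_sdiff,
    Set.ncard_inter_add_ncard_sdiff_eq_ncard _ _ (Set.toFinite _)]

open Classical in
lemma sum_ncard_neighborSet (H : SimpleGraph V) :
    ∑ v, (H.neighborSet v).ncard = 2 * H.edgeSet.ncard := by
  rw [Set.ncard_eq_toFinset_card' H.edgeSet]
  have := H.sum_degrees_eq_twice_card_edges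
  rw [SimpleGraph.edgeFinset] at this
  rw [← this]
  refine Finset.sum_congr rfl fun v _ => ?_
  rw [Set.ncard_eq_toFinset_card', ← SimpleGraph.card_neighborFinset_eq_degree]
  rfl

/-- If every edge of `H` has an endpoint in `T`, then the degrees in `T` account for all edges. -/
lemma ncard_edgeSet_le_sum (H : SimpleGraph V) (T : Finset V)
    (hT : ∀ u w, H.Adj u w → u ∈ T ∨ w ∈ T) :
    H.edgeSet.ncard ≤ ∑ v ∈ T, (H.neighborSet v).ncard := by
  classical
  have hsub : H.edgeSet ⊆ ⋃ v ∈ T, (fun w => s(v, w)) '' H.neighborSet v := by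
    intro e he
    induction e using Sym2.ind with
    | _ u w =>
      simp only [Set.mem_iUnion]
      rcases hT u w he with h | h
      · exact ⟨u, h, w, he, rfl⟩
      · exact ⟨w, h, u, he.symm, Sym2.eq_swap⟩
  refine (Set.ncard_le_ncard hsub (Set.toFinite _)).trans ?_
  refine (Finset.set_ncard_biUnion_le T _).trans ?_
  exact Finset.sum_le_sum fun v _ => Set.ncard_image_le (Set.toFinite _)

/-- If the vertices of degree at least `θ` in `M` cover all edges of `G` outside of `M`, then `M`
approximates the largest `b`-matchings of `G` with `b ≤ κ θ` up to a factor `2 κ`: an edge of such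
a `b`-matching outside of `M` is charged to an endpoint whose degree in `M` is large. -/
theorem optBMatching_le_of_cover {G M : SimpleGraph V} {b : ℕ} {θ κ : ℝ} (hκ : 1 ≤ κ)
    (hb : (b : ℝ) ≤ κ * θ) (hcov : ∀ u w, G.Adj u w → ¬ M.Adj u w →
      θ ≤ (M.neighborSet u).ncard ∨ θ ≤ (M.neighborSet w).ncard) :
    (optBMatching G b : ℝ) ≤ 2 * κ * M.edgeSet.ncard := by
  classical
  obtain ⟨F, hF, hopt⟩ := exists_isBMatching_ncard_eq G b
  rw [← hopt]
  have h1 := ncard_edgeSet_le_sum (F \ M)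
    (Finset.univ.filter fun v => θ ≤ ((M.neighborSet v).ncard : ℝ)) (by
      intro u w huw
      rw [SimpleGraph.sdiff_adj] at huw
      simpa using hcov u w (hF.1 huw.1) huw.2)
  have hinf : ∀ v, (((F ⊓ M).neighborSet v).ncard : ℝ) ≤ (M.neighborSet v).ncard := fun v =>
    Nat.cast_le.2 (Set.ncard_le_ncard (fun _ h => h.2) (Set.toFinite _))
  have h2 : ∀ v ∈ Finset.univ.filter (fun v => θ ≤ ((M.neighborSet v).ncard : ℝ)),
      (((F \ M).neighborSet v).ncard : ℝ) ≤
        κ * (M.neighborSet v).ncard - ((F ⊓ M).neighborSet v).ncard := by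
    intro v hv
    have hθ := (Finset.mem_filter.1 hv).2
    have e1 : (((F ⊓ M).neighborSet v).ncard : ℝ) + ((F \ M).neighborSet v).ncard =
        (F.neighborSet v).ncard := by
      exact_mod_cast ncard_neighborSet_inf_add_sdiff F M v
    have e2 : ((F.neighborSet v).ncard : ℝ) ≤ b := by
      exact_mod_cast hF.2 v
    have e3 : κ * θ ≤ κ * (M.neighborSet v).ncard := by gcongr
    linarith
  have h3 : ((F \ M).edgeSet.ncard : ℝ) ≤
      ∑ v : V, (κ * (M.neighborSet v).ncard - ((F ⊓ M).neighborSet v).ncard) := by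
    calc ((F \ M).edgeSet.ncard : ℝ)
        ≤ ∑ v ∈ Finset.univ.filter (fun v => θ ≤ ((M.neighborSet v).ncard : ℝ)),
          (((F \ M).neighborSet v).ncard : ℝ) := by
          exact_mod_cast h1
      _ ≤ ∑ v ∈ Finset.univ.filter (fun v => θ ≤ ((M.neighborSet v).ncard : ℝ)),
          (κ * (M.neighborSet v).ncard - ((F ⊓ M).neighborSet v).ncard) := Finset.sum_le_sum h2
      _ ≤ _ := by
          refine Finset.sum_le_sum_of_subset_of_nonneg (Finset.filter_subset _ _) fun v _ _ => ?_
          have : ((M.neighborSet v).ncard : ℝ) ≤ κ * (M.neighborSet v).ncard :=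
            le_mul_of_one_le_left (by positivity) hκ
          linarith [hinf v]
  have e1 : ∑ v : V, ((M.neighborSet v).ncard : ℝ) = 2 * M.edgeSet.ncard := by
    exact_mod_cast sum_ncard_neighborSet M
  have e2 : ∑ v : V, (((F ⊓ M).neighborSet v).ncard : ℝ) = 2 * (F ⊓ M).edgeSet.ncard := by
    exact_mod_cast sum_ncard_neighborSet (F ⊓ M)
  rw [Finset.sum_sub_distrib, ← Finset.mul_sum, e1, e2] at h3
  have e3 : ((F ⊓ M).edgeSet.ncard : ℝ) + (F \ M).edgeSet.ncard = F.edgeSet.ncard := by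
    exact_mod_cast ncard_edgeSet_inf_add_sdiff F M
  have : (0 : ℝ) ≤ (F ⊓ M).edgeSet.ncard := by positivity
  linarith

end Combinatorics

/-! ### Runs with small noise -/

section Deterministic

variable {p : Params} {V : Type*} [Fintype V] {n : ℕ}

/-- The unit `c ln(n) / ε'` in which deviations of the noises are measured. -/
def noiseUnit (p : Params) (n : ℕ) : ℝ := p.c * Real.log n / p.eps'

/-- The noises in the checks are small. -/
def SmallCheckNoise (ω : Randomness p V n) : Prop :=
  (∀ u, |ω.thresholdNoise u| ≤ 12 * noiseUnit p n) ∧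
    ∀ i u, |ω.checkNoise i u| ≤ 24 * noiseUnit p n

/-- The proposal of `v_i` is good if it does not exceed the capacity of `v_i` and if, unless it
comprises all active later neighbors, it brings the degree of `v_i` up to `θ`. -/
def GoodProposal (ord : Fin n ≃ V) (G : SimpleGraph V) (ω : Randomness p V n) (θ : ℝ)
    (i : Fin n) : Prop :=
  ((chosenSet ord G ω i (midState ord G ω i)).Nonempty →
    ((midState ord G ω i).M (ord i)).card + (chosenSet ord G ω i (midState ord G ω i)).card ≤
      p.b) ∧
  ((∃ u, G.Adj u (ord i) ∧ i < ord.symm u ∧ (i : WithTop (Fin n)) < (midState ord G ω i).A u ∧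
      u ∉ chosenSet ord G ω i (midState ord G ω i)) →
    θ ≤ (((midState ord G ω i).M (ord i)).card : ℝ) +
      (chosenSet ord G ω i (midState ord G ω i)).card)

/-- A node which is still active after the check of iteration `i` has spare capacity. -/
lemma card_lt_of_active {ord : Fin n ≃ V} {G : SimpleGraph V} {ω : Randomness p V n}
    (hω : SmallCheckNoise ω) {i : Fin n} {u : V}
    (h : (i : WithTop (Fin n)) < (midState ord G ω i).A u) :
    ((midState ord G ω i).M u).card < p.b := by
  classical
  rw [midState, checkConditions_A] at h
  split_ifs at h with hc
  · exact absurd h (lt_irrefl _)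
  · have h1 : ¬ noisyThreshold ω u ≤ (((midState ord G ω i).M u).card : ℝ) + ω.checkNoise i u :=
      fun h' => hc ⟨h, h'⟩
    have h2 := abs_le.1 (hω.1 u)
    have h3 := abs_le.1 (hω.2 i u)
    have h4 : noisyThreshold ω u = p.b - 36 * noiseUnit p n + ω.thresholdNoise u := by
      simp only [noisyThreshold, noiseUnit]
      ring
    rw [h4] at h1
    have : (((midState ord G ω i).M u).card : ℝ) < p.b := by linarith
    exact_mod_cast this

lemma le_card_of_check {ω : Randomness p V n} (hω : SmallCheckNoise ω) {θ : ℝ}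
    (hθ : θ + 72 * noiseUnit p n ≤ p.b) {i : Fin n} {u : V} {M : ℕ}
    (h : noisyThreshold ω u ≤ (M : ℝ) + ω.checkNoise i u) : θ ≤ M := by
  have h2 := abs_le.1 (hω.1 u)
  have h3 := abs_le.1 (hω.2 i u)
  have h4 : noisyThreshold ω u = p.b - 36 * noiseUnit p n + ω.thresholdNoise u := by
    simp only [noisyThreshold, noiseUnit]
    ring
  linarith

/-- A node which became inactive has degree at least `θ`. -/
lemma le_card_of_inactive {ord : Fin n ≃ V} {G : SimpleGraph V} {ω : Randomness p V n}
    (hω : SmallCheckNoise ω) {θ : ℝ} (hθ : θ + 72 * noiseUnit p n ≤ p.b) (k : ℕ) (hk : k ≤ n)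
    (u : V) (h : (runUpTo ord G ω k).A u ≠ ⊤) : θ ≤ ((runUpTo ord G ω k).M u).card := by
  classical
  refine runUpTo_induction (ord := ord) (G := G) (ω := ω)
    (Q := fun _ s => s.A u ≠ ⊤ → θ ≤ (s.M u).card) ?_ ?_ k hk h
  · intro h
    simp [runUpTo] at h
  · intro i ih h
    have hmono : (((midState ord G ω i).M u).card : ℝ) ≤
        ((propose ord G ω i (midState ord G ω i)).M u).card :=
      Nat.cast_le.2 (Finset.card_le_card (M_subset_propose_M ord G ω i _ u))
    refine le_trans ?_ hmono
    rw [propose_A, midState, checkConditions_A] at h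
    split_ifs at h with hc
    · exact le_card_of_check hω hθ hc.2
    · exact ih h

lemma card_le_of_good {ord : Fin n ≃ V} {G : SimpleGraph V} {ω : Randomness p V n}
    (hω : SmallCheckNoise ω) {θ : ℝ} (hgood : ∀ i : Fin n,
      (i : WithTop (Fin n)) < (midState ord G ω i).A (ord i) → GoodProposal ord G ω θ i)
    (k : ℕ) (hk : k ≤ n) (u : V) : ((runUpTo ord G ω k).M u).card ≤ p.b := by
  classical
  refine runUpTo_induction (ord := ord) (G := G) (ω := ω)
    (Q := fun _ s => ∀ u, (s.M u).card ≤ p.b) ?_ ?_ k hk u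
  · intro u
    simp [runUpTo]
  · intro i ih u
    have ih' : ((midState ord G ω i).M u).card ≤ p.b := ih u
    by_cases hact : (i : WithTop (Fin n)) < (midState ord G ω i).A (ord i)
    · rw [propose_M_of_active hact]
      split_ifs with h1 h2
      · subst h1
        rcases Finset.eq_empty_or_nonempty (chosenSet ord G ω i (midState ord G ω i)) with h | h
        · rw [h, Finset.union_empty]
          exact ih'
        · exact (Finset.card_union_le _ _).trans ((hgood i hact).1 h)
      · obtain ⟨r, -, hr⟩ := mem_chosenSet.1 h2
        exact (Finset.card_insert_le _ _).trans (card_lt_of_active hω (mem_proposalSet.1 hr).1)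
      · exact ih'
    · rw [propose_of_inactive hact]
      exact ih'

/-- The partners gained in a proposal come later in the ordering than all earlier partners. -/
lemma card_add_chosenSet_le (ord : Fin n ≃ V) (G : SimpleGraph V) (ω : Randomness p V n)
    (i : Fin n) (hact : (i : WithTop (Fin n)) < (midState ord G ω i).A (ord i)) :
    ((midState ord G ω i).M (ord i)).card + (chosenSet ord G ω i (midState ord G ω i)).card ≤
      ((runUpTo ord G ω n).M (ord i)).card := by
  classical
  rw [← Finset.card_union_of_disjoint]
  · refine Finset.card_le_card (Finset.Subset.trans ?_
      (runUpTo_M_mono ord G ω (ord i) (show (i : ℕ) + 1 ≤ n from i.2)))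
    simp only [runUpTo_succ]
    rw [propose_M_of_active hact, if_pos rfl]
  · rw [Finset.disjoint_left]
    intro w hw hw'
    rw [← earlierMatches_midState, earlierMatches, Finset.mem_filter,
      Equiv.symm_apply_apply] at hw
    obtain ⟨r, -, hr⟩ := mem_chosenSet.1 hw'
    exact lt_asymm hw.2 (mem_proposalSet.1 hr).2.1

/-- In a run with small noise and good proposals, the decoded graph is a `b`-matching, and every
edge outside of it has an endpoint of degree at least `θ`. -/
theorem isBMatching_and_cover {ord : Fin n ≃ V} {G : SimpleGraph V} {ω : Randomness p V n}
    (hω : SmallCheckNoise ω) {θ : ℝ} (hθ : θ + 72 * noiseUnit p n ≤ p.b) (hgood : ∀ i : Fin n,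
      (i : WithTop (Fin n)) < (midState ord G ω i).A (ord i) → GoodProposal ord G ω θ i) :
    IsBMatching G p.b ((billboard ord G ω).decode ord G) ∧
      ∀ u w, G.Adj u w → ¬ ((billboard ord G ω).decode ord G).Adj u w →
        θ ≤ (((billboard ord G ω).decode ord G).neighborSet u).ncard ∨
          θ ≤ (((billboard ord G ω).decode ord G).neighborSet w).ncard := by
  have hdeg : ∀ v, (((billboard ord G ω).decode ord G).neighborSet v).ncard =
      ((runUpTo ord G ω n).M v).card := by
    intro v
    rw [← run_M_eq_decode, Set.ncard_coe_finset, run_eq_runUpTo]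
  have hadj : ∀ u w, ((billboard ord G ω).decode ord G).Adj u w ↔
      w ∈ (runUpTo ord G ω n).M u := by
    intro u w
    rw [← SimpleGraph.mem_neighborSet, ← run_M_eq_decode, run_eq_runUpTo, Finset.mem_coe]
  refine ⟨⟨inf_le_left, fun v => ?_⟩, ?_⟩
  · rw [hdeg]
    exact card_le_of_good hω hgood n le_rfl v
  · -- by symmetry, `u` may be assumed to come before `w`
    have key : ∀ u w, ord.symm u < ord.symm w → G.Adj u w →
        ¬ ((billboard ord G ω).decode ord G).Adj u w →
        θ ≤ ((runUpTo ord G ω n).M u).card ∨ θ ≤ ((runUpTo ord G ω n).M w).card := by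
      intro u w hlt hG hM
      obtain ⟨i, rfl⟩ := ord.surjective u
      rw [Equiv.symm_apply_apply] at hlt
      have hinact : ∀ v, ¬ (i : WithTop (Fin n)) < (midState ord G ω i).A v →
          θ ≤ ((runUpTo ord G ω n).M v).card := by
        intro v hv
        refine le_card_of_inactive hω hθ n le_rfl v fun htop => hv ?_
        rw [← lt_runUpTo_A_iff ord G ω n le_rfl i i.2, htop]
        exact WithTop.coe_lt_top i
      by_cases hu : (i : WithTop (Fin n)) < (midState ord G ω i).A (ord i)
      swap
      · exact Or.inl (hinact _ hu)
      by_cases hw : (i : WithTop (Fin n)) < (midState ord G ω i).A w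
      swap
      · exact Or.inr (hinact _ hw)
      left
      have hwM : w ∉ chosenSet ord G ω i (midState ord G ω i) := by
        classical
        intro h
        apply hM
        rw [hadj]
        refine runUpTo_M_mono ord G ω (ord i) (show (i : ℕ) + 1 ≤ n from i.2) ?_
        simp only [runUpTo_succ]
        rw [propose_M_of_active hu, if_pos rfl]
        exact Finset.mem_union_right _ h
      refine ((hgood i hu).2 ⟨w, hG.symm, hlt, hw, hwM⟩).trans ?_
      exact_mod_cast card_add_chosenSet_le ord G ω i hu
    intro u w hG hM
    rw [hdeg, hdeg]
    rcases lt_trichotomy (ord.symm u) (ord.symm w) with h | h | h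
    · exact key u w h hG hM
    · exact absurd (ord.symm.injective h) hG.ne
    · exact (key w u h hG.symm fun h' => hM h'.symm).symm

end Deterministic

/-! ### Concentration of sums of coins -/

section Chernoff

variable {ι β : Type*} [Fintype ι] [Finite β] [MeasurableSpace β] [MeasurableSingletonClass β]
  (μ : Measure β) [IsProbabilityMeasure μ] (A : Set β)

open Classical in
/-- The number of indices `e ∈ E` for which the `e`-th coordinate lies in `A`. -/
def hits (E : Finset ι) (x : ι → β) : ℝ := ((E.filter fun e => x e ∈ A).card : ℝ)

lemma hits_nonneg (E : Finset ι) (x : ι → β) : 0 ≤ hits A E x := by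
  unfold hits; positivity

/-- The moment generating function of a binomial variable is at most that of a Poisson variable with
the same mean. -/
lemma mgf_hits_le (E : Finset ι) (t : ℝ) :
    ProbabilityTheory.mgf (hits A E) (Measure.pi fun _ : ι => μ) t ≤
      Real.exp (μ.real A * (Real.exp t - 1) * E.card) := by
  classical
  let f : ι → β → ℝ := fun e y => if e ∈ E ∧ y ∈ A then Real.exp t else 1
  have hprod : ∀ x : ι → β, Real.exp (t * hits A E x) = ∏ e, f e (x e) := by
    intro x
    simp only [f]
    rw [Finset.prod_ite, Finset.prod_const_one, mul_one, Finset.prod_const, ← Real.exp_nat_mul,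
      mul_comm t, hits]
    congr 4
    ext e
    simp
  have hint : ∀ e, ∫ y, f e y ∂μ =
      if e ∈ E then 1 + μ.real A * (Real.exp t - 1) else 1 := by
    intro e
    split_ifs with he
    · have : ∀ y, f e y = 1 + A.indicator (fun _ => Real.exp t - 1) y := by
        intro y
        by_cases hy : y ∈ A <;> simp [f, he, hy]
      simp only [this]
      rw [integral_add (integrable_const _) (Integrable.of_finite), integral_indicator_const _
        (Set.toFinite A).measurableSet]
      simp
    · simp [f, he]
  simp only [ProbabilityTheory.mgf, hprod]
  rw [integral_fintype_prod_eq_prod (𝕜 := ℝ) f]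
  simp only [hint]
  rw [Finset.prod_ite, Finset.prod_const_one, mul_one, Finset.prod_const,
    Finset.filter_mem_eq_inter, Finset.univ_inter, mul_comm _ (E.card : ℝ), Real.exp_nat_mul]
  have hA : μ.real A ≤ 1 := measureReal_le_one
  have hA0 : 0 ≤ μ.real A := measureReal_nonneg
  refine pow_le_pow_left₀ ?_ ?_ _
  · nlinarith [Real.exp_pos t]
  · linarith [Real.add_one_le_exp (μ.real A * (Real.exp t - 1))]

lemma measure_hits_ge_le (E : Finset ι) {η : ℝ} (h0 : 0 ≤ η) (h1 : η ≤ 1) (a : ℝ) :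
    Measure.pi (fun _ : ι => μ) {x | (1 + η) * (μ.real A * E.card) + a < hits A E x} ≤
      ENNReal.ofReal (Real.exp (-(η * a))) := by
  have h := ProbabilityTheory.measure_ge_le_exp_mul_mgf (μ := Measure.pi fun _ : ι => μ)
    (X := hits A E) ((1 + η) * (μ.real A * E.card) + a) h0 Integrable.of_finite
  have hm := mgf_hits_le μ A E η
  refine (measure_mono (t := {x | (1 + η) * (μ.real A * E.card) + a ≤ hits A E x})
    (by intro x hx; rw [Set.mem_ofPred_eq] at hx ⊢; exact hx.le)).trans ?_
  rw [← ofReal_measureReal]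
  refine ENNReal.ofReal_le_ofReal (h.trans ?_)
  refine (mul_le_mul_of_nonneg_left hm (Real.exp_pos _).le).trans ?_
  rw [← Real.exp_add]
  refine Real.exp_le_exp.2 ?_
  have hexp : Real.exp η - 1 ≤ η + η ^ 2 := by
    have := Real.abs_exp_sub_one_sub_id_le (x := η) (by rwa [abs_of_nonneg h0])
    linarith [(abs_le.1 this).2]
  have hA0 : 0 ≤ μ.real A * E.card := by positivity
  nlinarith [mul_le_mul_of_nonneg_left hexp hA0]

lemma measure_hits_le_le (E : Finset ι) {η : ℝ} (h0 : 0 ≤ η) (h1 : η ≤ 1) {a : ℝ} (ha : 0 ≤ a) :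
    Measure.pi (fun _ : ι => μ) {x | hits A E x < (1 - η) * (μ.real A * E.card - a)} ≤
      ENNReal.ofReal (Real.exp (-(η ^ 2 * a / 2))) := by
  rcases lt_or_ge (μ.real A * E.card) a with hlt | hge
  · have : {x | hits A E x < (1 - η) * (μ.real A * E.card - a)} = ∅ := by
      ext x
      simp only [Set.mem_ofPred_eq, Set.mem_empty_iff_false, iff_false, not_lt]
      refine le_trans ?_ (hits_nonneg A E x)
      exact mul_nonpos_of_nonneg_of_nonpos (by linarith) (by linarith)
    rw [this, measure_empty]
    exact zero_le
  · have h := ProbabilityTheory.measure_le_le_exp_mul_mgf (μ := Measure.pi fun _ : ι => μ)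
      (X := hits A E) (t := -η) ((1 - η) * (μ.real A * E.card - a)) (by linarith)
      Integrable.of_finite
    have hm := mgf_hits_le μ A E (-η)
    refine (measure_mono (t := {x | hits A E x ≤ (1 - η) * (μ.real A * E.card - a)})
      (by intro x hx; rw [Set.mem_ofPred_eq] at hx ⊢; exact hx.le)).trans ?_
    rw [← ofReal_measureReal]
    refine ENNReal.ofReal_le_ofReal (h.trans ?_)
    refine (mul_le_mul_of_nonneg_left hm (Real.exp_pos _).le).trans ?_
    rw [← Real.exp_add]
    refine Real.exp_le_exp.2 ?_
    have hexp : Real.exp (-η) ≤ 1 - η + η ^ 2 / 2 := by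
      have h2 := Real.quadratic_le_exp_of_nonneg h0
      have h3 : Real.exp (-η) * Real.exp η = 1 := by rw [← Real.exp_add]; simp
      have h4 : Real.exp (-η) * (1 + η + η ^ 2 / 2) ≤ 1 :=
        (mul_le_mul_of_nonneg_left h2 (Real.exp_pos _).le).trans h3.le
      -- `(1 - η + η²/2) (1 + η + η²/2) = 1 + η⁴/4`
      by_contra hcon
      push Not at hcon
      have h5 : (1 - η + η ^ 2 / 2) * (1 + η + η ^ 2 / 2) <
          Real.exp (-η) * (1 + η + η ^ 2 / 2) := by
        exact mul_lt_mul_of_pos_right hcon (by positivity)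
      nlinarith [sq_nonneg (η ^ 2)]
    set m := μ.real A * E.card with hm'
    have hm0 : 0 ≤ m := by positivity
    have h6 : m * (Real.exp (-η) - 1) ≤ m * (-η + η ^ 2 / 2) :=
      mul_le_mul_of_nonneg_left (by linarith) hm0
    have h7 : μ.real A * (Real.exp (-η) - 1) * E.card = m * (Real.exp (-η) - 1) := by
      rw [hm']; ring
    rw [h7]
    have h8 : 0 ≤ η ^ 2 * (m - a) := by
      have : 0 ≤ m - a := by linarith
      positivity
    have h9 : 0 ≤ η * (1 - η) * a := by
      have : 0 ≤ 1 - η := by linarith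
      positivity
    nlinarith

/-- An event about the coordinates in `S`, chosen depending on the coordinates outside of `S`, is
as unlikely as the choices. -/
lemma measure_adaptive_le {γ : Type*} [Finite γ] (S : Finset ι) (U : (ι → β) → γ)
    (hU : ∀ x y, (∀ i, i ∉ S → x i = y i) → U x = U y) (D : γ → Set (ι → β))
    (hD : ∀ g x y, (∀ i ∈ S, x i = y i) → x ∈ D g → y ∈ D g) {δ : ℝ≥0∞}
    (hδ : ∀ g, Measure.pi (fun _ : ι => μ) (D g) ≤ δ) :
    Measure.pi (fun _ : ι => μ) {x | x ∈ D (U x)} ≤ δ := by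
  classical
  have := Fintype.ofFinite γ
  have hind := (ProbabilityTheory.iIndepFun_pi (μ := fun _ : ι => μ) (X := fun _ y => y)
    (fun i => aemeasurable_id')).indepFun_finset Sᶜ S disjoint_compl_left
    (fun i => measurable_pi_apply i)
  have hinter : ∀ g, Measure.pi (fun _ : ι => μ) (U ⁻¹' {g} ∩ D g) =
      Measure.pi (fun _ : ι => μ) (U ⁻¹' {g}) * Measure.pi (fun _ : ι => μ) (D g) := by
    intro g
    have e1 : U ⁻¹' {g} = (fun (x : ι → β) (i : (Sᶜ : Finset ι)) => x i) ⁻¹'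
        ((fun (x : ι → β) (i : (Sᶜ : Finset ι)) => x i) '' (U ⁻¹' {g})) := by
      refine Set.Subset.antisymm (Set.subset_preimage_image _ _) ?_
      rintro x ⟨y, hy, hxy⟩
      have : U x = U y := hU x y fun i hi =>
        (congrFun hxy ⟨i, Finset.mem_compl.2 hi⟩).symm
      rw [Set.mem_preimage, this]
      exact hy
    have e2 : D g = (fun (x : ι → β) (i : S) => x i) ⁻¹'
        ((fun (x : ι → β) (i : S) => x i) '' D g) := by
      refine Set.Subset.antisymm (Set.subset_preimage_image _ _) ?_
      rintro x ⟨y, hy, hxy⟩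
      exact hD g y x (fun i hi => congrFun hxy ⟨i, hi⟩) hy
    rw [e1, e2]
    exact hind.measure_inter_preimage_eq_mul _ _ (Set.toFinite _).measurableSet
      (Set.toFinite _).measurableSet
  have hcover : {x | x ∈ D (U x)} ⊆ ⋃ g, U ⁻¹' {g} ∩ D g := by
    intro x hx
    exact Set.mem_iUnion.2 ⟨U x, rfl, hx⟩
  calc Measure.pi (fun _ : ι => μ) {x | x ∈ D (U x)}
      ≤ ∑ g, Measure.pi (fun _ : ι => μ) (U ⁻¹' {g} ∩ D g) :=
        (measure_mono hcover).trans (measure_iUnion_fintype_le _ _)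
    _ ≤ ∑ g, Measure.pi (fun _ : ι => μ) (U ⁻¹' {g}) * δ := by
        refine Finset.sum_le_sum fun g _ => ?_
        rw [hinter]
        gcongr
        exact hδ g
    _ = δ := by
        rw [← Finset.sum_mul, ← measure_biUnion_finset]
        · have : (⋃ g ∈ Finset.univ, U ⁻¹' {g}) = Set.univ := by
            ext x
            simp
          rw [this, measure_univ, one_mul]
        · intro g _ g' _ hgg'
          exact Set.disjoint_left.2 fun x h1 h2 => hgg' (h1.symm.trans h2)
        · exact fun g _ => (Set.toFinite _).measurableSet

end Chernoff

/-! ### Coins of a proposal -/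

section Proposal

variable {p : Params} {V : Type*} [Fintype V] {n : ℕ}

open Classical in
/-- The active neighbors of `v_i` which come later in the ordering, at the time when `v_i`
proposes. -/
def activeLater (ord : Fin n ≃ V) (G : SimpleGraph V) (i : Fin n) (s : State p V n) : Finset V :=
  Finset.univ.filter fun u => (i : WithTop (Fin n)) < s.A u ∧ i < ord.symm u ∧ G.Adj u (ord i)

open Classical in
/-- The pairs of `v_i` and a later node: only the coins of these pairs are used in iteration
`i`. -/
def laterPairs (ord : Fin n ≃ V) (i : Fin n) : Finset (Sym2 V) :=
  (Finset.univ.filter fun u => i < ord.symm u).image fun u => s(u, ord i)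

lemma mem_laterPairs {ord : Fin n ≃ V} {i : Fin n} {u : V} (hu : i < ord.symm u) :
    s(u, ord i) ∈ laterPairs ord i := by
  classical
  exact Finset.mem_image.2 ⟨u, by simp [hu], rfl⟩

lemma notMem_laterPairs {ord : Fin n ≃ V} {i j : Fin n} (hj : j < i) (u : V) :
    s(u, ord j) ∉ laterPairs ord i := by
  classical
  intro h
  obtain ⟨w, hw, he⟩ := Finset.mem_image.1 h
  have hw : i < ord.symm w := by simpa using hw
  rcases Sym2.eq_iff.1 he with ⟨-, h2⟩ | ⟨h1, -⟩
  · exact hj.ne' (ord.injective h2)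
  · rw [h1, Equiv.symm_apply_apply] at hw
    exact lt_asymm hw hj

/-- The state in which `v_i` proposes does not depend on the coins which `v_i` uses. -/
lemma midState_congr (ord : Fin n ≃ V) (G : SimpleGraph V) (i : Fin n)
    {ω ω' : Randomness p V n} (hnoise : ω.2 = ω'.2)
    (hcoin : ∀ e, e ∉ laterPairs ord i → ω.coin e = ω'.coin e) :
    midState ord G ω i = midState ord G ω' i := by
  classical
  have hcheck : ∀ (j : Fin n) (s : State p V n),
      checkConditions ω j s = checkConditions ω' j s := by
    intro j s
    simp only [checkConditions, noisyThreshold, Randomness.thresholdNoise,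
      Randomness.checkNoise, hnoise]
    congr!
  have hprop : ∀ (j : Fin n) (s : State p V n), j < i →
      propose ord G ω j s = propose ord G ω' j s := by
    intro j s hj
    have hset : proposalSet ord G ω j s.A = proposalSet ord G ω' j s.A := by
      funext r
      ext u
      rw [mem_proposalSet, mem_proposalSet]
      refine and_congr_right fun _ => and_congr_right fun _ => and_congr_right fun _ => ?_
      rw [hcoin _ (notMem_laterPairs hj u)]
    simp only [propose, chooseIdx, hset, Randomness.degreeNoise, Randomness.sizeNoise, hnoise]
    congr!
  have hrun : ∀ k, k ≤ (i : ℕ) → runUpTo ord G ω k = runUpTo ord G ω' k := by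
    intro k
    induction k with
    | zero => intro _; rfl
    | succ k ih =>
      intro hk
      have hkn : k < n := by omega
      simp only [runUpTo, hkn, dif_pos]
      rw [ih (by omega), hcheck, hprop _ _ (show (⟨k, hkn⟩ : Fin n) < i from hk)]
  rw [midState, midState, hrun i le_rfl, hcheck]

open Classical in
lemma card_proposalSet_eq_hits (ord : Fin n ≃ V) (G : SimpleGraph V) (ω : Randomness p V n)
    (i : Fin n) (s : State p V n) (r : Fin (p.numIdx n)) :
    ((proposalSet ord G ω i s.A r).card : ℝ) =
      hits {y : Fin (p.numIdx n) → Bool | y r = true}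
        ((activeLater ord G i s).image fun u => s(u, ord i)) ω.coin := by
  have hinj : Set.InjOn (fun u => s(u, ord i)) (proposalSet ord G ω i s.A r : Set V) :=
    fun u _ w _ h => Sym2.congr_left.1 h
  rw [hits, ← Finset.card_image_of_injOn hinj]
  congr 2
  ext e
  simp only [Finset.mem_filter, Finset.mem_image, activeLater, mem_proposalSet, Finset.mem_univ,
    true_and, Set.mem_ofPred_eq]
  constructor
  · rintro ⟨u, ⟨h1, h2, h3, h4⟩, rfl⟩
    exact ⟨⟨u, ⟨h1, h2, h3⟩, rfl⟩, h4⟩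
  · rintro ⟨⟨u, ⟨h1, h2, h3⟩, rfl⟩, h4⟩
    exact ⟨u, ⟨h1, h2, h3, h4⟩, rfl⟩

open Classical in
lemma card_image_activeLater (ord : Fin n ≃ V) (G : SimpleGraph V) (i : Fin n)
    (s : State p V n) : ((activeLater ord G i s).image fun u => s(u, ord i)).card =
      (activeLater ord G i s).card :=
  Finset.card_image_of_injOn fun _ _ _ _ h => Sym2.congr_left.1 h

lemma measureReal_coin (hη : 0 ≤ p.eta) (r : Fin (p.numIdx n)) :
    (Measure.pi fun r : Fin (p.numIdx n) => coinLaw (((1 + p.eta) ^ (r : ℕ))⁻¹)).real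
      {y | y r = true} = ((1 + p.eta) ^ (r : ℕ))⁻¹ := by
  have := isProbabilityMeasure_coinLaw_pow hη
  have h := (measurePreserving_eval (fun r : Fin (p.numIdx n) =>
    coinLaw (((1 + p.eta) ^ (r : ℕ))⁻¹)) r).measure_preimage
    (s := {true}) (measurableSet_singleton _).nullMeasurableSet
  have h' : (Function.eval r ⁻¹' {true} : Set (Fin (p.numIdx n) → Bool)) = {y | y r = true} := by
    ext y; simp
  rw [h'] at h
  rw [Measure.real, h]
  simp only [coinLaw, Measure.coe_add, Measure.coe_smul, Pi.add_apply, Pi.smul_apply,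
    measurableSet_singleton, Measure.dirac_apply', smul_eq_mul]
  simp
  positivity

/-- An event about the coins of the later pairs of `v_i`, chosen depending on the state when `v_i`
proposes, is as unlikely as the choices: these coins have not been used before. -/
lemma randomnessLaw_adaptive_le (hη : 0 ≤ p.eta) (hε : 0 < p.eps') (ord : Fin n ≃ V)
    (G : SimpleGraph V) (i : Fin n)
    (D : State p V n → Set (Sym2 V → Fin (p.numIdx n) → Bool))
    (hD : ∀ s x y, (∀ e ∈ laterPairs ord i, x e = y e) → x ∈ D s → y ∈ D s)
    {δ : ℝ≥0∞} (hδ : ∀ s, coinsLaw p V n (D s) ≤ δ) :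
    randomnessLaw p V n {ω | ω.coin ∈ D (midState ord G ω i)} ≤ δ := by
  have := isProbabilityMeasure_coinLaw_pow hη
  have := isProbabilityMeasure_laplace (s := 4 / p.eps') (by positivity)
  have := isProbabilityMeasure_laplace (s := 8 / p.eps') (by positivity)
  have := isProbabilityMeasure_laplace (s := 2 / p.eps') (by positivity)
  have hmeas : MeasurableSet {ω : Randomness p V n | ω.coin ∈ D (midState ord G ω i)} :=
    measurableSet_of_discrete_factor
      (Randomness.measurable_coin.prodMk (measurable_midState ord G i))
      (fun c => c.1 ∈ D c.2) (fun ω => ω.coin ∈ D (midState ord G ω i)) (fun _ => rfl) {P | P}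
  rw [randomnessLaw, Measure.prod_apply_symm hmeas]
  refine (lintegral_mono (g := fun _ => δ) fun z => ?_).trans (by simp)
  exact measure_adaptive_le _ (laterPairs ord i) (fun x => midState ord G (x, z) i)
    (fun x y hxy => midState_congr ord G i rfl hxy) D hD hδ

end Proposal

/-! ### The good event -/

section GoodEvent

variable {p : Params} {V : Type*} [Fintype V] {n : ℕ}

lemma hits_congr {ι β : Type*} {A : Set β} {E : Finset ι} {x y : ι → β}
    (h : ∀ e ∈ E, x e = y e) : hits A E x = hits A E y := by
  classical
  unfold hits
  congr 2
  exact Finset.filter_congr fun e he => by rw [h e he]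

open Classical in
lemma image_activeLater_subset (ord : Fin n ≃ V) (G : SimpleGraph V) (i : Fin n)
    (s : State p V n) :
    (activeLater ord G i s).image (fun u => s(u, ord i)) ⊆ laterPairs ord i := by
  intro e he
  obtain ⟨u, hu, rfl⟩ := Finset.mem_image.1 he
  simp only [activeLater, Finset.mem_filter] at hu
  exact mem_laterPairs hu.2.2.1

/-- The size of `W_r(v_i)` does not exceed `1 + η` times its mean by much. -/
def UpperTail (ord : Fin n ≃ V) (G : SimpleGraph V) (ω : Randomness p V n) (i : Fin n)
    (r : Fin (p.numIdx n)) : Prop :=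
  ((proposalSet ord G ω i (midState ord G ω i).A r).card : ℝ) ≤
    (1 + p.eta) * (((1 + p.eta) ^ (r : ℕ))⁻¹ * (activeLater ord G i (midState ord G ω i)).card) +
      3 * (p.c * Real.log n) / p.eta

/-- The size of `W_r(v_i)` does not fall below `1 - η` times its mean by much. -/
def LowerTail (ord : Fin n ≃ V) (G : SimpleGraph V) (ω : Randomness p V n) (i : Fin n)
    (r : Fin (p.numIdx n)) : Prop :=
  (1 - p.eta) * (((1 + p.eta) ^ (r : ℕ))⁻¹ * (activeLater ord G i (midState ord G ω i)).card -
      6 * (p.c * Real.log n) / p.eta ^ 2) ≤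
    ((proposalSet ord G ω i (midState ord G ω i).A r).card : ℝ)

/-- The probability with which a single one of the random quantities is allowed to deviate. -/
def tailBound (p : Params) (n : ℕ) : ℝ≥0∞ := ENNReal.ofReal (Real.exp (-(3 * (p.c * Real.log n))))

lemma randomnessLaw_upperTail_le (hη : p.eta ∈ Set.Ioo (0 : ℝ) 1) (hε : 0 < p.eps')
    (ord : Fin n ≃ V) (G : SimpleGraph V) (i : Fin n) (r : Fin (p.numIdx n)) :
    randomnessLaw p V n {ω | ¬ UpperTail ord G ω i r} ≤ tailBound p n := by
  classical
  have := isProbabilityMeasure_coinLaw_pow hη.1.le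
  have h := randomnessLaw_adaptive_le hη.1.le hε ord G i (fun s =>
    {x | (1 + p.eta) * ((Measure.pi fun r : Fin (p.numIdx n) =>
        coinLaw (((1 + p.eta) ^ (r : ℕ))⁻¹)).real {y | y r = true} *
          ((activeLater ord G i s).image fun u => s(u, ord i)).card) +
        3 * (p.c * Real.log n) / p.eta <
      hits {y : Fin (p.numIdx n) → Bool | y r = true}
        ((activeLater ord G i s).image fun u => s(u, ord i)) x})
    (fun s x y hxy hx => by
      rw [Set.mem_ofPred_eq] at hx ⊢
      rwa [← hits_congr fun e he => hxy e (image_activeLater_subset ord G i s he)])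
    (δ := tailBound p n) (fun s => by
      refine (measure_hits_ge_le _ _ _ hη.1.le hη.2.le _).trans (le_of_eq ?_)
      rw [tailBound, mul_div_cancel₀ _ hη.1.ne'])
  refine (measure_mono fun ω hω => ?_).trans h
  rw [Set.mem_ofPred_eq] at hω ⊢
  rw [Set.mem_ofPred_eq, ← card_proposalSet_eq_hits, card_image_activeLater,
    measureReal_coin hη.1.le]
  exact not_le.1 hω

lemma randomnessLaw_lowerTail_le (hη : p.eta ∈ Set.Ioo (0 : ℝ) 1) (hε : 0 < p.eps')
    (hc : 0 ≤ p.c) (ord : Fin n ≃ V) (G : SimpleGraph V) (i : Fin n) (r : Fin (p.numIdx n)) :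
    randomnessLaw p V n {ω | ¬ LowerTail ord G ω i r} ≤ tailBound p n := by
  classical
  have := isProbabilityMeasure_coinLaw_pow hη.1.le
  have hη0 := hη.1
  have hL : 0 ≤ Real.log n := Real.log_natCast_nonneg n
  have h := randomnessLaw_adaptive_le hη.1.le hε ord G i (fun s =>
    {x | hits {y : Fin (p.numIdx n) → Bool | y r = true}
        ((activeLater ord G i s).image fun u => s(u, ord i)) x <
      (1 - p.eta) * ((Measure.pi fun r : Fin (p.numIdx n) =>
        coinLaw (((1 + p.eta) ^ (r : ℕ))⁻¹)).real {y | y r = true} *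
          ((activeLater ord G i s).image fun u => s(u, ord i)).card -
        6 * (p.c * Real.log n) / p.eta ^ 2)})
    (fun s x y hxy hx => by
      rw [Set.mem_ofPred_eq] at hx ⊢
      rwa [← hits_congr fun e he => hxy e (image_activeLater_subset ord G i s he)])
    (δ := tailBound p n) (fun s => by
      refine (measure_hits_le_le _ _ _ hη.1.le hη.2.le (by positivity)).trans (le_of_eq ?_)
      rw [tailBound]
      congr 3
      field_simp
      ring)
  refine (measure_mono fun ω hω => ?_).trans h
  rw [Set.mem_ofPred_eq] at hω ⊢
  rw [Set.mem_ofPred_eq, ← card_proposalSet_eq_hits, card_image_activeLater,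
    measureReal_coin hη.1.le]
  exact not_le.1 hω

/-- The scales of the noises are such that a deviation by `t` is as unlikely as `tailBound`. -/
lemma measure_abs_gt_le_tailBound {μ : Measure (Randomness p V n)} {X : Randomness p V n → ℝ}
    {s t : ℝ} (hs : 0 < s) (ht : 0 ≤ t) (hst : t / s = 3 * (p.c * Real.log n))
    (hX : MeasurePreserving X μ (laplace s)) : μ {ω | ¬ |X ω| ≤ t} ≤ tailBound p n := by
  have hmeas : MeasurableSet {x : ℝ | t < |x|} := measurableSet_lt measurable_const (by fun_prop)
  have h := hX.measure_preimage hmeas.nullMeasurableSet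
  have h' : {ω | ¬ |X ω| ≤ t} = X ⁻¹' {x | t < |x|} := by ext; simp
  rw [h', h]
  refine (laplace_abs_gt hs ht).trans (le_of_eq ?_)
  rw [tailBound, neg_div, hst]

lemma noiseUnit_nonneg (hε : 0 < p.eps') (hc : 0 ≤ p.c) : 0 ≤ noiseUnit p n := by
  have : 0 ≤ Real.log n := Real.log_natCast_nonneg n
  unfold noiseUnit
  positivity

lemma randomnessLaw_thresholdNoise_le (hη : 0 ≤ p.eta) (hε : 0 < p.eps') (hc : 0 ≤ p.c)
    (u : V) :
    randomnessLaw p V n {ω | ¬ |ω.thresholdNoise u| ≤ 12 * noiseUnit p n} ≤ tailBound p n := by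
  have := isProbabilityMeasure_coinLaw_pow hη
  have := isProbabilityMeasure_laplace (s := 4 / p.eps') (by positivity)
  have := isProbabilityMeasure_laplace (s := 8 / p.eps') (by positivity)
  have := isProbabilityMeasure_laplace (s := 2 / p.eps') (by positivity)
  have hK := noiseUnit_nonneg (n := n) hε hc
  refine measure_abs_gt_le_tailBound (s := 4 / p.eps') (by positivity) (by positivity)
    (by unfold noiseUnit; field_simp; ring) ?_
  exact (measurePreserving_eval _ u).comp (measurePreserving_fst.comp measurePreserving_snd)

lemma randomnessLaw_checkNoise_le (hη : 0 ≤ p.eta) (hε : 0 < p.eps') (hc : 0 ≤ p.c)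
    (i : Fin n) (u : V) :
    randomnessLaw p V n {ω | ¬ |ω.checkNoise i u| ≤ 24 * noiseUnit p n} ≤ tailBound p n := by
  have := isProbabilityMeasure_coinLaw_pow hη
  have := isProbabilityMeasure_laplace (s := 4 / p.eps') (by positivity)
  have := isProbabilityMeasure_laplace (s := 8 / p.eps') (by positivity)
  have := isProbabilityMeasure_laplace (s := 2 / p.eps') (by positivity)
  have hK := noiseUnit_nonneg (n := n) hε hc
  refine measure_abs_gt_le_tailBound (s := 8 / p.eps') (by positivity) (by positivity)
    (by unfold noiseUnit; field_simp; ring) ?_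
  exact (measurePreserving_eval (fun _ : V => laplace (8 / p.eps')) u).comp
    ((measurePreserving_eval _ i).comp (measurePreserving_fst.comp
    (measurePreserving_snd.comp measurePreserving_snd)))

lemma randomnessLaw_sizeNoise_le (hη : 0 ≤ p.eta) (hε : 0 < p.eps') (hc : 0 ≤ p.c)
    (v : V) (r : Fin (p.numIdx n)) :
    randomnessLaw p V n {ω | ¬ |ω.sizeNoise v r| ≤ 6 * noiseUnit p n} ≤ tailBound p n := by
  have := isProbabilityMeasure_coinLaw_pow hη
  have := isProbabilityMeasure_laplace (s := 4 / p.eps') (by positivity)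
  have := isProbabilityMeasure_laplace (s := 8 / p.eps') (by positivity)
  have := isProbabilityMeasure_laplace (s := 2 / p.eps') (by positivity)
  have hK := noiseUnit_nonneg (n := n) hε hc
  refine measure_abs_gt_le_tailBound (s := 2 / p.eps') (by positivity) (by positivity)
    (by unfold noiseUnit; field_simp; ring) ?_
  exact (measurePreserving_eval (fun _ : Fin (p.numIdx n) => laplace (2 / p.eps')) r).comp
    ((measurePreserving_eval _ v).comp (measurePreserving_fst.comp
    (measurePreserving_snd.comp (measurePreserving_snd.comp measurePreserving_snd))))

lemma randomnessLaw_degreeNoise_le (hη : 0 ≤ p.eta) (hε : 0 < p.eps') (hc : 0 ≤ p.c)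
    (v : V) :
    randomnessLaw p V n {ω | ¬ |ω.degreeNoise v| ≤ 6 * noiseUnit p n} ≤ tailBound p n := by
  have := isProbabilityMeasure_coinLaw_pow hη
  have := isProbabilityMeasure_laplace (s := 4 / p.eps') (by positivity)
  have := isProbabilityMeasure_laplace (s := 8 / p.eps') (by positivity)
  have := isProbabilityMeasure_laplace (s := 2 / p.eps') (by positivity)
  have hK := noiseUnit_nonneg (n := n) hε hc
  refine measure_abs_gt_le_tailBound (s := 2 / p.eps') (by positivity) (by positivity)
    (by unfold noiseUnit; field_simp; ring) ?_
  exact (measurePreserving_eval _ v).comp (measurePreserving_snd.comp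
    (measurePreserving_snd.comp (measurePreserving_snd.comp measurePreserving_snd)))

/-- The coins with index `0` are heads. -/
lemma randomnessLaw_coin_zero (hη : 0 ≤ p.eta) (hε : 0 < p.eps') (e : Sym2 V)
    (r : Fin (p.numIdx n)) (hr : (r : ℕ) = 0) :
    randomnessLaw p V n {ω | ¬ ω.coin e r = true} = 0 := by
  have := isProbabilityMeasure_coinLaw_pow hη
  have := isProbabilityMeasure_laplace (s := 4 / p.eps') (by positivity)
  have := isProbabilityMeasure_laplace (s := 8 / p.eps') (by positivity)
  have := isProbabilityMeasure_laplace (s := 2 / p.eps') (by positivity)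
  have hX : MeasurePreserving (fun ω : Randomness p V n => ω.coin e r) (randomnessLaw p V n)
      (coinLaw (((1 + p.eta) ^ (r : ℕ))⁻¹)) :=
    (measurePreserving_eval (fun r : Fin (p.numIdx n) =>
      coinLaw (((1 + p.eta) ^ (r : ℕ))⁻¹)) r).comp
      ((measurePreserving_eval _ e).comp measurePreserving_fst)
  have h := hX.measure_preimage (s := {false}) (measurableSet_singleton _).nullMeasurableSet
  have h' : {ω : Randomness p V n | ¬ ω.coin e r = true} =
      (fun ω : Randomness p V n => ω.coin e r) ⁻¹' {false} := by ext; simp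
  rw [h', h, hr]
  simp [coinLaw]

/-- All random quantities which matter are close to what is expected of them; among the indices,
only those in `I` matter. -/
structure GoodRun (ord : Fin n ≃ V) (G : SimpleGraph V) (I : Finset (Fin (p.numIdx n)))
    (ω : Randomness p V n) : Prop where
  threshold : ∀ u, |ω.thresholdNoise u| ≤ 12 * noiseUnit p n
  check : ∀ i u, |ω.checkNoise i u| ≤ 24 * noiseUnit p n
  degree : ∀ v, |ω.degreeNoise v| ≤ 6 * noiseUnit p n
  size : ∀ v, ∀ r ∈ I, |ω.sizeNoise v r| ≤ 6 * noiseUnit p n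
  upper : ∀ i, ∀ r ∈ I, UpperTail ord G ω i r
  lower : ∀ i, ∀ r ∈ I, LowerTail ord G ω i r
  coin : ∀ e, ∀ r : Fin (p.numIdx n), (r : ℕ) = 0 → ω.coin e r = true

lemma measure_exists_le {α ι : Type*} [MeasurableSpace α] {μ : Measure α} (S : Finset ι)
    (P : ι → α → Prop) {δ : ℝ≥0∞} (h : ∀ i ∈ S, μ {x | ¬ P i x} ≤ δ) :
    μ {x | ¬ ∀ i ∈ S, P i x} ≤ S.card * δ := by
  have : {x | ¬ ∀ i ∈ S, P i x} ⊆ ⋃ i ∈ S, {x | ¬ P i x} := by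
    intro x hx
    simpa using hx
  refine (measure_mono this).trans ((measure_biUnion_finset_le _ _).trans ?_)
  refine (Finset.sum_le_sum h).trans (le_of_eq ?_)
  simp

lemma randomnessLaw_not_goodRun_le (hη : p.eta ∈ Set.Ioo (0 : ℝ) 1) (hε : 0 < p.eps')
    (hc : 0 ≤ p.c) (ord : Fin n ≃ V) (G : SimpleGraph V) (I : Finset (Fin (p.numIdx n))) :
    randomnessLaw p V n {ω | ¬ GoodRun ord G I ω} ≤
      (n + n * n + n + n * I.card + n * I.card + n * I.card : ℕ) * tailBound p n := by
  classical
  have hcard : Fintype.card V = n := by simpa using (Fintype.card_congr ord).symm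
  have h1 := measure_exists_le (μ := randomnessLaw p V n) Finset.univ
    (fun (u : V) ω => |ω.thresholdNoise u| ≤ 12 * noiseUnit p n)
    fun u _ => randomnessLaw_thresholdNoise_le hη.1.le hε hc u
  have h2 := measure_exists_le (μ := randomnessLaw p V n) Finset.univ
    (fun (q : Fin n × V) ω => |ω.checkNoise q.1 q.2| ≤ 24 * noiseUnit p n)
    fun q _ => randomnessLaw_checkNoise_le hη.1.le hε hc q.1 q.2
  have h3 := measure_exists_le (μ := randomnessLaw p V n) Finset.univ
    (fun (u : V) ω => |ω.degreeNoise u| ≤ 6 * noiseUnit p n)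
    fun u _ => randomnessLaw_degreeNoise_le hη.1.le hε hc u
  have h4 := measure_exists_le (μ := randomnessLaw p V n) (Finset.univ ×ˢ I)
    (fun (q : V × Fin (p.numIdx n)) ω => |ω.sizeNoise q.1 q.2| ≤ 6 * noiseUnit p n)
    fun q _ => randomnessLaw_sizeNoise_le hη.1.le hε hc q.1 q.2
  have h5 := measure_exists_le (μ := randomnessLaw p V n) (Finset.univ ×ˢ I)
    (fun (q : Fin n × Fin (p.numIdx n)) ω => UpperTail ord G ω q.1 q.2)
    fun q _ => randomnessLaw_upperTail_le hη hε ord G q.1 q.2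
  have h6 := measure_exists_le (μ := randomnessLaw p V n) (Finset.univ ×ˢ I)
    (fun (q : Fin n × Fin (p.numIdx n)) ω => LowerTail ord G ω q.1 q.2)
    fun q _ => randomnessLaw_lowerTail_le hη hε hc ord G q.1 q.2
  have h7 := measure_exists_le (μ := randomnessLaw p V n) Finset.univ
    (fun (q : Sym2 V × Fin (p.numIdx n)) ω => (q.2 : ℕ) = 0 → ω.coin q.1 q.2 = true)
    (δ := 0) fun q _ => by
      by_cases hq : (q.2 : ℕ) = 0
      · simp only [hq, forall_true_left]
        exact (randomnessLaw_coin_zero hη.1.le hε q.1 q.2 hq).le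
      · simp [hq]
  refine (measure_mono ?_).trans (((measure_union_le _ _).trans (add_le_add h1
    ((measure_union_le _ _).trans (add_le_add h2 ((measure_union_le _ _).trans (add_le_add h3
    ((measure_union_le _ _).trans (add_le_add h4 ((measure_union_le _ _).trans (add_le_add h5
    ((measure_union_le _ _).trans (add_le_add h6 h7)))))))))))).trans (le_of_eq ?_))
  · intro ω hω
    by_contra hcon
    simp only [Set.mem_union, Set.mem_ofPred_eq, not_or, not_not] at hcon
    obtain ⟨c1, c2, c3, c4, c5, c6, c7⟩ := hcon
    exact hω ⟨fun u => c1 u (Finset.mem_univ _), fun i u => c2 (i, u) (Finset.mem_univ _),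
      fun u => c3 u (Finset.mem_univ _), fun v r hr => c4 (v, r) (by simp [hr]),
      fun i r hr => c5 (i, r) (by simp [hr]), fun i r hr => c6 (i, r) (by simp [hr]),
      fun e r hr => c7 (e, r) (Finset.mem_univ _) hr⟩
  · simp only [Finset.card_univ, Finset.card_product, hcard, Fintype.card_prod, Fintype.card_fin]
    push_cast
    ring

end GoodEvent

/-! ### Proposals in a good run -/

section GoodProposals

variable {p : Params} {V : Type*} [Fintype V] {n : ℕ} {ord : Fin n ≃ V} {G : SimpleGraph V}
  {I : Finset (Fin (p.numIdx n))} {ω : Randomness p V n}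

lemma card_finset_le (ord : Fin n ≃ V) (S : Finset V) : (S.card : ℝ) ≤ n := by
  have hcard : Fintype.card V = n := by simpa using (Fintype.card_congr ord).symm
  rw [← hcard]
  exact_mod_cast Finset.card_le_univ S

lemma GoodRun.smallCheckNoise (h : GoodRun ord G I ω) : SmallCheckNoise ω :=
  ⟨h.threshold, h.check⟩

/-- The test which `v_i` applies to the index `r`. -/
def PassesTest (ord : Fin n ≃ V) (G : SimpleGraph V) (ω : Randomness p V n) (i : Fin n)
    (s : State p V n) (r : Fin (p.numIdx n)) : Prop :=
  (((s.M (ord i)).card : ℝ) + ω.degreeNoise (ord i)) +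
    (((proposalSet ord G ω i s.A r).card : ℝ) + ω.sizeNoise (ord i) r) +
    12 * p.c * Real.log n / p.eps' ≤ p.b

lemma chooseIdx_eq_iff {i : Fin n} {s : State p V n} {q : WithTop (Fin (p.numIdx n))} :
    chooseIdx ord G ω i s = q ↔
      (∀ r : Fin (p.numIdx n), (r : WithTop (Fin (p.numIdx n))) < q →
        ¬ PassesTest ord G ω i s r) ∧
      ∀ r : Fin (p.numIdx n), q = r → PassesTest ord G ω i s r := by
  classical
  rw [← min_filter_eq_iff (PassesTest ord G ω i s) q, chooseIdx]
  congr!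

lemma chosenSet_of_eq {i : Fin n} {s : State p V n} {r : Fin (p.numIdx n)}
    (hr : chooseIdx ord G ω i s = r) :
    chosenSet ord G ω i s = proposalSet ord G ω i s.A r := by
  rw [chosenSet, hr]
  rfl

lemma GoodRun.le_of_passesTest (h : GoodRun ord G I ω) {i : Fin n} {s : State p V n}
    {r : Fin (p.numIdx n)} (hr : r ∈ I) (ht : PassesTest ord G ω i s r) :
    (s.M (ord i)).card + (proposalSet ord G ω i s.A r).card ≤ p.b := by
  have h1 := abs_le.1 (h.degree (ord i))
  have h2 := abs_le.1 (h.size (ord i) r hr)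
  have h3 : 12 * p.c * Real.log n / p.eps' = 12 * noiseUnit p n := by
    unfold noiseUnit; ring
  rw [PassesTest, h3] at ht
  have : ((s.M (ord i)).card : ℝ) + (proposalSet ord G ω i s.A r).card ≤ p.b := by linarith
  exact_mod_cast this

lemma GoodRun.lt_of_not_passesTest (h : GoodRun ord G I ω) {i : Fin n} {s : State p V n}
    {r : Fin (p.numIdx n)} (hr : r ∈ I) (ht : ¬ PassesTest ord G ω i s r) :
    (p.b : ℝ) - 24 * noiseUnit p n <
      ((s.M (ord i)).card : ℝ) + (proposalSet ord G ω i s.A r).card := by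
  have h1 := abs_le.1 (h.degree (ord i))
  have h2 := abs_le.1 (h.size (ord i) r hr)
  have h3 : 12 * p.c * Real.log n / p.eps' = 12 * noiseUnit p n := by
    unfold noiseUnit; ring
  rw [PassesTest, h3] at ht
  linarith

/-- The proposal with index `0` leaves out no active later neighbor. -/
lemma GoodRun.goodProposal_of_chooseIdx_eq_zero (h : GoodRun ord G I ω) {i : Fin n}
    {r : Fin (p.numIdx n)} (hrI : r ∈ I) (hr0 : (r : ℕ) = 0)
    (hr : chooseIdx ord G ω i (midState ord G ω i) = r) (θ : ℝ) :
    GoodProposal ord G ω θ i := by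
  rw [GoodProposal, chosenSet_of_eq hr]
  refine ⟨fun _ => h.le_of_passesTest hrI ((chooseIdx_eq_iff.1 hr).2 r rfl), ?_⟩
  rintro ⟨u, hu, hlt, hA, hmem⟩
  exact absurd (mem_proposalSet.2 ⟨hA, hlt, hu, h.coin _ r hr0⟩) hmem

/-- If the capacity is so large that a node can be matched to all others, then the index `0`
is always chosen. -/
lemma GoodRun.goodProposal_of_large (h : GoodRun ord G I ω) {r₀ : Fin (p.numIdx n)}
    (hrI : r₀ ∈ I) (hr0 : (r₀ : ℕ) = 0) (hb : 2 * n + 24 * noiseUnit p n ≤ p.b) (θ : ℝ)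
    (i : Fin n) : GoodProposal ord G ω θ i := by
  refine h.goodProposal_of_chooseIdx_eq_zero hrI hr0 (chooseIdx_eq_iff.2 ⟨fun r hr => ?_,
    fun r hr => ?_⟩) θ
  · rw [WithTop.coe_lt_coe, Fin.lt_def, hr0] at hr
    exact absurd hr (Nat.not_lt_zero _)
  · obtain rfl := WithTop.coe_injective hr
    by_contra hcon
    have h1 := h.lt_of_not_passesTest hrI hcon
    have h2 := card_finset_le ord ((midState ord G ω i).M (ord i))
    have h3 := card_finset_le ord (proposalSet ord G ω i (midState ord G ω i).A r₀)
    linarith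

/-- The test fails for the index before the one that is chosen (or, if none is chosen, for the
last index), so the corresponding set together with `M(v_i)` has almost `b` elements. As the
sizes for consecutive indices differ by a factor of about `1 + η`, the chosen set is large as
well. -/
lemma GoodRun.goodProposal_of_all_mem (hη : p.eta ∈ Set.Ioo (0 : ℝ) 1) (hc : 0 ≤ p.c)
    (h : GoodRun ord G I ω) (hI : ∀ r, r ∈ I) {θ : ℝ}
    (h1 : θ + 24 * noiseUnit p n + 2 + 3 * (p.c * Real.log n) / p.eta ≤ p.b)
    (h2 : (1 + p.eta) ^ 2 / (1 - p.eta) * θ + 24 * noiseUnit p n +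
      3 * (p.c * Real.log n) / p.eta + 24 * (p.c * Real.log n) / p.eta ^ 2 ≤ p.b)
    (i : Fin n) : GoodProposal ord G ω θ i := by
  obtain ⟨hη0, hη1⟩ := hη
  have hL : 0 ≤ Real.log n := Real.log_natCast_nonneg n
  set s := midState ord G ω i with hs
  set m : ℝ := ((activeLater ord G i s).card : ℝ) with hm
  have hm0 : 0 ≤ m := by positivity
  have hn : 0 < n := i.pos
  cases hr : chooseIdx ord G ω i s with
  | top =>
    have hset : chosenSet ord G ω i s = ∅ := by rw [chosenSet, hr]; rfl
    rw [GoodProposal, ← hs, hset]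
    refine ⟨fun h => absurd h Finset.not_nonempty_empty, fun _ => ?_⟩
    let R : Fin (p.numIdx n) := ⟨⌈Real.logb (1 + p.eta) n⌉₊, Nat.lt_succ_self _⟩
    have hfail := h.lt_of_not_passesTest (hI R)
      ((chooseIdx_eq_iff.1 hr).1 R (WithTop.coe_lt_top _))
    have hup := h.upper i R (hI R)
    rw [UpperTail, ← hs, ← hm] at hup
    -- the last index is so large that the mean size of the corresponding set is at most one
    have hpow : ((1 + p.eta) ^ (R : ℕ))⁻¹ * m ≤ 1 := by
      have hmn : m ≤ n := card_finset_le ord _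
      have hpn : (n : ℝ) ≤ (1 + p.eta) ^ (R : ℕ) := by
        have h3 : Real.logb (1 + p.eta) n ≤ ((R : ℕ) : ℝ) := Nat.le_ceil _
        rw [Real.logb_le_iff_le_rpow (by linarith) (by exact_mod_cast hn)] at h3
        rwa [Real.rpow_natCast] at h3
      rw [inv_mul_le_iff₀ (by positivity)]
      linarith
    have h4 : (1 + p.eta) * (((1 + p.eta) ^ (R : ℕ))⁻¹ * m) ≤ 2 := by nlinarith
    simp only [Finset.card_empty, Nat.cast_zero, add_zero]
    linarith
  | coe r =>
    by_cases hr0 : (r : ℕ) = 0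
    · exact h.goodProposal_of_chooseIdx_eq_zero (hI r) hr0 hr θ
    rw [GoodProposal, ← hs, chosenSet_of_eq hr]
    refine ⟨fun _ => h.le_of_passesTest (hI r) ((chooseIdx_eq_iff.1 hr).2 r rfl), fun _ => ?_⟩
    obtain ⟨k, hk⟩ := Nat.exists_eq_succ_of_ne_zero hr0
    let q : Fin (p.numIdx n) := ⟨k, by omega⟩
    have hfail := h.lt_of_not_passesTest (hI q) ((chooseIdx_eq_iff.1 hr).1 q
      (WithTop.coe_lt_coe.2 (Fin.lt_def.2 (by simp only [q]; omega))))
    have hup := h.upper i q (hI q)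
    have hlo := h.lower i r (hI r)
    rw [UpperTail, ← hs, ← hm] at hup
    rw [LowerTail, ← hs, ← hm] at hlo
    set μ : ℝ := ((1 + p.eta) ^ (r : ℕ))⁻¹ * m with hμ
    have hμ0 : 0 ≤ μ := by positivity
    have hq : ((1 + p.eta) ^ (q : ℕ))⁻¹ * m = (1 + p.eta) * μ := by
      have hne : (1 + p.eta) ≠ 0 := by positivity
      rw [hμ, hk, pow_succ]
      simp only [q]
      field_simp
    rw [hq] at hup
    set X : ℝ := ((proposalSet ord G ω i s.A r).card : ℝ)
    set Y : ℝ := ((proposalSet ord G ω i s.A q).card : ℝ)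
    set d : ℝ := ((s.M (ord i)).card : ℝ)
    have hd : 0 ≤ d := by positivity
    have hη' : 0 < 1 - p.eta := by linarith
    rw [div_mul_eq_mul_div] at h2
    have ha : 24 * (p.c * Real.log n) / p.eta ^ 2 =
        4 * (6 * (p.c * Real.log n) / p.eta ^ 2) := by ring
    rw [ha] at h2
    have ha0 : 0 ≤ 6 * (p.c * Real.log n) / p.eta ^ 2 := by positivity
    set a := 3 * (p.c * Real.log n) / p.eta
    set a' := 6 * (p.c * Real.log n) / p.eta ^ 2
    have h3 : (1 + p.eta) ^ 2 * θ / (1 - p.eta) ≤ d + (1 + p.eta) ^ 2 * μ - 4 * a' := by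
      nlinarith
    rw [div_le_iff₀ hη'] at h3
    have hsq : 0 < (1 + p.eta) ^ 2 := by positivity
    have hsq4 : (1 + p.eta) ^ 2 ≤ 4 := by nlinarith
    have hlo' := mul_le_mul_of_nonneg_left hlo hsq.le
    have h5 : (1 - p.eta) * ((1 + p.eta) ^ 2 * a') ≤ (1 - p.eta) * (4 * a') := by gcongr
    have h6 : (1 - p.eta) * d ≤ (1 + p.eta) ^ 2 * d := by
      gcongr
      nlinarith
    have h7 : (1 + p.eta) ^ 2 * θ ≤ (1 + p.eta) ^ 2 * (d + X) := by nlinarith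
    exact le_of_mul_le_mul_left h7 hsq

end GoodProposals

/-! ### The probability of success -/

section Success

variable {p : Params} {V : Type*} [Fintype V] {n : ℕ}

/-- The number of events in the union bound is at most `n ^ 5`, and
`n ^ 5 * n ^ (-3 c) ≤ n ^ (-c)` as `3 ≤ c`. -/
lemma mul_tailBound_le (hn : 2 ≤ n) (hc : 3 ≤ p.c) {k : ℕ} (hk : k ≤ 2 * n) :
    ((n + n * n + n + n * k + n * k + n * k : ℕ) : ℝ≥0∞) * tailBound p n ≤
      ENNReal.ofReal (1 / (n : ℝ) ^ p.c) := by
  have hn0 : (0 : ℝ) < n := by positivity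
  have h1 : n + n * n + n + n * k + n * k + n * k ≤ n ^ 5 := by
    have : n * k ≤ n * (2 * n) := Nat.mul_le_mul_left n hk
    have h4 : n * n * (2 * 2 * 2) ≤ n * n * (n * n * n) := by gcongr
    have h5 : 2 * n ≤ n * n := Nat.mul_le_mul_right n hn
    nlinarith
  have h2 : ((n + n * n + n + n * k + n * k + n * k : ℕ) : ℝ) ≤ (n : ℝ) ^ (5 : ℕ) := by
    exact_mod_cast h1
  rw [tailBound, ← ENNReal.ofReal_natCast, ← ENNReal.ofReal_mul (by positivity)]
  refine ENNReal.ofReal_le_ofReal ?_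
  refine (mul_le_mul_of_nonneg_right h2 (Real.exp_pos _).le).trans ?_
  have h3 : Real.exp (-(3 * (p.c * Real.log n))) = (n : ℝ) ^ (-(3 * p.c)) := by
    rw [Real.rpow_def_of_pos hn0]
    congr 1
    ring
  rw [h3, ← Real.rpow_natCast, ← Real.rpow_add hn0, one_div, ← Real.rpow_neg hn0.le]
  refine Real.rpow_le_rpow_of_exponent_le (by exact_mod_cast (by omega : 1 ≤ n)) ?_
  push_cast
  linarith

/-- The unit `c ln(n) / (η² ε)` in which the loss of capacity is measured. -/
def lossUnit (p : Params) (n : ℕ) : ℝ := p.c * Real.log n / (p.eta ^ 2 * p.eps)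

lemma eps'_pos (hη : 0 < p.eta) (hε : 0 < p.eps) : 0 < p.eps' := by
  unfold Params.eps'
  positivity

lemma noiseUnit_eq (hη : 0 < p.eta) (hε : 0 < p.eps) :
    noiseUnit p n = 2 * (1 + 2 * p.eta) * p.eta * lossUnit p n := by
  unfold noiseUnit lossUnit Params.eps'
  field_simp

lemma c_mul_log_eq (hη : 0 < p.eta) (hε : 0 < p.eps) :
    p.c * Real.log n = p.eta ^ 2 * p.eps * lossUnit p n := by
  unfold lossUnit
  field_simp

lemma two_le_lossUnit (hη : p.eta ∈ Set.Ioo (0 : ℝ) 1) (hε : p.eps ∈ Set.Ioo (0 : ℝ) 1)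
    (hc : 3 ≤ p.c) (hn : 2 ≤ n) : 2 ≤ lossUnit p n := by
  obtain ⟨hη0, hη1⟩ := hη
  obtain ⟨hε0, hε1⟩ := hε
  have hL : Real.log 2 ≤ Real.log n := Real.log_le_log (by norm_num) (by exact_mod_cast hn)
  have h2 := Real.log_two_gt_d9
  have h3 : p.eta ^ 2 * p.eps ≤ 1 := mul_le_one₀ (pow_le_one₀ hη0.le hη1.le) hε0.le hε1.le
  unfold lossUnit
  rw [le_div_iff₀ (by positivity)]
  nlinarith

lemma numIdx_le (hη : p.eta ∈ Set.Ioo (0 : ℝ) 1) (hn : 2 ≤ n)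
    (h : 2 * Real.log n / p.eta ≤ n) : p.numIdx n ≤ 2 * n := by
  obtain ⟨hη0, hη1⟩ := hη
  have hL : 0 ≤ Real.log n := Real.log_natCast_nonneg n
  have hlog : p.eta / 2 ≤ Real.log (1 + p.eta) := by
    refine le_trans ?_ (Real.one_sub_inv_le_log_of_pos (by linarith))
    have h1 : 1 - (1 + p.eta)⁻¹ = p.eta / (1 + p.eta) := by field_simp; ring
    rw [h1]
    gcongr
    linarith
  have h1 : Real.logb (1 + p.eta) n ≤ n := by
    refine le_trans ?_ h
    rw [Real.logb, div_le_div_iff₀ (by linarith) hη0]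
    nlinarith
  have h2 : ⌈Real.logb (1 + p.eta) n⌉₊ ≤ n := Nat.ceil_le.2 h1
  unfold Params.numIdx
  omega

/-- If the capacity is at least `576` units of loss, then with high probability the noises in the
checks are small and all proposals are good. Either the capacity is so large that only the index
`0` matters, or there are at most `2 n` indices. -/
theorem success_probability (hη : p.eta ∈ Set.Ioo (0 : ℝ) 1) (hε : p.eps ∈ Set.Ioo (0 : ℝ) 1)
    (hc : 3 ≤ p.c) (hn : 2 ≤ n) (ord : Fin n ≃ V) (G : SimpleGraph V)
    (hb : 576 * lossUnit p n ≤ p.b) {θ : ℝ}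
    (h1 : θ + 24 * noiseUnit p n + 2 + 3 * (p.c * Real.log n) / p.eta ≤ p.b)
    (h2 : (1 + p.eta) ^ 2 / (1 - p.eta) * θ + 24 * noiseUnit p n +
      3 * (p.c * Real.log n) / p.eta + 24 * (p.c * Real.log n) / p.eta ^ 2 ≤ p.b) :
    ENNReal.ofReal (1 - 1 / (n : ℝ) ^ p.c) ≤ randomnessLaw p V n
      {ω | SmallCheckNoise ω ∧ ∀ i, GoodProposal ord G ω θ i} := by
  have hε' := eps'_pos hη.1 hε.1
  have hc0 : 0 ≤ p.c := by linarith
  have := isProbabilityMeasure_randomnessLaw (V := V) (n := n) hη.1.le hε'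
  -- `I` is the set of indices that matter
  obtain ⟨I, hI, hgood⟩ : ∃ I : Finset (Fin (p.numIdx n)), I.card ≤ 2 * n ∧
      ∀ ω : Randomness p V n, GoodRun ord G I ω → ∀ i, GoodProposal ord G ω θ i := by
    by_cases hlarge : 2 * n + 24 * noiseUnit p n ≤ p.b
    · exact ⟨{⟨0, Nat.succ_pos _⟩}, by simp; omega, fun ω h i =>
        h.goodProposal_of_large (Finset.mem_singleton_self _) rfl hlarge θ i⟩
    · refine ⟨Finset.univ, ?_, fun ω h i =>
        h.goodProposal_of_all_mem hη hc0 (fun _ => Finset.mem_univ _) h1 h2 i⟩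
      rw [Finset.card_univ, Fintype.card_fin]
      refine numIdx_le hη hn ?_
      obtain ⟨hη0, hη1⟩ := hη
      obtain ⟨hε0, hε1⟩ := hε
      rw [noiseUnit_eq hη0 hε0] at hlarge
      have hQ := two_le_lossUnit ⟨hη0, hη1⟩ ⟨hε0, hε1⟩ hc hn
      set Q := lossUnit p n with hQdef
      have h3 : 2 * (1 + 2 * p.eta) * p.eta * Q ≤ 6 * Q := by
        gcongr
        nlinarith
      have h4 : Q ≤ n := by linarith
      refine le_trans ?_ h4
      have hlog := c_mul_log_eq (n := n) hη0 hε0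
      rw [← hQdef] at hlog
      have hL : 0 ≤ Real.log n := Real.log_natCast_nonneg n
      rw [div_le_iff₀ hη0]
      have h5 : p.eta * (p.eta * p.eps) * Q ≤ p.eta * 1 * Q := by
        gcongr
        exact mul_le_one₀ hη1.le hε0.le hε1.le
      nlinarith
  have h3 := randomnessLaw_not_goodRun_le hη hε' hc0 ord G I
  have h4 := h3.trans (mul_tailBound_le hn hc hI)
  have h5 : 1 ≤ randomnessLaw p V n {ω | SmallCheckNoise ω ∧ ∀ i, GoodProposal ord G ω θ i} +
      ENNReal.ofReal (1 / (n : ℝ) ^ p.c) := by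
    rw [← measure_univ (μ := randomnessLaw p V n)]
    refine (measure_mono ?_).trans ((measure_union_le _ {ω | ¬ GoodRun ord G I ω}).trans
      (add_le_add le_rfl h4))
    intro ω _
    by_cases hω : GoodRun ord G I ω
    · exact Or.inl ⟨hω.smallCheckNoise, hgood ω hω⟩
    · exact Or.inr hω
  rw [ENNReal.ofReal_sub _ (by positivity), ENNReal.ofReal_one]
  exact tsub_le_iff_right.2 h5

/-- With high probability, the decoded graph is a `b`-matching which approximates the largest
`k`-matchings up to a factor `2 κ`, whenever `k ≤ κ θ` and the capacity exceeds `θ` by enough. -/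
theorem approximation_probability (hη : p.eta ∈ Set.Ioo (0 : ℝ) 1)
    (hε : p.eps ∈ Set.Ioo (0 : ℝ) 1) (hc : 3 ≤ p.c) (ord : Fin n ≃ V) (G : SimpleGraph V)
    {θ κ : ℝ} {k : ℕ} (hκ : 1 ≤ κ) (hk : (k : ℝ) ≤ κ * θ)
    (hb : 576 * lossUnit p n ≤ p.b) (h0 : θ + 72 * noiseUnit p n ≤ p.b)
    (h1 : 2 ≤ lossUnit p n →
      θ + 24 * noiseUnit p n + 2 + 3 * (p.c * Real.log n) / p.eta ≤ p.b)
    (h2 : (1 + p.eta) ^ 2 / (1 - p.eta) * θ + 24 * noiseUnit p n +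
      3 * (p.c * Real.log n) / p.eta + 24 * (p.c * Real.log n) / p.eta ^ 2 ≤ p.b) :
    ENNReal.ofReal (1 - 1 / (n : ℝ) ^ p.c) ≤ billboardLaw p ord G
      {B | IsBMatching G p.b (B.decode ord G) ∧
        (optBMatching G k : ℝ) ≤ 2 * κ * ((B.decode ord G).edgeSet.ncard : ℝ)} := by
  have hε' := eps'_pos hη.1 hε.1
  have := isProbabilityMeasure_randomnessLaw (V := V) (n := n) hη.1.le hε'
  have hsub : ∀ ω : Randomness p V n, (SmallCheckNoise ω ∧ ∀ i, GoodProposal ord G ω θ i) →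
      IsBMatching G p.b ((billboard ord G ω).decode ord G) ∧ (optBMatching G k : ℝ) ≤
        2 * κ * (((billboard ord G ω).decode ord G).edgeSet.ncard : ℝ) := by
    rintro ω ⟨hω, hgood⟩
    obtain ⟨hm, hcov⟩ := isBMatching_and_cover hω h0 fun i _ => hgood i
    exact ⟨hm, optBMatching_le_of_cover hκ hk hcov⟩
  rcases Nat.lt_or_ge n 2 with hn | hn
  · interval_cases n
    · -- without vertices, all runs are good
      have huniv : {ω : Randomness p V 0 | billboard ord G ω ∈
          {B : Billboard p V 0 | IsBMatching G p.b (B.decode ord G) ∧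
          (optBMatching G k : ℝ) ≤ 2 * κ * ((B.decode ord G).edgeSet.ncard : ℝ)}} =
          Set.univ := by
        have hV : IsEmpty V := ord.symm.isEmpty
        refine Set.eq_univ_of_forall fun ω => ?_
        exact hsub ω ⟨⟨fun u => isEmptyElim u, fun i => i.elim0⟩, fun i => i.elim0⟩
      rw [billboardLaw, huniv, measure_univ]
      exact ENNReal.ofReal_le_one.2 (sub_le_self _ (by positivity))
    · simp
  · refine (success_probability hη hε hc hn ord G hb (h1 (two_le_lossUnit hη hε hc hn)) h2).trans
      (measure_mono fun ω hω => hsub ω hω)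

end Success

end PrivateMatching

end

theorem mainTheorem4 {V : Type*} [Fintype V] (n : ℕ) (ord : Fin n ≃ V)
    (ε η c : ℝ) (hε : ε ∈ Set.Ioo (0 : ℝ) 1) (hη : η ∈ Set.Ioo (0 : ℝ) 1) (hc : 3 ≤ c) (b : ℕ) :
    -- the algorithm is `ε`-LEDP
    PrivateMatching.IsLEDP ε
      (fun G => PrivateMatching.billboardLaw ⟨ε, η, c, b⟩ ord G) ∧
    -- the sets `M(v)` of the algorithm are what the nodes decode from the billboard
    (∀ (G : SimpleGraph V) (ω : PrivateMatching.Randomness ⟨ε, η, c, b⟩ V n) (v : V),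
      ((PrivateMatching.run ord G ω).M v : Set V) =
        (((PrivateMatching.billboard ord G ω).decode ord G).neighborSet v)) ∧
    -- bicriteria guarantee
    (∀ b' : ℕ, 1 ≤ b' →
      (1 + η) ^ 2 / (1 - η) * b' + 576 * c * Real.log n / (η ^ 2 * ε) ≤ b →
      ∀ G : SimpleGraph V,
        ENNReal.ofReal (1 - 1 / (n : ℝ) ^ c) ≤
          PrivateMatching.billboardLaw ⟨ε, η, c, b⟩ ord G
            {B | PrivateMatching.IsBMatching G b (B.decode ord G) ∧
              (1 / 2 : ℝ) * PrivateMatching.optBMatching G b' ≤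
                ((B.decode ord G).edgeSet.ncard : ℝ)}) ∧
    -- approximation of a maximum `b`-matching
    (η < 1 / 2 → 576 * c * Real.log n / (η ^ 3 * ε) ≤ b →
      ∀ G : SimpleGraph V,
        ENNReal.ofReal (1 - 1 / (n : ℝ) ^ c) ≤
          PrivateMatching.billboardLaw ⟨ε, η, c, b⟩ ord G
            {B | PrivateMatching.IsBMatching G b (B.decode ord G) ∧
              (PrivateMatching.optBMatching G b : ℝ) ≤
                (2 + 24 * η) * ((B.decode ord G).edgeSet.ncard : ℝ)}) := by
  obtain ⟨hε0, hε1⟩ := hε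
  obtain ⟨hη0, hη1⟩ := hη
  let p : PrivateMatching.Params := ⟨ε, η, c, b⟩
  have hε' : 0 < p.eps' := PrivateMatching.eps'_pos (p := p) hη0 hε0
  have hL : 0 ≤ Real.log n := Real.log_natCast_nonneg n
  set Q := PrivateMatching.lossUnit p n with hQ
  have hQ0 : 0 ≤ Q := by
    have : 0 ≤ c := by linarith
    rw [hQ, PrivateMatching.lossUnit]
    positivity
  have hQ' : c * Real.log n / (η ^ 2 * ε) = Q := rfl
  have hK : PrivateMatching.noiseUnit p n = 2 * (1 + 2 * η) * η * Q :=
    PrivateMatching.noiseUnit_eq (p := p) hη0 hε0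
  have hlog : c * Real.log n = η ^ 2 * ε * Q := PrivateMatching.c_mul_log_eq (p := p) hη0 hε0
  have ha : 3 * (c * Real.log n) / η = 3 * (η * ε) * Q := by
    rw [hlog]; field_simp
  have ha' : 24 * (c * Real.log n) / η ^ 2 = 24 * ε * Q := by
    rw [hlog]; field_simp
  have e1 : 3 * (η * ε) * Q ≤ 3 * (η * 1) * Q := by gcongr
  have e2 : 24 * ε * Q ≤ 24 * 1 * Q := by gcongr
  refine ⟨PrivateMatching.isLEDP_billboardLaw (p := p) hη0.le hε' ?_ ord,
    fun G ω v => PrivateMatching.run_M_eq_decode ord G ω v, ?_, ?_⟩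
  · have : p.eps' = ε / (2 * (1 + 2 * η) / η) := rfl
    rw [this, div_div_eq_mul_div, ← mul_div_assoc, div_le_iff₀ (by positivity)]
    nlinarith
  · intro b' hb' hb G
    have hb1 : (1 : ℝ) ≤ b' := by exact_mod_cast hb'
    have h576 : 576 * c * Real.log n / (η ^ 2 * ε) = 576 * Q := by
      rw [← hQ']; ring
    rw [h576] at hb
    have hfac : (1 : ℝ) * b' ≤ (1 + η) ^ 2 / (1 - η) * b' := by
      gcongr
      rw [le_div_iff₀ (by linarith)]
      nlinarith
    have e3 : 2 * (1 + 2 * η) * η * Q ≤ 6 * Q := by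
      gcongr
      nlinarith
    have e4 : 3 * (η * 1) * Q ≤ 3 * (1 * 1) * Q := by gcongr
    have h := PrivateMatching.approximation_probability (p := p) ⟨hη0, hη1⟩ ⟨hε0, hε1⟩ hc ord G
      (θ := b') (κ := 1) (k := b') le_rfl (by simp)
      (show 576 * Q ≤ b by linarith)
      (show (b' : ℝ) + 72 * PrivateMatching.noiseUnit p n ≤ b by rw [hK]; linarith)
      (fun hQ2 => show (b' : ℝ) + 24 * PrivateMatching.noiseUnit p n + 2 +
        3 * (c * Real.log n) / η ≤ b by
          change 2 ≤ Q at hQ2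
          rw [hK, ha]; linarith)
      (show (1 + η) ^ 2 / (1 - η) * b' + 24 * PrivateMatching.noiseUnit p n +
        3 * (c * Real.log n) / η + 24 * (c * Real.log n) / η ^ 2 ≤ b by
          rw [hK, ha, ha']; linarith)
    refine h.trans (MeasureTheory.measure_mono fun ω hω => ⟨hω.1, ?_⟩)
    have := hω.2
    linarith
  · intro hη2 hb G
    -- `Q` is at most the fraction `η / 576` of the capacity
    have hQb : 576 * Q ≤ η * b := by
      have : 576 * c * Real.log n / (η ^ 3 * ε) = 576 * Q / η := by
        rw [← hQ']; field_simp
      rw [this, div_le_iff₀ hη0] at hb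
      linarith
    have hb0 : (0 : ℝ) ≤ b := by positivity
    have hηb : η * b ≤ 1 / 2 * b := by gcongr
    have e3 : 2 * (1 + 2 * η) * η * Q ≤ 2 * Q := by
      gcongr
      nlinarith
    have e4 : 3 * (η * 1) * Q ≤ 3 * (1 / 2 * 1) * Q := by gcongr
    have hden : 0 < 1 + 12 * η := by linarith
    have hθ : (b : ℝ) / (1 + 12 * η) ≤ b - η * b := by
      rw [div_le_iff₀ hden]
      nlinarith [mul_nonneg hb0 hη0.le]
    have hθ' : (1 + η) ^ 2 / (1 - η) * (b / (1 + 12 * η)) ≤ b - 3 / 10 * (η * b) := by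
      rw [div_mul_div_comm, div_le_iff₀ (mul_pos (by linarith) hden)]
      have : (1 + η) ^ 2 ≤ (1 - 3 / 10 * η) * ((1 - η) * (1 + 12 * η)) := by
        nlinarith [mul_pos hη0 hη0, mul_pos hη0 (sub_pos.2 hη2), pow_pos hη0 3]
      nlinarith [mul_le_mul_of_nonneg_right this hb0]
    have h := PrivateMatching.approximation_probability (p := p) ⟨hη0, hη1⟩ ⟨hε0, hε1⟩ hc ord G
      (θ := b / (1 + 12 * η)) (κ := 1 + 12 * η) (k := b) (by linarith)
      (by rw [mul_div_cancel₀ _ hden.ne'])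
      (show 576 * Q ≤ b by linarith)
      (show (b : ℝ) / (1 + 12 * η) + 72 * PrivateMatching.noiseUnit p n ≤ b by rw [hK]; linarith)
      (fun hQ2 => show (b : ℝ) / (1 + 12 * η) + 24 * PrivateMatching.noiseUnit p n + 2 +
        3 * (c * Real.log n) / η ≤ b by
          change 2 ≤ Q at hQ2
          rw [hK, ha]; linarith)
      (show (1 + η) ^ 2 / (1 - η) * (b / (1 + 12 * η)) + 24 * PrivateMatching.noiseUnit p n +
        3 * (c * Real.log n) / η + 24 * (c * Real.log n) / η ^ 2 ≤ b by
          rw [hK, ha, ha']; linarith)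
    refine h.trans (MeasureTheory.measure_mono fun ω hω => ⟨hω.1, ?_⟩)
    have := hω.2
    linarith
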